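/- A weight sequence is a sequence $w=(w(k))_{k\ge 0}$ with values in $(0,\infty)$; extend it to a function $w:[0,\infty)\to(0,\infty)$ by linear interpolation, put $W(x)=\int_0^x \frac{du}{w(u)}$, let $W^{-1}$ be the inverse of $W$ on $[0,\infty)$ (below, $W$ is an increasing bijection of $[0,\infty)$), and for $f:[0,\infty)\to[0,\infty)$ measurable put $$G(f)(x)=\int_0^x \frac{w(W^{-1}(f(u)))}{w(W^{-1}(u))}\,du .$$ For $\eta\in(0,1)$ let $i_\eta(w)=\inf\{n\ge 2 : G^{(n-1)}(\eta\,\mathrm{Id})\text{ is bounded}\}$, where $G^{(n)}$ is the $n$-fold iterate of $G$ and $\inf\emptyset=+\infty$, and let $i_-(w)$ and $i_+(w)$ be the left and right limits of $\eta\mapsto i_\eta(w)$ at $\eta=1/2$. The vertex reinforced random walk (VRRW) with weight sequence $w$ is the process $(X_n)_{n\ge0}$ on $\mathbb Z$ with $X_0=0$ and $$\mathbb P\{X_{n+1}=X_n\pm 1\mid X_0,\dots,X_n\}=\frac{w(Z_n(X_n\pm1))}{w(Z_n(X_n-1))+w(Z_n(X_n+1))},\qquad Z_n(y)=\#\{0\le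 i\le n: X_i=y\}.$$ It localizes if the set of sites it visits is finite; $R$ denotes the set of sites visited infinitely often. (a) Let $\alpha\in(0,1)$ and let $w$ be a non-decreasing weight sequence with $w(k)\sim k/\exp(\log^\alpha k)$ as $k\to\infty$. Then the limits $i_-(w)$ and $i_+(w)$ exist and are both finite. Moreover, for every integer $n\ge1$, if $\alpha\in\left(\frac{n-1}{n},\frac{n}{n+1}\right)$, then $i_-(w)=i_+(w)=n+1$. (b) For every odd integer $N\ge5$ there are $\alpha\in(0,1)$ and a non-decreasing weight sequence $w$ with $w(k)\sim k/\exp(\log^\alpha k)$ as $k\to\infty$ such that the VRRW with weight sequence $w$ localizes on exactly $N$ sites with positive probability: with positive probability it localizes and $|R|=N$. -/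

import Mathlib

open Set Filter Topology MeasureTheory

namespace VRRW

noncomputable section

/-- The weight function on `[0, ∞)` attached to a weight sequence by linear interpolation
(only its values at `x ≥ 0` are ever used). -/
def weightFun (w : ℕ → ℝ) (x : ℝ) : ℝ :=
  w ⌊x⌋₊ + (x - (⌊x⌋₊ : ℝ)) * (w (⌊x⌋₊ + 1) - w ⌊x⌋₊)

/-- `W(x) = ∫₀ˣ du / w(u)`. -/
def bigW (w : ℕ → ℝ) (x : ℝ) : ℝ :=
  ∫ u in (0 : ℝ)..x, 1 / weightFun w u

/-- The inverse of `W : [0, ∞) → [0, ∞)`. -/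
def bigWInv (w : ℕ → ℝ) : ℝ → ℝ :=
  Function.invFunOn (bigW w) (Ici 0)

/-- The operator `G(f)(x) = ∫₀ˣ w(W⁻¹(f(u))) / w(W⁻¹(u)) du`. -/
def opG (w : ℕ → ℝ) (f : ℝ → ℝ) (x : ℝ) : ℝ :=
  ∫ u in (0 : ℝ)..x, weightFun w (bigWInv w (f u)) / weightFun w (bigWInv w u)

/-- Boundedness on the half-line `[0, ∞)`. -/
def BoundedOnHalfLine (f : ℝ → ℝ) : Prop :=
  ∃ C : ℝ, ∀ x : ℝ, 0 ≤ x → |f x| ≤ C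

/-- `i_η(w) = inf {n ≥ 2 : G^{(n-1)}(η Id) is bounded}`, with `inf ∅ = ∞`. -/
def iIndex (w : ℕ → ℝ) (η : ℝ) : ℕ∞ :=
  ⨅ (n : ℕ) (_ : 2 ≤ n ∧ BoundedOnHalfLine ((opG w)^[n - 1] (fun x => η * x))), (n : ℕ∞)

/-- `i_-(w)`, the left limit of `η ↦ i_η(w)` at `1/2`. -/
def iMinus (w : ℕ → ℝ) : ℕ∞ := Function.leftLim (iIndex w) (1 / 2)

/-- `i_+(w)`, the right limit of `η ↦ i_η(w)` at `1/2`. -/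
def iPlus (w : ℕ → ℝ) : ℕ∞ := Function.rightLim (iIndex w) (1 / 2)

/-- `Z_n(y)`, the number of visits of the path `x` to the site `y` up to time `n`. -/
def localTime (x : ℕ → ℤ) (n : ℕ) (y : ℤ) : ℕ :=
  ((Finset.range (n + 1)).filter (fun i => x i = y)).card

/-- The event that the process `X` follows the path `x` up to time `n`. -/
def history {Ω : Type*} (X : ℕ → Ω → ℤ) (x : ℕ → ℤ) (n : ℕ) : Set Ω :=
  {ω | ∀ i ≤ n, X i ω = x i}

/-- `X` is, under `P`, a vertex reinforced random walk on `ℤ` with weight sequence `w`, started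
from `0`: given `X_0, …, X_n`, it jumps to a neighbour of `X_n` with probability proportional to
the weight of the local time of that neighbour. -/
structure IsVRRW {Ω : Type*} [MeasurableSpace Ω] (P : Measure Ω) (w : ℕ → ℝ)
    (X : ℕ → Ω → ℤ) : Prop where
  measurable : ∀ n, Measurable (X n)
  start : ∀ᵐ ω ∂P, X 0 ω = 0
  jump_left : ∀ (n : ℕ) (x : ℕ → ℤ), P (history X x n) ≠ 0 →
    ProbabilityTheory.cond P (history X x n) {ω | X (n + 1) ω = x n - 1} =
      ENNReal.ofReal (w (localTime x n (x n - 1)) /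
        (w (localTime x n (x n - 1)) + w (localTime x n (x n + 1))))
  jump_right : ∀ (n : ℕ) (x : ℕ → ℤ), P (history X x n) ≠ 0 →
    ProbabilityTheory.cond P (history X x n) {ω | X (n + 1) ω = x n + 1} =
      ENNReal.ofReal (w (localTime x n (x n + 1)) /
        (w (localTime x n (x n - 1)) + w (localTime x n (x n + 1))))

/-- A path localizes if the set of sites which it visits is finite. -/
def Localizes (x : ℕ → ℤ) : Prop := (range x).Finite

/-- `R`, the set of sites which the path visits infinitely often. -/
def visitedInfinitelyOften (x : ℕ → ℤ) : Set ℤ := {y | ∃ᶠ n in atTop, x n = y}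

/-- `w` is a non-decreasing weight sequence (with values in `(0, ∞)`) such that
`w(k) ~ k / exp (log^α k)`. -/
structure IsLogPowerWeight (α : ℝ) (w : ℕ → ℝ) : Prop where
  pos : ∀ k, 0 < w k
  mono : Monotone w
  equiv : Asymptotics.IsEquivalent atTop w
    (fun k : ℕ => (k : ℝ) / Real.exp (Real.log (k : ℝ) ^ α))

end

end VRRW

/-! ### Power inequalities; the interpolated weight and W -/

namespace VRRW

noncomputable section

/-! Work in the logarithmic scale with V(l) = W(e^l). Since w(e^l) is of order exp(l - l^α), V grows
at a rate of order exp(l^α), so V(l) is exp(l^α) up to powers of l. Shifting l by l^a lowers l^α by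
an amount of order l^(a+α-1). Hence a factor η < 1 in front of V is worth a shift of exponent about
1-α, and a factor exp(-l^a) is worth a shift of exponent a + (1-α).

Part (a). Suppose f(W(e^l)) is about W(e^(l - l^a)). After the substitution u = W(y), y = e^l, the
integrand of G(f) is about exp(l^α - l^a) / y. If a < α, its integral is again W at a shifted point,
now with exponent a + (1-α); if a > α, the integrand is summable and G(f) is bounded. As η Id has
exponent 1-α, the m-th iterate has exponent (m+1)(1-α) up to arbitrarily small errors: it is
unbounded while (m+1)(1-α) < 1, and bounded once m(1-α) > α. See `upperProfile_opG`,
`lowerProfile_opG`, `bounded_opG`. The answer does not depend on η; monotonicity in η gives the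
one-sided limits for the critical α too.

Part (b). Write N = 2K+1 and choose α with α < (K-1)(1-α) < 1. The weighted number of jumps from y±1
to y, minus its compensator, is a martingale whose variance is controlled by the series of 1/w². So
W(Z(y)) follows, up to a constant, the sum of the compensators at y-1 and y+1. Started from a
symmetric profile with Z(±1) comparable to Z(0) and log Z(±k) about l - l^((k-1)(1-α)), l = log
Z(0), this mean field system keeps its shape: passing from one site to the next raises the exponent
as G does (`crude_of_balanced`, `lower_envelope`, `upper_envelope`). As (K-1)(1-α) < 1, the sites ±K
are visited infinitely often; as (K-1)(1-α) > α, the compensator of jumps out of ±K stays bounded by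
a small constant (`jumpComp_last_le`), and so does the chance of leaving [-K, K].

The two halves are tied together by `potential`: it is a supermartingale, nonnegative as long as the
path is tame, below 1 at the start and at least 1 at the first failure. Hence the path is tame
forever with positive probability (`measure_forall_tame_pos`). The initial profile is reached by an
explicit finite path. -/

theorem rpow_sub_rpow_le {α m l : ℝ} (h1 : α < 1) (hm : 0 ≤ m) (hml : m ≤ l)
    (hl : 0 < l) : l ^ α - m ^ α ≤ l ^ (α - 1) * (l - m) := by
  have e1 : l ^ α = l ^ (α - 1) * l := by
    rw [Real.rpow_sub_one hl.ne']; field_simp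
  have e2 : l ^ (α - 1) * m ≤ m ^ α := by
    rcases hm.eq_or_lt with rfl | hm
    · simp; positivity
    · have : m ^ α = m ^ (α - 1) * m := by
        rw [Real.rpow_sub_one hm.ne']; field_simp
      rw [this]
      gcongr ?_ * _
      exact Real.rpow_le_rpow_of_nonpos hm hml (by linarith)
  rw [e1]; nlinarith

/-- Bernoulli's inequality for m / l: a concave power lies below its tangent at l. A shift by l^b
thus costs l^α at least α l^(b+α-1), while `rpow_sub_rpow_le` caps the cost at l^(b+α-1). -/
theorem le_rpow_sub_rpow {α m l : ℝ} (h0 : 0 ≤ α) (h1 : α ≤ 1) (hm : 0 ≤ m)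
    (hl : 0 < l) : α * l ^ (α - 1) * (l - m) ≤ l ^ α - m ^ α := by
  have e1 : l ^ α = l ^ (α - 1) * l := by
    rw [Real.rpow_sub_one hl.ne']; field_simp
  have h := rpow_one_add_le_one_add_mul_self (s := m / l - 1) (p := α)
    (by have : 0 ≤ m / l := by positivity
        linarith) h0 h1
  have e2 : 1 + (m / l - 1) = m / l := by ring
  rw [e2, Real.div_rpow hm hl.le, div_le_iff₀ (by positivity)] at h
  have e3 : (1 + α * (m / l - 1)) * l ^ α = l ^ α - α * l ^ (α - 1) * (l - m) := by
    rw [e1]; field_simp; ring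
  linarith

/-- The slowly varying factor `exp (log^α x)`. -/
def slowFactor (α x : ℝ) : ℝ := Real.exp (Real.log x ^ α)

theorem slowFactor_pos (α x : ℝ) : 0 < slowFactor α x := Real.exp_pos _

theorem slowFactor_mono {α x y : ℝ} (h0 : 0 ≤ α) (hx : 1 ≤ x) (hxy : x ≤ y) :
    slowFactor α x ≤ slowFactor α y := by
  unfold slowFactor
  gcongr
  exact Real.log_nonneg hx

section Weight

variable {w : ℕ → ℝ}

theorem weightFun_natCast (w : ℕ → ℝ) (k : ℕ) : weightFun w k = w k := by
  simp [weightFun]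

theorem weightFun_of_mem (w : ℕ → ℝ) {k : ℕ} {x : ℝ} (h1 : (k : ℝ) ≤ x) (h2 : x ≤ k + 1) :
    weightFun w x = w k + (x - k) * (w (k + 1) - w k) := by
  rcases h2.eq_or_lt with rfl | h2
  · have : ((k : ℝ) + 1) = ((k + 1 : ℕ) : ℝ) := by push_cast; ring
    rw [this, weightFun_natCast]; push_cast; ring
  · have : ⌊x⌋₊ = k := by
      rw [Nat.floor_eq_iff (by have := Nat.cast_nonneg (α := ℝ) k; linarith)]
      exact ⟨h1, h2⟩
    rw [weightFun, this]

theorem weight_floor_le (hw : Monotone w) {x : ℝ} (hx : 0 ≤ x) :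
    w ⌊x⌋₊ ≤ weightFun w x := by
  have h1 := Nat.floor_le hx
  have h2 := hw (Nat.le_succ ⌊x⌋₊)
  simp only [Nat.succ_eq_add_one] at h2
  unfold weightFun; nlinarith

theorem weightFun_le (hw : Monotone w) {x : ℝ} :
    weightFun w x ≤ w (⌊x⌋₊ + 1) := by
  have h1 := (Nat.lt_floor_add_one x).le
  have h2 := hw (Nat.le_succ ⌊x⌋₊)
  simp only [Nat.succ_eq_add_one] at h2
  unfold weightFun; nlinarith

theorem weightFun_monotoneOn (hw : Monotone w) : MonotoneOn (weightFun w) (Ici 0) := by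
  intro x hx y hy hxy
  rcases (Nat.floor_mono hxy).eq_or_lt with h | h
  · have h2 := hw (Nat.le_succ ⌊y⌋₊)
    simp only [Nat.succ_eq_add_one] at h2
    unfold weightFun; rw [h]; nlinarith
  · calc weightFun w x ≤ w (⌊x⌋₊ + 1) := weightFun_le hw
      _ ≤ w ⌊y⌋₊ := hw h
      _ ≤ _ := weight_floor_le hw hy

theorem weightFun_pos (hp : ∀ k, 0 < w k) (hw : Monotone w) {x : ℝ} (hx : 0 ≤ x) :
    0 < weightFun w x := (hp _).trans_le (weight_floor_le hw hx)

theorem continuous_weightFun (w : ℕ → ℝ) : Continuous (weightFun w) := by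
  rw [continuous_iff_continuousAt]
  intro x
  by_cases hx : x < 1
  · have : weightFun w =ᶠ[𝓝 x] fun y => w 0 + y * (w 1 - w 0) := by
      filter_upwards [Iio_mem_nhds hx] with y hy
      have : ⌊y⌋₊ = 0 := Nat.floor_eq_zero.2 hy
      simp [weightFun, this]
    exact ContinuousAt.congr (by fun_prop) this.symm
  · push Not at hx
    obtain ⟨k, hk⟩ : ∃ k, ⌊x⌋₊ = k + 1 := ⟨⌊x⌋₊ - 1, by
      have := Nat.floor_pos.2 hx; omega⟩
    have h1 := Nat.floor_le (by linarith : 0 ≤ x)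
    have h2 := Nat.lt_floor_add_one x
    rw [hk] at h1 h2
    push_cast at h1 h2
    -- As k is one below the floor of x, the interval (k, k + 2) surrounds x even when x is an
    -- integer; on it the interpolation is a broken line whose only kink is at k + 1.
    have : weightFun w =ᶠ[𝓝 x] fun y => w (k + 1) + min (y - (k + 1)) 0 * (w (k + 1) - w k)
        + max (y - (k + 1)) 0 * (w (k + 2) - w (k + 1)) := by
      filter_upwards [Ioo_mem_nhds (by linarith : (k : ℝ) < x) h2] with y hy
      rcases le_total y (k + 1) with h | h
      · rw [weightFun_of_mem w hy.1.le h, min_eq_left (by linarith), max_eq_right (by linarith)]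
        ring
      · rw [weightFun_of_mem w (k := k + 1) (by push_cast; exact h) (by push_cast; exact hy.2.le),
          min_eq_right (by linarith), max_eq_left (by linarith)]
        push_cast; ring
    exact ContinuousAt.congr (by fun_prop) this.symm

theorem IsLogPowerWeight.bounds_nat {α : ℝ} (h : IsLogPowerWeight α w) :
    ∃ k0 : ℕ, ∀ k ≥ k0, (k : ℝ) / (2 * slowFactor α k) ≤ w k ∧ w k ≤ 2 * k / slowFactor α k := by
  have h1 := h.equiv.isLittleO.def (by norm_num : (0 : ℝ) < 1 / 2)
  obtain ⟨k0, hk0⟩ := eventually_atTop.1 h1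
  refine ⟨k0, fun k hk => ?_⟩
  have h2 := hk0 k hk
  simp only [Pi.sub_apply] at h2
  have hpos : 0 ≤ (k : ℝ) / slowFactor α k := by
    have := slowFactor_pos α k
    positivity
  change ‖w k - (k : ℝ) / slowFactor α k‖ ≤ 1 / 2 * ‖(k : ℝ) / slowFactor α k‖ at h2
  rw [Real.norm_of_nonneg hpos, Real.norm_eq_abs, abs_le] at h2
  have e1 : (k : ℝ) / (2 * slowFactor α k) = (k : ℝ) / slowFactor α k / 2 := by
    rw [div_div, mul_comm]
  have e2 : 2 * (k : ℝ) / slowFactor α k = 2 * ((k : ℝ) / slowFactor α k) := by ring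
  rw [e1, e2]
  constructor <;> linarith

theorem IsLogPowerWeight.bounds {α : ℝ} (h : IsLogPowerWeight α w) (h0 : 0 ≤ α) :
    ∃ x0 : ℝ, 3 ≤ x0 ∧ ∀ x ≥ x0, x / (4 * slowFactor α x) ≤ weightFun w x ∧
      weightFun w x ≤ 4 * x / slowFactor α x := by
  obtain ⟨k0, hk0⟩ := h.bounds_nat
  -- Replacing x by an adjacent integer costs at most a factor 2, which turns the 2 of `bounds_nat`
  -- into 4. The threshold keeps the floor at least 1, where `slowFactor` is monotone.
  refine ⟨max 3 (k0 + 1), le_max_left _ _, fun x hx => ?_⟩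
  have hx3 : 3 ≤ x := (le_max_left _ _).trans hx
  have hxk : (k0 : ℝ) + 1 ≤ x := (le_max_right _ _).trans hx
  have h1 := Nat.floor_le (by linarith : 0 ≤ x)
  have h2 := Nat.lt_floor_add_one x
  have hk : k0 ≤ ⌊x⌋₊ := by
    apply Nat.le_floor; linarith
  have hf : (1 : ℝ) ≤ ⌊x⌋₊ := by
    have : 1 ≤ ⌊x⌋₊ := Nat.le_floor (by push_cast; linarith)
    exact_mod_cast this
  constructor
  · refine le_trans ?_ (weight_floor_le h.mono (by linarith))
    refine le_trans ?_ (hk0 _ hk).1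
    have hs := slowFactor_mono h0 hf h1
    have := slowFactor_pos α (⌊x⌋₊ : ℝ)
    rw [div_le_div_iff₀ (by have := slowFactor_pos α x; positivity) (by positivity)]
    have h5 : 0 ≤ slowFactor α x := (slowFactor_pos α x).le
    calc x * (2 * slowFactor α ⌊x⌋₊) ≤ x * (2 * slowFactor α x) := by gcongr
      _ ≤ (2 * ⌊x⌋₊) * (2 * slowFactor α x) := by gcongr; linarith
      _ = _ := by ring
  · refine (weightFun_le h.mono).trans ?_
    refine (hk0 _ (by omega)).2.trans ?_
    push_cast
    have hs : slowFactor α x ≤ slowFactor α (⌊x⌋₊ + 1) :=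
      slowFactor_mono h0 (by linarith) h2.le
    have := slowFactor_pos α x
    gcongr ?_ / ?_
    linarith

theorem hasDerivAt_bigW (hp : ∀ k, 0 < w k) (hw : Monotone w) {x : ℝ} (hx : 0 ≤ x) :
    HasDerivAt (bigW w) (1 / weightFun w x) x := by
  have hcont : ∀ y, 0 ≤ y → ContinuousAt (fun u => 1 / weightFun w u) y := fun y hy =>
    continuousAt_const.div (continuous_weightFun w).continuousAt (weightFun_pos hp hw hy).ne'
  apply intervalIntegral.integral_hasDerivAt_right
  · apply ContinuousOn.intervalIntegrable
    intro y hy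
    rw [uIcc_of_le hx] at hy
    exact (hcont y hy.1).continuousWithinAt
  · exact (Measurable.stronglyMeasurable (by
      have := (continuous_weightFun w).measurable
      fun_prop)).stronglyMeasurableAtFilter
  · exact hcont x hx

theorem bigW_zero (w : ℕ → ℝ) : bigW w 0 = 0 := by simp [bigW]

theorem continuousOn_bigW (hp : ∀ k, 0 < w k) (hw : Monotone w) :
    ContinuousOn (bigW w) (Ici 0) :=
  fun _ hx => (hasDerivAt_bigW hp hw hx).continuousAt.continuousWithinAt

theorem strictMonoOn_bigW (hp : ∀ k, 0 < w k) (hw : Monotone w) :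
    StrictMonoOn (bigW w) (Ici 0) := by
  apply strictMonoOn_of_deriv_pos (convex_Ici 0) (continuousOn_bigW hp hw)
  intro x hx
  rw [interior_Ici] at hx
  rw [(hasDerivAt_bigW hp hw (le_of_lt hx)).deriv]
  have := weightFun_pos hp hw (le_of_lt hx)
  positivity

theorem bigW_le_iff (hp : ∀ k, 0 < w k) (hw : Monotone w) {x y : ℝ} (hx : 0 ≤ x) (hy : 0 ≤ y) :
    bigW w x ≤ bigW w y ↔ x ≤ y := (strictMonoOn_bigW hp hw).le_iff_le hx hy

theorem bigW_nonneg (hp : ∀ k, 0 < w k) (hw : Monotone w) {x : ℝ} (hx : 0 ≤ x) :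
    0 ≤ bigW w x := by
  rw [← bigW_zero w, bigW_le_iff hp hw le_rfl hx]; exact hx

theorem bigW_sub_eq (hp : ∀ k, 0 < w k) (hw : Monotone w) {x y : ℝ} (hx : 0 ≤ x) (hxy : x ≤ y) :
    bigW w y - bigW w x = ∫ u in x..y, 1 / weightFun w u := by
  unfold bigW
  rw [intervalIntegral.integral_interval_sub_left]
  all_goals
    apply ContinuousOn.intervalIntegrable
    intro z hz
    refine (continuousAt_const.div (continuous_weightFun w).continuousAt
      (weightFun_pos hp hw ?_).ne').continuousWithinAt
  · rw [uIcc_of_le (hx.trans hxy)] at hz; exact hz.1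
  · rw [uIcc_of_le hx] at hz; exact hz.1

theorem intervalIntegrable_one_div_weightFun (hp : ∀ k, 0 < w k) (hw : Monotone w) {x y : ℝ}
    (hx : 0 ≤ x) (hy : 0 ≤ y) : IntervalIntegrable (fun u => 1 / weightFun w u) volume x y := by
  apply ContinuousOn.intervalIntegrable
  intro z hz
  refine (continuousAt_const.div (continuous_weightFun w).continuousAt
    (weightFun_pos hp hw ?_).ne').continuousWithinAt
  exact (le_min hx hy).trans hz.1

end Weight

end

end VRRW

/-! ### Existence of the walk -/

namespace VRRW

noncomputable section

section Existence

open ProbabilityTheory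

/-- The path on `ℕ` that follows the finite path `h` up to time `n`. -/
def extendPath (n : ℕ) (h : (i : Finset.Iic n) → ℤ) (i : ℕ) : ℤ :=
  if hi : i ≤ n then h ⟨i, Finset.mem_Iic.2 hi⟩ else 0

/-- The probability of the jump from `x n` to the right. -/
def rightProb (w : ℕ → ℝ) (x : ℕ → ℤ) (n : ℕ) : ℝ :=
  w (localTime x n (x n + 1)) / (w (localTime x n (x n - 1)) + w (localTime x n (x n + 1)))

/-- The probability of the jump from `x n` to the left. -/
def leftProb (w : ℕ → ℝ) (x : ℕ → ℤ) (n : ℕ) : ℝ :=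
  w (localTime x n (x n - 1)) / (w (localTime x n (x n - 1)) + w (localTime x n (x n + 1)))

theorem rightProb_pos {w : ℕ → ℝ} (hp : ∀ k, 0 < w k) (x : ℕ → ℤ) (n : ℕ) :
    0 < rightProb w x n := div_pos (hp _) (add_pos (hp _) (hp _))

theorem leftProb_pos {w : ℕ → ℝ} (hp : ∀ k, 0 < w k) (x : ℕ → ℤ) (n : ℕ) :
    0 < leftProb w x n := div_pos (hp _) (add_pos (hp _) (hp _))

theorem leftProb_add_rightProb {w : ℕ → ℝ} (hp : ∀ k, 0 < w k) (x : ℕ → ℤ) (n : ℕ) :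
    leftProb w x n + rightProb w x n = 1 := by
  unfold leftProb rightProb
  rw [← add_div, div_self (add_pos (hp _) (hp _)).ne']

theorem localTime_congr {x y : ℕ → ℤ} {n : ℕ} (h : ∀ i ≤ n, x i = y i) (k : ℤ) :
    localTime x n k = localTime y n k := by
  unfold localTime
  congr 1
  apply Finset.filter_congr
  intro i hi
  rw [h i (by simpa [Nat.lt_succ_iff] using hi)]

theorem rightProb_congr (w : ℕ → ℝ) {x y : ℕ → ℤ} {n : ℕ} (h : ∀ i ≤ n, x i = y i) :
    rightProb w x n = rightProb w y n := by
  unfold rightProb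
  simp only [h n le_rfl, localTime_congr h]

theorem leftProb_congr (w : ℕ → ℝ) {x y : ℕ → ℤ} {n : ℕ} (h : ∀ i ≤ n, x i = y i) :
    leftProb w x n = leftProb w y n := by
  unfold leftProb
  simp only [h n le_rfl, localTime_congr h]

/-- The transition kernel of the walk, as a function of the past. -/
def stepKernel (w : ℕ → ℝ) (n : ℕ) : Kernel ((i : Finset.Iic n) → ℤ) ℤ :=
  Kernel.ofFunOfCountable fun h =>
    ENNReal.ofReal (leftProb w (extendPath n h) n) • Measure.dirac (extendPath n h n - 1) +
      ENNReal.ofReal (rightProb w (extendPath n h) n) • Measure.dirac (extendPath n h n + 1)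

theorem stepKernel_apply (w : ℕ → ℝ) (n : ℕ) (h : (i : Finset.Iic n) → ℤ) :
    stepKernel w n h =
      ENNReal.ofReal (leftProb w (extendPath n h) n) • Measure.dirac (extendPath n h n - 1) +
      ENNReal.ofReal (rightProb w (extendPath n h) n) • Measure.dirac (extendPath n h n + 1) :=
  rfl

theorem isMarkovKernel_stepKernel {w : ℕ → ℝ} (hp : ∀ k, 0 < w k) (n : ℕ) :
    IsMarkovKernel (stepKernel w n) := by
  refine ⟨fun h => ⟨?_⟩⟩
  rw [stepKernel_apply]
  simp only [Measure.coe_add, Measure.coe_smul, Pi.add_apply, Pi.smul_apply, measure_univ,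
    smul_eq_mul, mul_one]
  rw [← ENNReal.ofReal_add (leftProb_pos hp _ _).le (rightProb_pos hp _ _).le,
    leftProb_add_rightProb hp, ENNReal.ofReal_one]

theorem exists_isVRRW {w : ℕ → ℝ} (hp : ∀ k, 0 < w k) :
    ∃ (Ω : Type) (_ : MeasurableSpace Ω) (P : Measure Ω) (_ : IsProbabilityMeasure P)
      (X : ℕ → Ω → ℤ), IsVRRW P w X := by
  have := isMarkovKernel_stepKernel hp
  -- Ionescu-Tulcea: the law on path space generated by the step kernels from 0. The walk is the
  -- coordinate process.
  let P : Measure (ℕ → ℤ) := Kernel.traj (X := fun _ => ℤ) (stepKernel w) 0 (fun _ => 0)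
  have hP : IsProbabilityMeasure P := by
    change IsProbabilityMeasure (Kernel.traj (X := fun _ => ℤ) (stepKernel w) 0 (fun _ => 0))
    infer_instance
  have hXm : ∀ n, Measurable (fun (ω : ℕ → ℤ) => ω n) := fun n => measurable_pi_apply n
  have hres : ∀ (n : ℕ) (x : ℕ → ℤ), history (fun n (ω : ℕ → ℤ) => ω n) x n =
      (Preorder.frestrictLe (π := fun _ => ℤ) n) ⁻¹' {fun i : Finset.Iic n => x i} := by
    intro n x
    ext ω
    simp only [history, mem_ofPred_eq, mem_preimage, mem_singleton_iff, funext_iff]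
    exact ⟨fun h i => h i (Finset.mem_Iic.1 i.2), fun h i hi => h ⟨i, Finset.mem_Iic.2 hi⟩⟩
  have hext : ∀ (n : ℕ) (x : ℕ → ℤ), ∀ i ≤ n,
      extendPath n (fun i : Finset.Iic n => x i) i = x i := by
    intro n x i hi
    simp [extendPath, hi]
  -- The joint law of the prefix and the next position is the composition product of the prefix law
  -- with the step kernel; over a single prefix the integral collapses to a product.
  have key : ∀ (n : ℕ) (x : ℕ → ℤ) (y : ℤ),
      P (history (fun n (ω : ℕ → ℤ) => ω n) x n ∩ {ω | ω (n + 1) = y}) =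
        P (history (fun n (ω : ℕ → ℤ) => ω n) x n) * stepKernel w n (fun i => x i) {y} := by
    intro n x y
    have h1 := Kernel.partialTraj_compProd_eq_map_traj (X := fun _ => ℤ) (κ := stepKernel w)
      (Nat.zero_le n) (x₀ := fun _ => 0)
    have h2 := Kernel.traj_map_frestrictLe_apply (X := fun _ => ℤ) (κ := stepKernel w)
      0 n (fun _ => 0)
    have e1 : history (fun n (ω : ℕ → ℤ) => ω n) x n ∩ {ω | ω (n + 1) = y} =
        (fun ω : ℕ → ℤ => (Preorder.frestrictLe (π := fun _ => ℤ) n ω, ω (n + 1))) ⁻¹'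
          ({fun i : Finset.Iic n => x i} ×ˢ {y}) := by
      rw [hres]; rfl
    have hms : MeasurableSet ({fun i : Finset.Iic n => x i} : Set ((i : Finset.Iic n) → ℤ)) :=
      MeasurableSet.singleton _
    rw [e1, ← Measure.map_apply (by fun_prop) (hms.prod (MeasurableSet.singleton _)), ← h1,
      Measure.compProd_apply_prod hms (MeasurableSet.singleton _), hres,
      ← Measure.map_apply (by fun_prop) hms, h2, lintegral_singleton, mul_comm]
  have hmh : ∀ (n : ℕ) (x : ℕ → ℤ),
      MeasurableSet (history (fun n (ω : ℕ → ℤ) => ω n) x n) := by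
    intro n x
    rw [hres]
    exact (MeasurableSet.singleton _).preimage (by fun_prop)
  refine ⟨ℕ → ℤ, inferInstance, P, hP, fun n ω => ω n, hXm, ?_, ?_, ?_⟩
  · have h2 := Kernel.traj_map_frestrictLe_apply (X := fun _ => ℤ) (κ := stepKernel w)
      0 0 (fun _ => 0)
    rw [Kernel.partialTraj_self, Kernel.id_apply] at h2
    have h3 : P.map (Preorder.frestrictLe (π := fun _ => ℤ) 0) {fun _ : Finset.Iic 0 => (0 : ℤ)}ᶜ = 0 := by
      change (Measure.map _ (Kernel.traj _ _ _)) _ = 0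
      rw [h2, Measure.dirac_apply' _ (MeasurableSet.singleton _).compl]
      simp
    rw [Measure.map_apply (by fun_prop) (MeasurableSet.singleton _).compl] at h3
    refine measure_mono_null ?_ h3
    intro ω hω
    simp only [preimage_compl, mem_compl_iff, mem_preimage, mem_singleton_iff, funext_iff, not_forall]
    exact ⟨⟨0, by simp⟩, hω⟩
  · intro n x hx
    rw [cond_apply (hmh n x), key, ← mul_assoc, ENNReal.inv_mul_cancel hx (measure_ne_top _ _),
      one_mul, stepKernel_apply, leftProb_congr w (hext n x), hext n x n le_rfl]
    have : x n + 1 ≠ x n - 1 := by omega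
    simp [leftProb, Measure.dirac_apply' _ (MeasurableSet.singleton _), Set.indicator, this]
  · intro n x hx
    rw [cond_apply (hmh n x), key, ← mul_assoc, ENNReal.inv_mul_cancel hx (measure_ne_top _ _),
      one_mul, stepKernel_apply, rightProb_congr w (hext n x), hext n x n le_rfl]
    have : x n - 1 ≠ x n + 1 := by omega
    simp [rightProb, Measure.dirac_apply' _ (MeasurableSet.singleton _), Set.indicator, this]

end Existence

end

end VRRW

/-! ### The scale V(l) = W(e^l) and its shifts -/

namespace VRRW

noncomputable section

theorem eventually_const_le_rpow {q : ℝ} (hq : 0 < q) (C : ℝ) :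
    ∀ᶠ l : ℝ in atTop, C ≤ l ^ q :=
  (tendsto_rpow_atTop hq).eventually_ge_atTop C

theorem eventually_mul_rpow_le {p q : ℝ} (hpq : p < q) (C : ℝ) :
    ∀ᶠ l : ℝ in atTop, C * l ^ p ≤ l ^ q := by
  filter_upwards [eventually_const_le_rpow (sub_pos.2 hpq) C, eventually_gt_atTop 0] with l hl h0
  calc C * l ^ p ≤ l ^ (q - p) * l ^ p := by gcongr
    _ = l ^ q := by rw [← Real.rpow_add h0]; ring_nf

theorem eventually_mul_log_le_rpow {q : ℝ} (hq : 0 < q) (C : ℝ) :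
    ∀ᶠ l : ℝ in atTop, C * Real.log l ≤ l ^ q := by
  have h := (isLittleO_log_rpow_atTop hq).def (by positivity : 0 < 1 / (|C| + 1))
  filter_upwards [h, eventually_ge_atTop 1] with l hl h0
  have h1 : 0 ≤ Real.log l := Real.log_nonneg h0
  rw [Real.norm_of_nonneg h1, Real.norm_of_nonneg (by positivity), one_div,
    ← div_eq_inv_mul, le_div_iff₀ (by positivity)] at hl
  nlinarith [le_abs_self C]

/-- `V` is, up to constants, a primitive of `l ↦ exp (l^α)`. -/
structure ScaleBounds (α : ℝ) (V : ℝ → ℝ) : Prop where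
  nonneg : ∀ l, 0 ≤ V l
  exists_bounds : ∃ l0 : ℝ, 1 ≤ l0 ∧ ∀ m l, l0 ≤ m → m ≤ l →
    1 / 4 * (l - m) * Real.exp (m ^ α) ≤ V l - V m ∧ V l - V m ≤ 4 * (l - m) * Real.exp (l ^ α)

namespace ScaleBounds

variable {α : ℝ} {V : ℝ → ℝ}

/-- On the window from l - l^(1-α) to l the power l^α moves by at most 1, so exp(l^α) keeps a
fraction 1/e over a length l^(1-α). -/
theorem eventually_lower (h : ScaleBounds α V) (h0 : 0 < α) (h1 : α < 1) :
    ∃ c > 0, ∀ᶠ l in atTop, c * l ^ (1 - α) * Real.exp (l ^ α) ≤ V l := by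
  obtain ⟨l0, hl0, hb⟩ := h.exists_bounds
  refine ⟨1 / 4 * Real.exp (-1), by positivity, ?_⟩
  filter_upwards [eventually_mul_rpow_le (by linarith : 1 - α < 1) 2, eventually_ge_atTop (2 * l0)]
    with l h2 h3
  rw [Real.rpow_one] at h2
  have hl : 0 < l := by linarith
  have hp : 0 < l ^ (1 - α) := by positivity
  have h4 := (hb (l - l ^ (1 - α)) l (by linarith) (by linarith)).1
  have h5 := rpow_sub_rpow_le h1 (m := l - l ^ (1 - α)) (l := l) (by linarith) (by linarith) hl
  have h6 : l ^ (α - 1) * (l - (l - l ^ (1 - α))) = 1 := by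
    rw [sub_sub_cancel, ← Real.rpow_add hl]; simp
  rw [h6] at h5
  calc 1 / 4 * Real.exp (-1) * l ^ (1 - α) * Real.exp (l ^ α)
      = 1 / 4 * l ^ (1 - α) * Real.exp (l ^ α - 1) := by
        rw [sub_eq_add_neg (l ^ α), Real.exp_add]; ring
    _ ≤ 1 / 4 * l ^ (1 - α) * Real.exp ((l - l ^ (1 - α)) ^ α) := by gcongr; linarith
    _ ≤ V l - V (l - l ^ (1 - α)) := by
        rw [sub_sub_cancel] at h4; exact h4
    _ ≤ V l := by linarith [h.nonneg (l - l ^ (1 - α))]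

theorem eventually_upper (h : ScaleBounds α V) :
    ∀ᶠ l in atTop, V l ≤ 5 * l * Real.exp (l ^ α) := by
  obtain ⟨l0, hl0, hb⟩ := h.exists_bounds
  filter_upwards [eventually_ge_atTop (max l0 (V l0))] with l hl
  have h1 : l0 ≤ l := (le_max_left _ _).trans hl
  have h2 : V l0 ≤ l := (le_max_right _ _).trans hl
  have h3 := (hb l0 l le_rfl h1).2
  have hl : 0 ≤ l := by linarith
  have h4 : (1 : ℝ) ≤ Real.exp (l ^ α) := Real.one_le_exp (by positivity)
  nlinarith [mul_le_mul_of_nonneg_left h4 (by linarith : 0 ≤ l),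
    mul_nonneg (by linarith : 0 ≤ l0) (Real.exp_pos (l ^ α)).le]

/-- From l - l^a to l + κ the increase of V is O(l^a) times exp((l+κ)^α), which is negligible
against V(l+κ) as a < 1-α. The shift κ serves to compare W(9z) with W(z). -/
theorem eventually_mul_shift_lt (h : ScaleBounds α V) (h0 : 0 < α) (h1 : α < 1) {η a κ : ℝ}
    (hη : η < 1) (hκ : 0 ≤ κ) (ha : 0 < a) (haα : a < 1 - α) :
    ∀ᶠ l in atTop, η * V (l + κ) < V (l - l ^ a) := by
  obtain ⟨l0, hl0, hb⟩ := h.exists_bounds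
  obtain ⟨c, hc, hlow⟩ := h.eventually_lower h0 h1
  have hlow' := (tendsto_atTop_add_const_right atTop κ tendsto_id).eventually hlow
  have hη' : 0 < 1 - η := by linarith
  filter_upwards [hlow', eventually_mul_rpow_le (by linarith : a < 1) 2,
    eventually_ge_atTop (2 * l0), eventually_mul_rpow_le haα (16 / ((1 - η) * c)),
    eventually_const_le_rpow ha κ] with l h2 h3 h4 h5 h6
  simp only [id_eq] at h2
  rw [Real.rpow_one] at h3
  have hl : 0 < l := by linarith
  have hp : 0 < l ^ a := by positivity
  have h7 := (hb (l - l ^ a) (l + κ) (by linarith) (by linarith)).2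
  have h8 : l ^ (1 - α) ≤ (l + κ) ^ (1 - α) :=
    Real.rpow_le_rpow hl.le (by linarith) (by linarith)
  set e := Real.exp ((l + κ) ^ α) with he
  have hepos : 0 < e := Real.exp_pos _
  rw [div_mul_eq_mul_div, div_le_iff₀ (by positivity)] at h5
  have h9 : 16 * l ^ a * e ≤ (1 - η) * V (l + κ) := by
    calc 16 * l ^ a * e ≤ (l + κ) ^ (1 - α) * ((1 - η) * c) * e := by
          gcongr ?_ * _
          exact h5.trans (by gcongr)
      _ = (1 - η) * (c * (l + κ) ^ (1 - α) * e) := by ring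
      _ ≤ _ := by gcongr
  have h10 : 4 * (l + κ - (l - l ^ a)) * e ≤ 8 * l ^ a * e := by
    gcongr ?_ * _; linarith
  have h11 : 0 < l ^ a * e := by positivity
  nlinarith

/-- The shift lowers l^α by at least α l^(b'+α-1). As b < b'+α-1, this beats C l^b, the logarithm of
the polynomial factor and all constants. -/
theorem eventually_shift_add_le (h : ScaleBounds α V) (h0 : 0 < α) (h1 : α < 1) {b b' : ℝ}
    (hb0 : 0 ≤ b) (hbb : b + (1 - α) < b') (hb1 : b' < 1) (C D : ℝ) :
    ∀ᶠ l in atTop, V (l - l ^ b') + D ≤ Real.exp (l ^ α - C * l ^ b) := by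
  obtain ⟨L, hup⟩ := eventually_atTop.1 h.eventually_upper
  have hq : b < b' + α - 1 := by linarith
  filter_upwards [eventually_mul_rpow_le hb1 2, eventually_ge_atTop (max 1 (2 * L)),
    eventually_mul_rpow_le hq (2 / α * C),
    eventually_mul_log_le_rpow (by linarith : 0 < b' + α - 1) (4 / α),
    eventually_const_le_rpow (by linarith : 0 < b' + α - 1) (4 / α * Real.log 10),
    eventually_const_le_rpow h0 (2 * Real.log (2 * max D 1)),
    eventually_mul_rpow_le (by linarith : b < α) (2 * C)] with l h2 h3 h4 h5 h6 h7 h8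
  rw [Real.rpow_one] at h2
  have hl1 : 1 ≤ l := (le_max_left _ _).trans h3
  have hlL : 2 * L ≤ l := (le_max_right _ _).trans h3
  have hl : 0 < l := by linarith
  have hp : 0 < l ^ b' := by positivity
  have hm := hup (l - l ^ b') (by linarith)
  have hcc := le_rpow_sub_rpow h0.le h1.le (m := l - l ^ b') (l := l) (by linarith) hl
  have e1 : α * l ^ (α - 1) * (l - (l - l ^ b')) = α * l ^ (b' + α - 1) := by
    rw [sub_sub_cancel, mul_assoc, ← Real.rpow_add hl]; ring_nf
  rw [e1] at hcc
  set q := l ^ (b' + α - 1) with hqd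
  have hV : V (l - l ^ b') ≤ Real.exp (l ^ α - C * l ^ b) / 2 := by
    calc V (l - l ^ b') ≤ 5 * (l - l ^ b') * Real.exp ((l - l ^ b') ^ α) := hm
      _ ≤ 5 * l * Real.exp (l ^ α - α * q) := by
          have : (0 : ℝ) ≤ l - l ^ b' := by linarith
          gcongr
          · linarith
          · linarith
      _ = Real.exp (Real.log 10 + Real.log l + l ^ α - α * q) / 2 := by
          rw [show Real.log 10 + Real.log l + l ^ α - α * q =
            Real.log 10 + Real.log l + (l ^ α - α * q) by ring, Real.exp_add, Real.exp_add,
            Real.exp_log (by norm_num), Real.exp_log hl]; ring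
      _ ≤ _ := by
          gcongr ?_ / _
          apply Real.exp_le_exp.2
          have a1 : Real.log l ≤ α / 4 * q := by
            have := mul_le_mul_of_nonneg_left h5 (by positivity : 0 ≤ α / 4)
            field_simp at this ⊢; linarith
          have a2 : Real.log 10 ≤ α / 4 * q := by
            have := mul_le_mul_of_nonneg_left h6 (by positivity : 0 ≤ α / 4)
            field_simp at this ⊢; linarith
          have a3 : C * l ^ b ≤ α / 2 * q := by
            have := mul_le_mul_of_nonneg_left h4 (by positivity : 0 ≤ α / 2)
            field_simp at this ⊢; linarith
          linarith
  have hD : D ≤ Real.exp (l ^ α - C * l ^ b) / 2 := by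
    have : 2 * max D 1 ≤ Real.exp (l ^ α - C * l ^ b) := by
      rw [← Real.log_le_iff_le_exp (by positivity)]
      linarith
    linarith [le_max_left D 1]
  linarith

/-- Counterpart of `eventually_shift_add_le`: the shift lowers l^α by at most l^(a'+α-1), which is
negligible against c l^a; what remains of c l^a absorbs the factor l and the constants. -/
theorem eventually_le_shift (h : ScaleBounds α V) (h0 : 0 < α) (h1 : α < 1) {a a' c : ℝ}
    (ha : 0 < a) (hc : 0 < c) (haa : a' < a + (1 - α)) (ha1 : a' < 1) (C : ℝ) :
    ∀ᶠ l in atTop, C * (l * Real.exp (l ^ α - c * l ^ a) + 1) ≤ V (l - l ^ a') := by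
  obtain ⟨c0, hc0, hlow⟩ := h.eventually_lower h0 h1
  obtain ⟨L, hL⟩ := eventually_atTop.1 hlow
  set K := max C 1 with hK
  have hKpos : 0 < K := by positivity
  filter_upwards [eventually_mul_rpow_le ha1 2, eventually_ge_atTop (max 2 (2 * L)),
    eventually_mul_rpow_le (by linarith : a' + α - 1 < a) (2 / c),
    eventually_mul_log_le_rpow ha (4 / c),
    eventually_const_le_rpow ha (4 / c * Real.log (2 * K / c0)),
    eventually_const_le_rpow h0 (2 * Real.log (2 * K / c0)),
    eventually_mul_rpow_le (by linarith : a' + α - 1 < α) 2] with l h2 h3 h4 h5 h6 h7 h8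
  rw [Real.rpow_one] at h2
  have hl1 : 2 ≤ l := (le_max_left _ _).trans h3
  have hlL : 2 * L ≤ l := (le_max_right _ _).trans h3
  have hl : 0 < l := by linarith
  have hp : 0 < l ^ a' := by positivity
  have hm := hL (l - l ^ a') (by linarith)
  have hcc := rpow_sub_rpow_le h1 (m := l - l ^ a') (l := l) (by linarith) (by linarith) hl
  have e1 : l ^ (α - 1) * (l - (l - l ^ a')) = l ^ (a' + α - 1) := by
    rw [sub_sub_cancel, ← Real.rpow_add hl]; ring_nf
  rw [e1] at hcc
  set q := l ^ (a' + α - 1) with hqd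
  have hm1 : 1 ≤ (l - l ^ a') ^ (1 - α) := Real.one_le_rpow (by linarith) (by linarith)
  have hV : c0 * Real.exp (l ^ α - q) ≤ V (l - l ^ a') := by
    refine le_trans ?_ hm
    have : Real.exp (l ^ α - q) ≤ Real.exp ((l - l ^ a') ^ α) := Real.exp_le_exp.2 (by linarith)
    calc c0 * Real.exp (l ^ α - q) ≤ c0 * 1 * Real.exp ((l - l ^ a') ^ α) := by
          rw [mul_one]; gcongr
      _ ≤ _ := by gcongr
  have hA : K * (l * Real.exp (l ^ α - c * l ^ a)) ≤ c0 * Real.exp (l ^ α - q) / 2 := by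
    have e3 : K * (l * Real.exp (l ^ α - c * l ^ a)) =
        c0 / 2 * Real.exp (Real.log (2 * K / c0) + Real.log l + (l ^ α - c * l ^ a)) := by
      rw [Real.exp_add, Real.exp_add, Real.exp_log (by positivity), Real.exp_log hl]
      field_simp
    rw [e3, show c0 * Real.exp (l ^ α - q) / 2 = c0 / 2 * Real.exp (l ^ α - q) by ring]
    refine mul_le_mul_of_nonneg_left (Real.exp_le_exp.2 ?_) (by positivity)
    have a1 : Real.log l ≤ c / 4 * l ^ a := by
      have := mul_le_mul_of_nonneg_left h5 (by positivity : 0 ≤ c / 4)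
      field_simp at this ⊢; linarith
    have a2 : Real.log (2 * K / c0) ≤ c / 4 * l ^ a := by
      have := mul_le_mul_of_nonneg_left h6 (by positivity : 0 ≤ c / 4)
      rw [← mul_assoc] at this
      have e : c / 4 * (4 / c) = 1 := by field_simp
      rw [e] at this; linarith
    have a3 : q ≤ c / 2 * l ^ a := by
      have := mul_le_mul_of_nonneg_left h4 (by positivity : 0 ≤ c / 2)
      field_simp at this ⊢; linarith
    linarith
  have hB : K ≤ c0 * Real.exp (l ^ α - q) / 2 := by
    have : 2 * K / c0 ≤ Real.exp (l ^ α - q) := by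
      rw [← Real.log_le_iff_le_exp (by positivity)]
      linarith
    rw [div_le_iff₀ hc0] at this
    linarith
  have hpos : 0 ≤ l * Real.exp (l ^ α - c * l ^ a) + 1 := by positivity
  calc C * (l * Real.exp (l ^ α - c * l ^ a) + 1)
      ≤ K * (l * Real.exp (l ^ α - c * l ^ a) + 1) := by
        gcongr; exact le_max_left _ _
    _ ≤ V (l - l ^ a') := by linarith

theorem tendsto_atTop (h : ScaleBounds α V) : Tendsto V atTop atTop := by
  obtain ⟨l0, hl0, hb⟩ := h.exists_bounds
  refine tendsto_atTop_mono' atTop (f₁ := fun l => 1 / 4 * (l - l0)) ?_ ?_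
  · filter_upwards [eventually_ge_atTop l0] with l hl
    have h1 := (hb l0 l le_rfl hl).1
    have h2 : (1 : ℝ) ≤ Real.exp (l0 ^ α) := Real.one_le_exp (by positivity)
    nlinarith [h.nonneg l0, mul_le_mul_of_nonneg_left h2 (by linarith : 0 ≤ 1 / 4 * (l - l0))]
  · exact (tendsto_atTop_add_const_right atTop (-l0) tendsto_id).const_mul_atTop (by norm_num)

end ScaleBounds

/-- Up to a factor 4, 1/w(u) is the slow factor divided by u; the slow factor is monotone and du/u
integrates to l - m. -/
theorem IsLogPowerWeight.scaleBounds {α : ℝ} {w : ℕ → ℝ} (h : IsLogPowerWeight α w) (h0 : 0 ≤ α) :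
    ScaleBounds α (fun l => bigW w (Real.exp l)) := by
  obtain ⟨x0, hx0, hb⟩ := h.bounds h0
  refine ⟨fun l => bigW_nonneg h.pos h.mono (Real.exp_pos l).le, Real.log x0, ?_, ?_⟩
  · rw [Real.le_log_iff_exp_le (by linarith)]
    linarith [Real.exp_one_lt_d9]
  intro m l hm hml
  have hm0 : 0 ≤ m := (Real.log_nonneg (by linarith)).trans hm
  have hexp : Real.exp m ≤ Real.exp l := Real.exp_le_exp.2 hml
  have hint : ∫ u in Real.exp m..Real.exp l, 1 / u = l - m := by
    rw [integral_one_div_of_pos (Real.exp_pos m) (Real.exp_pos l),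
      Real.log_div (Real.exp_pos l).ne' (Real.exp_pos m).ne', Real.log_exp, Real.log_exp]
  have hI : IntervalIntegrable (fun u : ℝ => 1 / u) volume (Real.exp m) (Real.exp l) := by
    apply ContinuousOn.intervalIntegrable
    intro y hy
    rw [uIcc_of_le hexp] at hy
    have : y ≠ 0 := ((Real.exp_pos m).trans_le hy.1).ne'
    exact (continuousAt_const.div continuousAt_id this).continuousWithinAt
  have hIw := intervalIntegrable_one_div_weightFun h.pos h.mono (Real.exp_pos m).le
    (Real.exp_pos l).le
  have hpt : ∀ u ∈ Icc (Real.exp m) (Real.exp l),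
      1 / 4 * Real.exp (m ^ α) * (1 / u) ≤ 1 / weightFun w u ∧
      1 / weightFun w u ≤ 4 * Real.exp (l ^ α) * (1 / u) := by
    intro u hu
    have hu0 : 0 < u := (Real.exp_pos m).trans_le hu.1
    have hux : x0 ≤ u := by
      rw [← Real.log_le_log_iff (by linarith) hu0]
      refine hm.trans ?_
      rw [← Real.log_exp m]
      exact Real.log_le_log (Real.exp_pos m) hu.1
    have hlm : m ≤ Real.log u := by rw [Real.le_log_iff_exp_le hu0]; exact hu.1
    have hll : Real.log u ≤ l := by rw [Real.log_le_iff_le_exp hu0]; exact hu.2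
    have hwp := weightFun_pos h.pos h.mono hu0.le
    have hs1 : Real.exp (m ^ α) ≤ slowFactor α u := by unfold slowFactor; gcongr
    have hs2 : slowFactor α u ≤ Real.exp (l ^ α) := by
      unfold slowFactor; gcongr
      exact hm0.trans hlm
    have hsp := slowFactor_pos α u
    obtain ⟨b1, b2⟩ := hb u hux
    rw [div_le_iff₀ (by positivity)] at b1
    rw [le_div_iff₀ hsp] at b2
    constructor
    · rw [mul_one_div, div_le_div_iff₀ hu0 hwp]
      have : Real.exp (m ^ α) * weightFun w u ≤ slowFactor α u * weightFun w u := by gcongr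
      linarith
    · rw [mul_one_div, div_le_div_iff₀ hwp hu0]
      have : slowFactor α u * weightFun w u ≤ Real.exp (l ^ α) * weightFun w u := by gcongr
      linarith
  rw [bigW_sub_eq h.pos h.mono (Real.exp_pos m).le hexp]
  constructor
  · have := intervalIntegral.integral_mono_on hexp (hI.const_mul (1 / 4 * Real.exp (m ^ α))) hIw
      (fun u hu => (hpt u hu).1)
    rw [intervalIntegral.integral_const_mul, hint] at this
    linarith
  · have := intervalIntegral.integral_mono_on hexp hIw (hI.const_mul (4 * Real.exp (l ^ α)))
      (fun u hu => (hpt u hu).2)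
    rw [intervalIntegral.integral_const_mul, hint] at this
    linarith

end

end VRRW

/-! ### The inverse of W, and G after the substitution u = W(y) -/

namespace VRRW

noncomputable section

section Inverse

variable {w : ℕ → ℝ} {α : ℝ}

theorem IsLogPowerWeight.tendsto_bigW (h : IsLogPowerWeight α w) (h0 : 0 ≤ α) :
    Tendsto (bigW w) atTop atTop := by
  have h1 := (h.scaleBounds h0).tendsto_atTop.comp Real.tendsto_log_atTop
  refine h1.congr' ?_
  filter_upwards [eventually_gt_atTop 0] with x hx
  simp [Real.exp_log hx]

theorem IsLogPowerWeight.surjOn_bigW (h : IsLogPowerWeight α w) (h0 : 0 ≤ α) :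
    SurjOn (bigW w) (Ici 0) (Ici 0) := by
  intro y hy
  obtain ⟨b, hb0, hb⟩ := ((eventually_ge_atTop 0).and
    ((h.tendsto_bigW h0).eventually_ge_atTop y)).exists
  have := intermediate_value_Icc hb0 ((continuousOn_bigW h.pos h.mono).mono Icc_subset_Ici_self)
  obtain ⟨x, hx, rfl⟩ := this ⟨by rw [bigW_zero]; exact hy, hb⟩
  exact ⟨x, hx.1, rfl⟩

theorem IsLogPowerWeight.bigWInv_nonneg (h : IsLogPowerWeight α w) (h0 : 0 ≤ α) {y : ℝ}
    (hy : 0 ≤ y) : 0 ≤ bigWInv w y :=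
  Function.invFunOn_mem (h.surjOn_bigW h0 hy)

theorem IsLogPowerWeight.bigW_bigWInv (h : IsLogPowerWeight α w) (h0 : 0 ≤ α) {y : ℝ}
    (hy : 0 ≤ y) : bigW w (bigWInv w y) = y :=
  Function.invFunOn_eq (h.surjOn_bigW h0 hy)

theorem IsLogPowerWeight.bigWInv_bigW (h : IsLogPowerWeight α w) {x : ℝ} (hx : 0 ≤ x) :
    bigWInv w (bigW w x) = x :=
  (strictMonoOn_bigW h.pos h.mono).injOn.leftInvOn_invFunOn hx

theorem IsLogPowerWeight.bigWInv_mono (h : IsLogPowerWeight α w) (h0 : 0 ≤ α) {x y : ℝ}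
    (hx : 0 ≤ x) (hxy : x ≤ y) : bigWInv w x ≤ bigWInv w y := by
  rw [← bigW_le_iff h.pos h.mono (h.bigWInv_nonneg h0 hx) (h.bigWInv_nonneg h0 (hx.trans hxy)),
    h.bigW_bigWInv h0 hx, h.bigW_bigWInv h0 (hx.trans hxy)]
  exact hxy

/-- W is an order isomorphism of the half-line, and order isomorphisms are homeomorphisms for the
order topology. -/
theorem IsLogPowerWeight.continuousOn_bigWInv (h : IsLogPowerWeight α w) (h0 : 0 ≤ α) :
    ContinuousOn (bigWInv w) (Ici 0) := by
  let g : Ici (0 : ℝ) → Ici (0 : ℝ) := fun x => ⟨bigW w x, bigW_nonneg h.pos h.mono x.2⟩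
  have hg : StrictMono g := fun x y hxy => strictMonoOn_bigW h.pos h.mono x.2 y.2 hxy
  have hs : Function.Surjective g := fun y => by
    obtain ⟨x, hx, hxy⟩ := h.surjOn_bigW h0 y.2
    exact ⟨⟨x, hx⟩, Subtype.ext hxy⟩
  let e := hg.orderIsoOfSurjective g hs
  have hc : Continuous e.symm := e.symm.continuous
  rw [continuousOn_iff_continuous_domRestrict]
  have : (Ici (0 : ℝ)).domRestrict (bigWInv w) = fun y => ((e.symm y : Ici (0 : ℝ)) : ℝ) := by
    ext y
    have h1 : g (e.symm y) = y := e.apply_symm_apply y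
    have h2 : bigW w (e.symm y) = y := congrArg Subtype.val h1
    rw [domRestrict_apply, ← h2]
    exact h.bigWInv_bigW (e.symm y).2
  rw [this]
  exact continuous_subtype_val.comp hc

/-- Non-negative and continuous on the half-line. -/
def NonnegCont (f : ℝ → ℝ) : Prop := ContinuousOn f (Ici 0) ∧ ∀ x, 0 ≤ x → 0 ≤ f x

/-- The integrand in the definition of `opG`. -/
def ratioG (w : ℕ → ℝ) (f : ℝ → ℝ) (u : ℝ) : ℝ :=
  weightFun w (bigWInv w (f u)) / weightFun w (bigWInv w u)

theorem IsLogPowerWeight.continuousOn_ratioG (h : IsLogPowerWeight α w) (h0 : 0 ≤ α)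
    {f : ℝ → ℝ} (hf : NonnegCont f) : ContinuousOn (ratioG w f) (Ici 0) := by
  refine ContinuousOn.div ?_ ?_ ?_
  · exact (continuous_weightFun w).comp_continuousOn
      ((h.continuousOn_bigWInv h0).comp hf.1 fun x hx => hf.2 x hx)
  · exact (continuous_weightFun w).comp_continuousOn (h.continuousOn_bigWInv h0)
  · intro x hx
    exact (weightFun_pos h.pos h.mono (h.bigWInv_nonneg h0 hx)).ne'

theorem IsLogPowerWeight.ratioG_nonneg (h : IsLogPowerWeight α w) (h0 : 0 ≤ α)
    {f : ℝ → ℝ} (hf : NonnegCont f) {u : ℝ} (hu : 0 ≤ u) : 0 ≤ ratioG w f u :=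
  div_nonneg (weightFun_pos h.pos h.mono (h.bigWInv_nonneg h0 (hf.2 u hu))).le
    (weightFun_pos h.pos h.mono (h.bigWInv_nonneg h0 hu)).le

theorem intervalIntegrable_of_continuousOn_Ici {g : ℝ → ℝ} (hg : ContinuousOn g (Ici 0)) {a b : ℝ}
    (ha : 0 ≤ a) (hb : 0 ≤ b) : IntervalIntegrable g volume a b :=
  (hg.mono fun _ hz => (le_min ha hb).trans hz.1).intervalIntegrable

theorem IsLogPowerWeight.nonnegCont_opG (h : IsLogPowerWeight α w) (h0 : 0 ≤ α)
    {f : ℝ → ℝ} (hf : NonnegCont f) : NonnegCont (opG w f) := by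
  have hc := h.continuousOn_ratioG h0 hf
  constructor
  -- Freezing the integrand at its value at 0 on the negative axis makes it continuous on the line
  -- and leaves the integrals over [0, x] unchanged.
  · have hc' : Continuous (fun u => ratioG w f (max u 0)) :=
      hc.comp_continuous (by fun_prop) (fun u => le_max_right u 0)
    have := intervalIntegral.continuous_primitive (μ := volume)
      (fun a b => hc'.intervalIntegrable a b) 0
    refine this.continuousOn.congr ?_
    intro x hx
    apply intervalIntegral.integral_congr
    intro u hu
    rw [uIcc_of_le hx] at hu
    simp only [max_eq_left hu.1]
    rfl
  · intro x hx
    exact intervalIntegral.integral_nonneg hx fun u hu => h.ratioG_nonneg h0 hf hu.1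

theorem IsLogPowerWeight.opG_mono (h : IsLogPowerWeight α w) (h0 : 0 ≤ α)
    {f g : ℝ → ℝ} (hf : NonnegCont f) (hg : NonnegCont g) (hfg : ∀ x, 0 ≤ x → f x ≤ g x)
    {x : ℝ} (hx : 0 ≤ x) : opG w f x ≤ opG w g x := by
  refine intervalIntegral.integral_mono_on hx
    (intervalIntegrable_of_continuousOn_Ici (h.continuousOn_ratioG h0 hf) le_rfl hx)
    (intervalIntegrable_of_continuousOn_Ici (h.continuousOn_ratioG h0 hg) le_rfl hx) ?_
  intro u hu
  have h1 := (weightFun_pos h.pos h.mono (h.bigWInv_nonneg h0 hu.1)).le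
  gcongr
  exact weightFun_monotoneOn h.mono (h.bigWInv_nonneg h0 (hf.2 u hu.1))
    (h.bigWInv_nonneg h0 (hg.2 u hu.1)) (h.bigWInv_mono h0 (hf.2 u hu.1) (hfg u hu.1))

/-- The integrand of `opG w f ∘ bigW w`. -/
def conjG (w : ℕ → ℝ) (f : ℝ → ℝ) (y : ℝ) : ℝ :=
  weightFun w (bigWInv w (f (bigW w y))) / weightFun w y ^ 2

theorem IsLogPowerWeight.continuousOn_conjG (h : IsLogPowerWeight α w) (h0 : 0 ≤ α)
    {f : ℝ → ℝ} (hf : NonnegCont f) : ContinuousOn (conjG w f) (Ici 0) := by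
  have hW : MapsTo (bigW w) (Ici 0) (Ici 0) := fun x hx => bigW_nonneg h.pos h.mono hx
  refine ContinuousOn.div ?_ ?_ ?_
  · exact (continuous_weightFun w).comp_continuousOn
      ((h.continuousOn_bigWInv h0).comp (hf.1.comp (continuousOn_bigW h.pos h.mono) hW)
        fun x hx => hf.2 _ (hW hx))
  · exact ((continuous_weightFun w).pow 2).continuousOn
  · intro x hx
    exact (pow_pos (weightFun_pos h.pos h.mono hx) 2).ne'

/-- Substitution u = W(y); the Jacobian 1/w(y) supplies the square in the denominator of `conjG`. -/
theorem IsLogPowerWeight.opG_bigW (h : IsLogPowerWeight α w) (h0 : 0 ≤ α)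
    {f : ℝ → ℝ} (hf : NonnegCont f) {x : ℝ} (hx : 0 ≤ x) :
    opG w f (bigW w x) = ∫ y in (0 : ℝ)..x, conjG w f y := by
  have h1 := intervalIntegral.integral_comp_mul_deriv' (a := 0) (b := x) (f := bigW w)
    (f' := fun y => 1 / weightFun w y) (g := ratioG w f)
    (fun y hy => by
      rw [uIcc_of_le hx] at hy
      exact hasDerivAt_bigW h.pos h.mono hy.1)
    (fun y hy => by
      rw [uIcc_of_le hx] at hy
      exact (continuousAt_const.div (continuous_weightFun w).continuousAt
        (weightFun_pos h.pos h.mono hy.1).ne').continuousWithinAt)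
    ((h.continuousOn_ratioG h0 hf).mono (by
      rintro _ ⟨y, hy, rfl⟩
      rw [uIcc_of_le hx] at hy
      exact bigW_nonneg h.pos h.mono hy.1))
  rw [bigW_zero] at h1
  rw [show opG w f (bigW w x) = ∫ u in (0 : ℝ)..bigW w x, ratioG w f u from rfl, ← h1]
  apply intervalIntegral.integral_congr
  intro y hy
  rw [uIcc_of_le hx] at hy
  simp only [Function.comp_apply, ratioG, conjG, h.bigWInv_bigW hy.1]
  have := (weightFun_pos h.pos h.mono hy.1).ne'
  field_simp

end Inverse

end

end VRRW

/-! ### The effect of G on profiles -/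

namespace VRRW

noncomputable section

/-- For a < α the slope of l^α eventually dominates that of l^a / 2. This lets an integrand of the
form exp(l^α - l^a / 2) / y be bounded through the right endpoint. -/
theorem exists_rpow_sub_mono {α a : ℝ} (h0 : 0 < α) (h1 : α < 1) (ha : 0 < a) (haα : a < α) :
    ∃ Λ : ℝ, 1 ≤ Λ ∧ ∀ m l, Λ ≤ m → m ≤ l → m ^ α - 1 / 2 * m ^ a ≤ l ^ α - 1 / 2 * l ^ a := by
  obtain ⟨Λ, hΛ⟩ := eventually_atTop.1 (eventually_mul_rpow_le (by linarith : a - 1 < α - 1)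
    (1 / (2 * α)))
  refine ⟨max 1 Λ, le_max_left _ _, fun m l hm hml => ?_⟩
  have hm1 : 1 ≤ m := (le_max_left _ _).trans hm
  have hl : 0 < l := by linarith
  have h2 := hΛ l (((le_max_right _ _).trans hm).trans hml)
  have h3 := rpow_sub_rpow_le (by linarith : a < 1) (by linarith : 0 ≤ m) hml hl
  have h4 := le_rpow_sub_rpow h0.le h1.le (by linarith : 0 ≤ m) hl (l := l) (m := m)
  have h5 : 1 / 2 * l ^ (a - 1) ≤ α * l ^ (α - 1) := by
    have := mul_le_mul_of_nonneg_left h2 h0.le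
    field_simp at this ⊢; linarith
  have h6 := mul_le_mul_of_nonneg_right h5 (by linarith : 0 ≤ l - m)
  linarith

section OpG

variable {w : ℕ → ℝ} {α : ℝ}

/-- `f (W x) ≤ W (x exp (-log^a x))` for large `x`. -/
def UpperProfile (w : ℕ → ℝ) (f : ℝ → ℝ) (a : ℝ) : Prop :=
  ∀ᶠ l : ℝ in atTop, f (bigW w (Real.exp l)) ≤ bigW w (Real.exp (l - l ^ a))

/-- `W (x exp (-log^b x)) ≤ f (W x)` for large `x`. -/
def LowerProfile (w : ℕ → ℝ) (f : ℝ → ℝ) (b : ℝ) : Prop :=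
  ∀ᶠ l : ℝ in atTop, bigW w (Real.exp (l - l ^ b)) ≤ f (bigW w (Real.exp l))

theorem IsLogPowerWeight.exp_bounds (h : IsLogPowerWeight α w) (h0 : 0 ≤ α) :
    ∃ l0 : ℝ, 1 ≤ l0 ∧ ∀ l ≥ l0, Real.exp (l - l ^ α) ≤ 4 * weightFun w (Real.exp l) ∧
      weightFun w (Real.exp l) ≤ 4 * Real.exp (l - l ^ α) := by
  obtain ⟨x0, hx0, hb⟩ := h.bounds h0
  refine ⟨Real.log x0, ?_, fun l hl => ?_⟩
  · rw [Real.le_log_iff_exp_le (by linarith)]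
    linarith [Real.exp_one_lt_d9]
  · obtain ⟨b1, b2⟩ := hb (Real.exp l) ((Real.log_le_iff_le_exp (by linarith)).1 hl)
    have e : slowFactor α (Real.exp l) = Real.exp (l ^ α) := by simp [slowFactor]
    rw [e] at b1 b2
    rw [Real.exp_sub]
    rw [div_le_iff₀ (by positivity)] at b1
    constructor
    · rw [div_le_iff₀ (Real.exp_pos _)]; linarith
    · rw [← mul_div_assoc]; exact b2

/-- With m = l - l^a the numerator is at most 4 exp(m - m^α) and the denominator at least (exp(l -
l^α) / 4)^2, whence 64. Replacing m^α by l^α costs l^(a+α-1), at most half of l^a; the other half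
survives. -/
theorem IsLogPowerWeight.conjG_upper (h : IsLogPowerWeight α w) (h0 : 0 < α) (h1 : α < 1)
    {f : ℝ → ℝ} (hf : NonnegCont f) {a : ℝ} (ha1 : a < 1)
    (hU : UpperProfile w f a) :
    ∀ᶠ l : ℝ in atTop, conjG w f (Real.exp l) ≤
      64 * Real.exp (l ^ α - 1 / 2 * l ^ a) * (1 / Real.exp l) := by
  obtain ⟨l0, hl0, hb⟩ := h.exp_bounds h0.le
  filter_upwards [hU, eventually_ge_atTop (2 * l0), eventually_mul_rpow_le ha1 2,
    eventually_mul_rpow_le (by linarith : a + α - 1 < a) 2] with l h2 h3 h4 h5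
  rw [Real.rpow_one] at h4
  have hl : 0 < l := by linarith
  have hp : 0 < l ^ a := by positivity
  have hW := bigW_nonneg h.pos h.mono (Real.exp_pos l).le
  have h6 : bigWInv w (f (bigW w (Real.exp l))) ≤ Real.exp (l - l ^ a) := by
    rw [← h.bigWInv_bigW (Real.exp_pos (l - l ^ a)).le]
    exact h.bigWInv_mono h0.le (hf.2 _ hW) h2
  have h7 : weightFun w (bigWInv w (f (bigW w (Real.exp l)))) ≤
      4 * Real.exp (l - l ^ a - (l - l ^ a) ^ α) :=
    (weightFun_monotoneOn h.mono (h.bigWInv_nonneg h0.le (hf.2 _ hW)) (Real.exp_pos _).le h6).trans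
      (hb (l - l ^ a) (by linarith)).2
  have h8 := (hb l (by linarith)).1
  have h9 : Real.exp (l - l ^ α) / 4 ≤ weightFun w (Real.exp l) := by linarith
  have hcc := rpow_sub_rpow_le h1 (m := l - l ^ a) (l := l) (by linarith) (by linarith) hl
  have e1 : l ^ (α - 1) * (l - (l - l ^ a)) = l ^ (a + α - 1) := by
    rw [sub_sub_cancel, ← Real.rpow_add hl]; ring_nf
  rw [e1] at hcc
  unfold conjG
  calc _ ≤ 4 * Real.exp (l - l ^ a - (l - l ^ a) ^ α) / (Real.exp (l - l ^ α) / 4) ^ 2 := by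
        gcongr
    _ = 64 * Real.exp (l - l ^ a - (l - l ^ a) ^ α - 2 * (l - l ^ α)) := by
        rw [Real.exp_sub (l - l ^ a - (l - l ^ a) ^ α), two_mul, Real.exp_add]
        field_simp
        norm_num
    _ ≤ 64 * Real.exp (l ^ α - 1 / 2 * l ^ a - l) := by
        gcongr 64 * Real.exp ?_; linarith
    _ = _ := by rw [Real.exp_sub _ l]; ring

theorem integral_conjG_split (h : IsLogPowerWeight α w) (h0 : 0 ≤ α)
    {f : ℝ → ℝ} (hf : NonnegCont f) (m l : ℝ) :
    opG w f (bigW w (Real.exp l)) = opG w f (bigW w (Real.exp m)) +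
      ∫ y in Real.exp m..Real.exp l, conjG w f y := by
  rw [h.opG_bigW h0 hf (Real.exp_pos l).le, h.opG_bigW h0 hf (Real.exp_pos m).le]
  have hc := h.continuousOn_conjG h0 hf
  exact (intervalIntegral.integral_add_adjacent_intervals
    (intervalIntegrable_of_continuousOn_Ici hc le_rfl (Real.exp_pos m).le)
    (intervalIntegrable_of_continuousOn_Ici hc (Real.exp_pos m).le (Real.exp_pos l).le)).symm

theorem intervalIntegrable_const_div (c : ℝ) (m l : ℝ) :
    IntervalIntegrable (fun y : ℝ => c * (1 / y)) volume (Real.exp m) (Real.exp l) := by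
  apply ContinuousOn.intervalIntegrable
  intro y hy
  have : y ≠ 0 := ((lt_min (Real.exp_pos m) (Real.exp_pos l)).trans_le hy.1).ne'
  exact (continuousAt_const.mul (continuousAt_const.div continuousAt_id this)).continuousWithinAt

theorem integral_const_div (c : ℝ) (m l : ℝ) :
    ∫ y in Real.exp m..Real.exp l, c * (1 / y) = c * (l - m) := by
  rw [intervalIntegral.integral_const_mul, integral_one_div_of_pos (Real.exp_pos m)
    (Real.exp_pos l), Real.log_div (Real.exp_pos l).ne' (Real.exp_pos m).ne', Real.log_exp,
    Real.log_exp]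

/-- As a < α, the bound of `conjG_upper` on y times the integrand increases with l, so the integral
is at most l times its endpoint value plus a constant. By `eventually_le_shift` this is dominated by
W at a point shifted with any exponent below a + (1-α). -/
theorem IsLogPowerWeight.upperProfile_opG (h : IsLogPowerWeight α w) (h0 : 0 < α) (h1 : α < 1)
    {f : ℝ → ℝ} (hf : NonnegCont f) {a a' : ℝ} (ha : 0 < a) (haα : a < α)
    (hU : UpperProfile w f a) (haa : a' < a + (1 - α)) (ha1 : a' < 1) :
    UpperProfile w (opG w f) a' := by
  obtain ⟨L, hL⟩ := eventually_atTop.1 (h.conjG_upper h0 h1 hf (by linarith) hU)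
  obtain ⟨Λ, hΛ1, hΛ⟩ := exists_rpow_sub_mono h0 h1 ha haα
  set M := max L Λ with hM
  have hM1 : 1 ≤ M := hΛ1.trans (le_max_right _ _)
  set C0 := opG w f (bigW w (Real.exp M))
  filter_upwards [(h.scaleBounds h0.le).eventually_le_shift h0 h1 ha
    (by norm_num : (0 : ℝ) < 1 / 2) haa ha1 (max 64 C0), eventually_ge_atTop M] with l h2 h3
  refine le_trans ?_ h2
  rw [integral_conjG_split h h0.le hf M l]
  have h4 : ∫ y in Real.exp M..Real.exp l, conjG w f y ≤
      64 * Real.exp (l ^ α - 1 / 2 * l ^ a) * (l - M) := by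
    rw [← integral_const_div]
    apply intervalIntegral.integral_mono_on (Real.exp_le_exp.2 h3)
      (intervalIntegrable_of_continuousOn_Ici (h.continuousOn_conjG h0.le hf) (Real.exp_pos M).le
        (Real.exp_pos l).le) (intervalIntegrable_const_div _ _ _)
    intro y hy
    have hy0 : 0 < y := (Real.exp_pos M).trans_le hy.1
    have h5 : M ≤ Real.log y := (Real.le_log_iff_exp_le hy0).2 hy.1
    have h6 : Real.log y ≤ l := (Real.log_le_iff_le_exp hy0).2 hy.2
    have h7 := hL (Real.log y) ((le_max_left _ _).trans h5)
    rw [Real.exp_log hy0] at h7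
    refine h7.trans ?_
    gcongr ?_ * _
    gcongr 64 * Real.exp ?_
    exact hΛ _ _ ((le_max_right _ _).trans h5) h6
  have h8 : 0 ≤ Real.exp (l ^ α - 1 / 2 * l ^ a) := (Real.exp_pos _).le
  have h9 : 64 * Real.exp (l ^ α - 1 / 2 * l ^ a) * (l - M) ≤
      max 64 C0 * (l * Real.exp (l ^ α - 1 / 2 * l ^ a)) := by
    calc _ ≤ 64 * Real.exp (l ^ α - 1 / 2 * l ^ a) * l := by gcongr; linarith
      _ = 64 * (l * Real.exp (l ^ α - 1 / 2 * l ^ a)) := by ring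
      _ ≤ _ := by
        have : 0 ≤ l := by linarith
        gcongr
        exact le_max_left _ _
  have := le_max_right 64 C0
  linarith

/-- For a > α, l^α - l^a / 2 is eventually below -2 log l, so the integrand is at most 64 / (y log²
y), whose primitive -64 / log y is bounded. -/
theorem IsLogPowerWeight.bounded_opG (h : IsLogPowerWeight α w) (h0 : 0 < α) (h1 : α < 1)
    {f : ℝ → ℝ} (hf : NonnegCont f) {a : ℝ} (haα : α < a) (ha1 : a < 1)
    (hU : UpperProfile w f a) : BoundedOnHalfLine (opG w f) := by
  have ha : 0 < a := h0.trans haα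
  obtain ⟨L, hL⟩ := eventually_atTop.1 ((h.conjG_upper h0 h1 hf ha1 hU).and
    ((eventually_mul_rpow_le haα 4).and ((eventually_mul_log_le_rpow ha 8))))
  set M := max L 1 with hM
  have hM1 : 1 ≤ M := le_max_right _ _
  set C0 := opG w f (bigW w (Real.exp M)) with hC0
  have hG := h.nonnegCont_opG h0.le hf
  have hWM := bigW_nonneg h.pos h.mono (Real.exp_pos M).le
  have hC0n : 0 ≤ C0 := hG.2 _ hWM
  have hmonoG : ∀ x y, 0 ≤ x → x ≤ y → opG w f x ≤ opG w f y := by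
    intro x y hx hxy
    have hc := h.continuousOn_ratioG h0.le hf
    have : opG w f y = opG w f x + ∫ u in x..y, ratioG w f u :=
      (intervalIntegral.integral_add_adjacent_intervals
        (intervalIntegrable_of_continuousOn_Ici hc le_rfl hx)
        (intervalIntegrable_of_continuousOn_Ici hc hx (hx.trans hxy))).symm
    rw [this]
    have := intervalIntegral.integral_nonneg (μ := volume) hxy fun u hu =>
      h.ratioG_nonneg h0.le hf (hx.trans hu.1)
    linarith
  have key : ∀ l, M ≤ l → opG w f (bigW w (Real.exp l)) ≤ C0 + 64 := by
    intro l hl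
    rw [integral_conjG_split h h0.le hf M l]
    have hd : ∀ y ∈ uIcc (Real.exp M) (Real.exp l),
        HasDerivAt (fun y => -(64 * (Real.log y)⁻¹)) (64 * (1 / (y * Real.log y ^ 2))) y := by
      intro y hy
      rw [uIcc_of_le (Real.exp_le_exp.2 hl)] at hy
      have hy0 : 0 < y := (Real.exp_pos M).trans_le hy.1
      have h5 : M ≤ Real.log y := (Real.le_log_iff_exp_le hy0).2 hy.1
      have h6 : Real.log y ≠ 0 := by linarith
      have := (((Real.hasDerivAt_log hy0.ne').inv h6).const_mul 64).neg
      exact this.congr_deriv (by ring)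
    have hcont : ContinuousOn (fun y => 64 * (1 / (y * Real.log y ^ 2)))
        (uIcc (Real.exp M) (Real.exp l)) := by
      intro y hy
      rw [uIcc_of_le (Real.exp_le_exp.2 hl)] at hy
      have hy0 : 0 < y := (Real.exp_pos M).trans_le hy.1
      have h5 : M ≤ Real.log y := (Real.le_log_iff_exp_le hy0).2 hy.1
      have h6 : Real.log y ≠ 0 := by linarith
      refine (continuousAt_const.mul (continuousAt_const.div (continuousAt_id.mul
        ((Real.continuousAt_log hy0.ne').pow 2)) ?_)).continuousWithinAt
      have : 0 < Real.log y := by linarith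
      change y * Real.log y ^ 2 ≠ 0
      positivity
    have hI := intervalIntegral.integral_eq_sub_of_hasDerivAt hd hcont.intervalIntegrable
    have h4 : ∫ y in Real.exp M..Real.exp l, conjG w f y ≤
        ∫ y in Real.exp M..Real.exp l, 64 * (1 / (y * Real.log y ^ 2)) := by
      apply intervalIntegral.integral_mono_on (Real.exp_le_exp.2 hl)
        (intervalIntegrable_of_continuousOn_Ici (h.continuousOn_conjG h0.le hf)
          (Real.exp_pos M).le (Real.exp_pos l).le) hcont.intervalIntegrable
      intro y hy
      have hy0 : 0 < y := (Real.exp_pos M).trans_le hy.1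
      have h5 : M ≤ Real.log y := (Real.le_log_iff_exp_le hy0).2 hy.1
      have h6 : 0 < Real.log y := by linarith
      obtain ⟨h7, h8, h9⟩ := hL (Real.log y) ((le_max_left _ _).trans h5)
      rw [Real.exp_log hy0] at h7
      refine h7.trans ?_
      rw [mul_assoc]
      gcongr 64 * ?_
      rw [mul_one_div, div_le_div_iff₀ hy0 (by positivity), one_mul]
      have h10 : Real.exp (Real.log y ^ α - 1 / 2 * Real.log y ^ a) ≤ (Real.log y ^ 2)⁻¹ := by
        rw [← Real.exp_log (by positivity : 0 < (Real.log y ^ 2)⁻¹), Real.log_inv, Real.log_pow]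
        apply Real.exp_le_exp.2
        push_cast
        linarith
      calc _ ≤ (Real.log y ^ 2)⁻¹ * (y * Real.log y ^ 2) := by gcongr
        _ = y := by field_simp
    rw [hI] at h4
    simp only [Real.log_exp] at h4
    have h5 : 0 ≤ l⁻¹ := inv_nonneg.2 (by linarith)
    have h6 : M⁻¹ ≤ 1 := inv_le_one_of_one_le₀ hM1
    linarith
  refine ⟨C0 + 64, fun x hx => ?_⟩
  rw [abs_of_nonneg (hG.2 x hx)]
  obtain ⟨l, hl1, hl2⟩ := ((eventually_ge_atTop M).and
    ((h.scaleBounds h0.le).tendsto_atTop.eventually_ge_atTop x)).exists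
  exact (hmonoG _ _ hx hl2).trans (key l hl1)

/-- Only the last unit [l-1, l] of the logarithmic scale is kept. There l^α moves by at most 1 and
the integrand is at least exp((l-1)^α - l^b) / (64 y); the constants are absorbed by taking 3 l^b in
place of l^b. -/
theorem IsLogPowerWeight.lowerProfile_opG (h : IsLogPowerWeight α w) (h0 : 0 < α) (h1 : α < 1)
    {f : ℝ → ℝ} (hf : NonnegCont f) {b b' : ℝ} (hb0 : 0 < b)
    (hL : LowerProfile w f b) (hbb : b + (1 - α) < b') (hb1 : b' < 1) :
    LowerProfile w (opG w f) b' := by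
  obtain ⟨l0, hl0, hb⟩ := h.exp_bounds h0.le
  obtain ⟨L, hL⟩ := eventually_atTop.1 hL
  filter_upwards [(h.scaleBounds h0.le).eventually_shift_add_le h0 h1 hb0.le hbb hb1 3 0,
    eventually_ge_atTop (max 4 (max (L + 1) (4 * l0))),
    eventually_mul_rpow_le (by linarith : b < 1) 4,
    eventually_const_le_rpow hb0 (Real.log 64 + 1)] with l h2 h3 h4 h5
  rw [Real.rpow_one] at h4
  have hl4 : 4 ≤ l := (le_max_left _ _).trans h3
  have hlL : L + 1 ≤ l := (le_max_left _ _).trans ((le_max_right _ _).trans h3)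
  have hll0 : 4 * l0 ≤ l := (le_max_right _ _).trans ((le_max_right _ _).trans h3)
  have hl : 0 < l := by linarith
  rw [add_zero] at h2
  refine h2.trans ?_
  rw [integral_conjG_split h h0.le hf (l - 1) l]
  have hG := (h.nonnegCont_opG h0.le hf).2 _
    (bigW_nonneg h.pos h.mono (Real.exp_pos (l - 1)).le)
  have key : 1 / 64 * Real.exp ((l - 1) ^ α - l ^ b) * (l - (l - 1)) ≤
      ∫ y in Real.exp (l - 1)..Real.exp l, conjG w f y := by
    rw [← integral_const_div]
    apply intervalIntegral.integral_mono_on (Real.exp_le_exp.2 (by linarith))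
      (intervalIntegrable_const_div _ _ _)
      (intervalIntegrable_of_continuousOn_Ici (h.continuousOn_conjG h0.le hf)
        (Real.exp_pos (l - 1)).le (Real.exp_pos l).le)
    intro y hy
    have hy0 : 0 < y := (Real.exp_pos _).trans_le hy.1
    have h6 : l - 1 ≤ Real.log y := (Real.le_log_iff_exp_le hy0).2 hy.1
    have h7 : Real.log y ≤ l := (Real.log_le_iff_le_exp hy0).2 hy.2
    obtain ⟨m, rfl⟩ : ∃ m, y = Real.exp m := ⟨Real.log y, (Real.exp_log hy0).symm⟩
    rw [Real.log_exp] at h6 h7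
    have hm : 0 < m := by linarith
    have hmb : m ^ b ≤ l ^ b := by gcongr
    have hW := bigW_nonneg h.pos h.mono (Real.exp_pos m).le
    have h8 : Real.exp (m - m ^ b) ≤ bigWInv w (f (bigW w (Real.exp m))) := by
      rw [← h.bigWInv_bigW (Real.exp_pos (m - m ^ b)).le]
      exact h.bigWInv_mono h0.le (bigW_nonneg h.pos h.mono (Real.exp_pos _).le)
        (hL m (by linarith))
    have h9 := weightFun_monotoneOn h.mono (Real.exp_pos _).le
      (h.bigWInv_nonneg h0.le (hf.2 _ hW)) h8
    have h10 := (hb (m - m ^ b) (by linarith)).1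
    have h11 := (hb m (by linarith)).2
    have hwp := weightFun_pos h.pos h.mono (Real.exp_pos m).le
    have hwp' := (weightFun_pos h.pos h.mono (Real.exp_pos (m - m ^ b)).le).le.trans h9
    have h12 : (m - m ^ b) ^ α ≤ m ^ α := by
      have : 0 ≤ m ^ b := by positivity
      apply Real.rpow_le_rpow <;> linarith
    have h13 : (l - 1) ^ α ≤ m ^ α := by
      apply Real.rpow_le_rpow <;> linarith
    unfold conjG
    calc 1 / 64 * Real.exp ((l - 1) ^ α - l ^ b) * (1 / Real.exp m)
        = 1 / 64 * Real.exp ((l - 1) ^ α - l ^ b - m) := by rw [Real.exp_sub _ m]; ring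
      _ ≤ 1 / 64 * Real.exp (m - m ^ b - (m - m ^ b) ^ α - 2 * (m - m ^ α)) := by
          gcongr 1 / 64 * Real.exp ?_; linarith
      _ = Real.exp (m - m ^ b - (m - m ^ b) ^ α) / 4 / (4 * Real.exp (m - m ^ α)) ^ 2 := by
          rw [Real.exp_sub (m - m ^ b - (m - m ^ b) ^ α), two_mul, Real.exp_add]
          field_simp
          norm_num
      _ ≤ _ := by
          gcongr
          linarith
  have h6 := rpow_sub_rpow_le h1 (m := l - 1) (l := l) (by linarith) (by linarith) hl
  rw [sub_sub_cancel, mul_one] at h6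
  have h7 : l ^ (α - 1) ≤ 1 := Real.rpow_le_one_of_one_le_of_nonpos (by linarith) (by linarith)
  have h8 : Real.exp (l ^ α - 3 * l ^ b) ≤
      1 / 64 * Real.exp ((l - 1) ^ α - l ^ b) * (l - (l - 1)) := by
    have e : 1 / 64 * Real.exp ((l - 1) ^ α - l ^ b) * (l - (l - 1)) =
        Real.exp ((l - 1) ^ α - l ^ b - Real.log 64) := by
      rw [Real.exp_sub _ (Real.log 64), Real.exp_log (by norm_num)]; ring
    rw [e]
    apply Real.exp_le_exp.2
    have : 0 ≤ l ^ b := by positivity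
    linarith
  linarith

end OpG

end

end VRRW

/-! ### Part (a): iterates of G and the index -/

namespace VRRW

noncomputable section

section PartA

variable {w : ℕ → ℝ} {α : ℝ}

theorem nonnegCont_linear {η : ℝ} (hη : 0 ≤ η) : NonnegCont (fun x => η * x) :=
  ⟨by fun_prop, fun x hx => mul_nonneg hη hx⟩

theorem IsLogPowerWeight.nonnegCont_iterate (h : IsLogPowerWeight α w) (h0 : 0 ≤ α) {η : ℝ}
    (hη : 0 ≤ η) (m : ℕ) : NonnegCont ((opG w)^[m] (fun x => η * x)) := by
  induction m with
  | zero => exact nonnegCont_linear hη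
  | succ m ih =>
    rw [Function.iterate_succ_apply']
    exact h.nonnegCont_opG h0 ih

theorem IsLogPowerWeight.iterate_mono (h : IsLogPowerWeight α w) (h0 : 0 ≤ α) {η η' : ℝ}
    (hη : 0 ≤ η) (hηη : η ≤ η') (m : ℕ) {x : ℝ} (hx : 0 ≤ x) :
    (opG w)^[m] (fun x => η * x) x ≤ (opG w)^[m] (fun x => η' * x) x := by
  induction m generalizing x with
  | zero => exact mul_le_mul_of_nonneg_right hηη hx
  | succ m ih =>
    rw [Function.iterate_succ_apply', Function.iterate_succ_apply']
    exact h.opG_mono h0 (h.nonnegCont_iterate h0 hη m)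
      (h.nonnegCont_iterate h0 (hη.trans hηη) m) (fun x hx => ih hx) hx

theorem IsLogPowerWeight.upperProfile_iterate (h : IsLogPowerWeight α w) (h0 : 0 < α) (h1 : α < 1)
    {η : ℝ} (hη : 0 ≤ η) (hη1 : η < 1) (m : ℕ) {a : ℝ} (ha : 0 < a) (ha1 : a < 1)
    (ham : a < (m + 1) * (1 - α)) : UpperProfile w ((opG w)^[m] (fun x => η * x)) a := by
  induction m generalizing a with
  | zero =>
    simp only [Nat.cast_zero, zero_add, one_mul] at ham
    filter_upwards [(h.scaleBounds h0.le).eventually_mul_shift_lt h0 h1 hη1 le_rfl ha ham] with l hl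
    rw [add_zero] at hl
    exact hl.le
  | succ m ih =>
    rw [Function.iterate_succ_apply']
    push_cast at ham
    have hm : 0 < ((m : ℝ) + 1) * (1 - α) := by
      have : 0 < 1 - α := by linarith
      positivity
    -- c is the exponent before the last application of G: large enough to reach a with a gain below
    -- 1-α, and below α so that `upperProfile_opG` applies. There is room because a < 1.
    obtain ⟨c, hc1, hc2⟩ : ∃ c, max 0 (a - (1 - α)) < c ∧ c < min α ((m + 1) * (1 - α)) := by
      apply exists_between
      rw [max_lt_iff, lt_min_iff, lt_min_iff]
      exact ⟨⟨h0, hm⟩, by linarith, by linarith⟩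
    rw [max_lt_iff] at hc1
    rw [lt_min_iff] at hc2
    exact h.upperProfile_opG h0 h1 (h.nonnegCont_iterate h0.le hη m) hc1.1 hc2.1
      (ih hc1.1 (by linarith) hc2.2) (by linarith) ha1

theorem IsLogPowerWeight.lowerProfile_iterate (h : IsLogPowerWeight α w) (h0 : 0 < α) (h1 : α < 1)
    {η : ℝ} (hη : 0 < η) (m : ℕ) {b : ℝ} (hb1 : b < 1)
    (hbm : (m + 1) * (1 - α) < b) : LowerProfile w ((opG w)^[m] (fun x => η * x)) b := by
  induction m generalizing b with
  | zero =>
    simp only [Nat.cast_zero, zero_add, one_mul] at hbm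
    obtain ⟨c, hc, hlow⟩ := (h.scaleBounds h0.le).eventually_lower h0 h1
    filter_upwards [hlow, (h.scaleBounds h0.le).eventually_shift_add_le h0 h1 le_rfl
      (by linarith : 0 + (1 - α) < b) hb1 (-Real.log (η * c)) 0, eventually_ge_atTop 1]
      with l h2 h3 h4
    rw [add_zero] at h3
    refine h3.trans ?_
    rw [Real.rpow_zero, mul_one, sub_neg_eq_add, Real.exp_add, Real.exp_log (by positivity)]
    have h5 : 1 ≤ l ^ (1 - α) := Real.one_le_rpow h4 (by linarith)
    have h6 : c * 1 * Real.exp (l ^ α) ≤ c * l ^ (1 - α) * Real.exp (l ^ α) := by gcongr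
    simp only [Function.iterate_zero, id_eq]
    calc Real.exp (l ^ α) * (η * c) = η * (c * 1 * Real.exp (l ^ α)) := by ring
      _ ≤ _ := by
        gcongr
        exact h6.trans h2
  | succ m ih =>
    rw [Function.iterate_succ_apply']
    push_cast at hbm
    have hm : 0 < ((m : ℝ) + 1) * (1 - α) := by
      have : 0 < 1 - α := by linarith
      positivity
    obtain ⟨c, hc1, hc2⟩ : ∃ c, (m + 1) * (1 - α) < c ∧ c < b - (1 - α) :=
      exists_between (by linarith)
    exact h.lowerProfile_opG h0 h1 (h.nonnegCont_iterate h0.le hη.le m) (hm.trans hc1)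
      (ih (by linarith) hc1) (by linarith) hb1

/-- The m-th iterate admits an exponent strictly between α and 1, and one more application of G then
gives a bounded function. -/
theorem IsLogPowerWeight.bounded_iterate (h : IsLogPowerWeight α w) (h0 : 0 < α) (h1 : α < 1)
    {η : ℝ} (hη : 0 ≤ η) (hη1 : η < 1) (m : ℕ) (hm : α < (m + 1) * (1 - α)) :
    BoundedOnHalfLine ((opG w)^[m + 1] (fun x => η * x)) := by
  obtain ⟨a, ha1, ha2⟩ := exists_between (lt_min hm h1)
  rw [lt_min_iff] at ha2
  rw [Function.iterate_succ_apply']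
  exact h.bounded_opG h0 h1 (h.nonnegCont_iterate h0.le hη m) ha1 ha2.2
    (h.upperProfile_iterate h0 h1 hη hη1 m (h0.trans ha1) ha2.2 ha2.1)

/-- A lower exponent b < 1 is available, so l - l^b tends to infinity and the lower profile forces
divergence along W(e^l). -/
theorem IsLogPowerWeight.not_bounded_iterate (h : IsLogPowerWeight α w) (h0 : 0 < α) (h1 : α < 1)
    {η : ℝ} (hη : 0 < η) (m : ℕ) (hm : (m + 1) * (1 - α) < 1) :
    ¬ BoundedOnHalfLine ((opG w)^[m] (fun x => η * x)) := by
  rintro ⟨C, hC⟩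
  obtain ⟨b, hb1, hb2⟩ := exists_between hm
  have hsub : Tendsto (fun l : ℝ => l - l ^ b) atTop atTop := by
    refine tendsto_atTop_mono' atTop (f₁ := fun l => l / 2) ?_
      (tendsto_id.atTop_div_const (by norm_num))
    filter_upwards [eventually_mul_rpow_le hb2 2] with l hl
    rw [Real.rpow_one] at hl
    linarith
  have h2 := ((h.scaleBounds h0.le).tendsto_atTop.comp hsub).eventually_gt_atTop C
  obtain ⟨l, hl1, hl2⟩ := ((h.lowerProfile_iterate h0 h1 hη m hb2 hb1).and h2).exists
  have h3 := (le_abs_self _).trans (hC _ (bigW_nonneg h.pos h.mono (Real.exp_pos l).le))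
  simp only [Function.comp_apply] at hl2
  linarith

theorem IsLogPowerWeight.iIndex_le (h : IsLogPowerWeight α w) (h0 : 0 < α) (h1 : α < 1)
    {η : ℝ} (hη : η ∈ Ioo (0 : ℝ) 1) {m : ℕ} (hm : α < (m + 1) * (1 - α)) :
    iIndex w η ≤ ((m + 2 : ℕ) : ℕ∞) :=
  iInf₂_le (m + 2) ⟨by omega, h.bounded_iterate h0 h1 hη.1.le hη.2 m hm⟩

/-- G is monotone, so boundedness passes to smaller η. This yields the one-sided limits for every α,
including the critical values at which the index is not computed. -/
theorem IsLogPowerWeight.iIndex_monotoneOn (h : IsLogPowerWeight α w) (h0 : 0 ≤ α) :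
    MonotoneOn (iIndex w) (Ioo 0 1) := by
  intro η hη η' hη' hle
  refine le_iInf₂ fun n hn => iInf₂_le n ⟨hn.1, ?_⟩
  obtain ⟨C, hC⟩ := hn.2
  refine ⟨C, fun x hx => ?_⟩
  rw [abs_of_nonneg ((h.nonnegCont_iterate h0 hη.1.le _).2 x hx)]
  exact ((h.iterate_mono h0 hη.1.le hle _ hx).trans (le_abs_self _)).trans (hC x hx)

theorem IsLogPowerWeight.iIndex_eq (h : IsLogPowerWeight α w) (h0 : 0 < α) (h1 : α < 1)
    {n : ℕ} (hn : 1 ≤ n) (hα : α ∈ Ioo (((n : ℝ) - 1) / n) ((n : ℝ) / (n + 1)))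
    {η : ℝ} (hη : η ∈ Ioo (0 : ℝ) 1) : iIndex w η = (n : ℕ∞) + 1 := by
  have hn0 : (0 : ℝ) < n := by exact_mod_cast hn
  have hα1 := hα.1
  have hα2 := hα.2
  rw [div_lt_iff₀ hn0] at hα1
  rw [lt_div_iff₀ (by positivity)] at hα2
  -- With n = m + 1, the two bounds on α become (m+1)(1-α) < 1 and α < (m+1)(1-α), the hypotheses of
  -- the unboundedness and boundedness criteria.
  obtain ⟨m, rfl⟩ : ∃ m, n = m + 1 := ⟨n - 1, by omega⟩
  push_cast at hα1 hα2
  apply le_antisymm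
  · have := h.iIndex_le h0 h1 hη (m := m) (by nlinarith)
    refine this.trans_eq ?_
    push_cast
    rw [add_assoc]; norm_num
  · refine le_iInf₂ fun k hk => ?_
    by_contra hlt
    have hlt' : (k : ℕ∞) < ((m + 1 + 1 : ℕ) : ℕ∞) := by push_cast; exact_mod_cast not_le.1 hlt
    have hk2 : k < m + 2 := by exact_mod_cast hlt'
    refine h.not_bounded_iterate h0 h1 hη.1 (k - 1) ?_ hk.2
    have hk1 := hk.1
    have e : ((k - 1 : ℕ) : ℝ) + 1 = k := by
      rw [Nat.cast_sub (by omega)]; simp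
    rw [e]
    have hk3 : (k : ℝ) ≤ m + 1 := by exact_mod_cast (by omega : k ≤ m + 1)
    have : (k : ℝ) * (1 - α) ≤ (m + 1) * (1 - α) := by
      have : 0 ≤ 1 - α := by linarith
      gcongr
    nlinarith

theorem limits_of_isLogPowerWeight (h : IsLogPowerWeight α w) (h0 : 0 < α) (h1 : α < 1) :
    Tendsto (iIndex w) (𝓝[<] (1 / 2 : ℝ)) (𝓝 (iMinus w)) ∧
      Tendsto (iIndex w) (𝓝[>] (1 / 2 : ℝ)) (𝓝 (iPlus w)) ∧
      iMinus w < ⊤ ∧ iPlus w < ⊤ ∧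
      ∀ n : ℕ, 1 ≤ n → α ∈ Ioo (((n : ℝ) - 1) / n) ((n : ℝ) / (n + 1)) →
        iMinus w = (n : ℕ∞) + 1 ∧ iPlus w = (n : ℕ∞) + 1 := by
  have hmono := h.iIndex_monotoneOn h0.le
  have hl : Tendsto (iIndex w) (𝓝[<] (1 / 2 : ℝ)) (𝓝 (iMinus w)) :=
    tendsto_leftLim_of_tendsto ⟨_, MonotoneOn.tendsto_nhdsWithin_Ioo_left
      (y := 0) (x := 1 / 2) ⟨1 / 4, by norm_num⟩
      (hmono.mono (Ioo_subset_Ioo_right (by norm_num))) (OrderTop.bddAbove _)⟩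
  have hr : Tendsto (iIndex w) (𝓝[>] (1 / 2 : ℝ)) (𝓝 (iPlus w)) :=
    tendsto_rightLim_of_tendsto ⟨_, MonotoneOn.tendsto_nhdsWithin_Ioo_right
      (x := 1 / 2) (y := 1) ⟨3 / 4, by norm_num⟩
      (hmono.mono (Ioo_subset_Ioo_left (by norm_num))) (OrderBot.bddBelow _)⟩
  have hevl : ∀ᶠ η in 𝓝[<] (1 / 2 : ℝ), η ∈ Ioo (0 : ℝ) 1 :=
    mem_of_superset (Ioo_mem_nhdsLT (by norm_num : (0 : ℝ) < 1 / 2))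
      (Ioo_subset_Ioo_right (by norm_num))
  have hevr : ∀ᶠ η in 𝓝[>] (1 / 2 : ℝ), η ∈ Ioo (0 : ℝ) 1 :=
    mem_of_superset (Ioo_mem_nhdsGT (by norm_num : (1 / 2 : ℝ) < 1))
      (Ioo_subset_Ioo_left (by norm_num))
  obtain ⟨m, hm⟩ : ∃ m : ℕ, α < (m + 1) * (1 - α) := by
    obtain ⟨m, hm⟩ := exists_nat_gt (α / (1 - α))
    refine ⟨m, ?_⟩
    rw [div_lt_iff₀ (by linarith)] at hm
    nlinarith
  have htop : ((m + 2 : ℕ) : ℕ∞) < ⊤ := ENat.natCast_lt_top _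
  refine ⟨hl, hr, lt_of_le_of_lt (le_of_tendsto hl ?_) htop,
    lt_of_le_of_lt (le_of_tendsto hr ?_) htop, fun n hn hα => ⟨?_, ?_⟩⟩
  · filter_upwards [hevl] with η hη using h.iIndex_le h0 h1 hη hm
  · filter_upwards [hevr] with η hη using h.iIndex_le h0 h1 hη hm
  · refine tendsto_nhds_unique hl (tendsto_const_nhds.congr' ?_)
    filter_upwards [hevl] with η hη using (h.iIndex_eq h0 h1 hn hα hη).symm
  · refine tendsto_nhds_unique hr (tendsto_const_nhds.congr' ?_)
    filter_upwards [hevr] with η hη using (h.iIndex_eq h0 h1 hn hα hη).symm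

end PartA

end

end VRRW

/-! ### Local times, compensators and balanced paths -/

namespace VRRW

noncomputable section

section Paths

/-- The number of visits to `k` strictly before time `n`. -/
def visitsBefore (x : ℕ → ℤ) (n : ℕ) (k : ℤ) : ℕ :=
  ((Finset.range n).filter (fun i => x i = k)).card

theorem visitsBefore_succ (x : ℕ → ℤ) (n : ℕ) (k : ℤ) :
    visitsBefore x (n + 1) k = visitsBefore x n k + if x n = k then 1 else 0 := by
  unfold visitsBefore
  rw [Finset.range_add_one, Finset.filter_insert]
  split_ifs with h
  · rw [Finset.card_insert_of_notMem (by simp)]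
  · simp

theorem localTime_eq_add (x : ℕ → ℤ) (n : ℕ) (k : ℤ) :
    localTime x n k = visitsBefore x n k + if x n = k then 1 else 0 := visitsBefore_succ x n k

theorem localTime_succ (x : ℕ → ℤ) (n : ℕ) (k : ℤ) :
    localTime x (n + 1) k = localTime x n k + if x (n + 1) = k then 1 else 0 :=
  visitsBefore_succ x (n + 1) k

theorem visitsBefore_mono (x : ℕ → ℤ) (k : ℤ) : Monotone (fun n => visitsBefore x n k) :=
  monotone_nat_of_le_succ fun n => by rw [visitsBefore_succ]; omega

theorem localTime_mono (x : ℕ → ℤ) (k : ℤ) : Monotone (fun n => localTime x n k) :=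
  monotone_nat_of_le_succ fun n => by rw [localTime_succ]; omega

theorem localTime_succ_le (x : ℕ → ℤ) (n : ℕ) (k : ℤ) :
    localTime x (n + 1) k ≤ localTime x n k + 1 := by
  rw [localTime_succ]; split_ifs <;> omega

theorem visitsBefore_le_localTime (x : ℕ → ℤ) (n : ℕ) (k : ℤ) :
    visitsBefore x n k ≤ localTime x n k := by
  rw [localTime_eq_add]; omega

theorem localTime_le_visitsBefore_add_one (x : ℕ → ℤ) (n : ℕ) (k : ℤ) :
    localTime x n k ≤ visitsBefore x n k + 1 := by
  rw [localTime_eq_add]; split_ifs <;> omega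

theorem localTime_neg (x : ℕ → ℤ) (n : ℕ) (k : ℤ) :
    localTime (fun i => -x i) n k = localTime x n (-k) := by
  unfold localTime
  congr 1
  apply Finset.filter_congr
  intro i _
  exact neg_eq_iff_eq_neg

theorem visitsBefore_neg (x : ℕ → ℤ) (n : ℕ) (k : ℤ) :
    visitsBefore (fun i => -x i) n k = visitsBefore x n (-k) := by
  unfold visitsBefore
  congr 1
  apply Finset.filter_congr
  intro i _
  exact neg_eq_iff_eq_neg

/-- Reindexes visit times by visit counts. At a visit preceded by j others the local time already
counts the current one, whence j + 1. -/
theorem sum_visits (x : ℕ → ℤ) (k : ℤ) (g : ℕ → ℝ) {T n : ℕ} (hT : T ≤ n) :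
    ∑ i ∈ Finset.Ico T n, (if x i = k then g (localTime x i k) else 0) =
      ∑ j ∈ Finset.Ico (visitsBefore x T k) (visitsBefore x n k), g (j + 1) := by
  induction n, hT using Nat.le_induction with
  | base => simp
  | succ n hn ih =>
    rw [Finset.sum_Ico_succ_top hn, ih, visitsBefore_succ]
    split_ifs with h
    · rw [Finset.sum_Ico_succ_top (visitsBefore_mono x k hn), localTime_eq_add, if_pos h]
    · simp

/-- The path makes nearest neighbour steps up to time `n`. -/
def IsNNPath (x : ℕ → ℤ) (n : ℕ) : Prop := ∀ i < n, x (i + 1) = x i + 1 ∨ x (i + 1) = x i - 1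

/-- Two visits to y are separated by a visit to a neighbour. The induction keeps the extra unit only
while the path sits at y. -/
theorem IsNNPath.localTime_le {x : ℕ → ℤ} {n : ℕ} (h : IsNNPath x n) (y : ℤ) :
    localTime x n y ≤ localTime x n (y - 1) + localTime x n (y + 1) + 1 := by
  have key : ∀ m ≤ n, localTime x m y ≤ localTime x m (y - 1) + localTime x m (y + 1) +
      if x m = y then 1 else 0 := by
    intro m hm
    induction m with
    | zero =>
      rw [localTime_eq_add]
      simp [visitsBefore]
    | succ m ih =>
      have ih := ih (by omega)
      have hs := h m (by omega)
      rw [localTime_succ, localTime_succ x m (y - 1), localTime_succ x m (y + 1)]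
      split_ifs at * <;> omega
  have := key n le_rfl
  split_ifs at this <;> omega

/-- Compensator of the weighted number of jumps out of `k` between the times `T` and `n`. -/
def jumpComp (w : ℕ → ℝ) (x : ℕ → ℤ) (T n : ℕ) (k : ℤ) : ℝ :=
  ∑ i ∈ Finset.Ico T n, if x i = k then
    1 / (w (localTime x i (k - 1)) + w (localTime x i (k + 1))) else 0

/-- Weighted number of jumps from `k` to `y` between the times `T` and `n`. -/
def jumpSum (w : ℕ → ℝ) (x : ℕ → ℤ) (T n : ℕ) (k y : ℤ) : ℝ :=
  ∑ i ∈ Finset.Ico T n, if x i = k ∧ x (i + 1) = y then 1 / w (localTime x i y) else 0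

theorem jumpComp_succ (w : ℕ → ℝ) (x : ℕ → ℤ) {T n : ℕ} (hT : T ≤ n) (k : ℤ) :
    jumpComp w x T (n + 1) k = jumpComp w x T n k + if x n = k then
      1 / (w (localTime x n (k - 1)) + w (localTime x n (k + 1))) else 0 := by
  unfold jumpComp; rw [Finset.sum_Ico_succ_top hT]

theorem jumpSum_succ (w : ℕ → ℝ) (x : ℕ → ℤ) {T n : ℕ} (hT : T ≤ n) (k y : ℤ) :
    jumpSum w x T (n + 1) k y = jumpSum w x T n k y +
      if x n = k ∧ x (n + 1) = y then 1 / w (localTime x n y) else 0 := by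
  unfold jumpSum; rw [Finset.sum_Ico_succ_top hT]

theorem jumpComp_neg (w : ℕ → ℝ) (x : ℕ → ℤ) (T n : ℕ) (k : ℤ) :
    jumpComp w (fun i => -x i) T n k = jumpComp w x T n (-k) := by
  unfold jumpComp
  apply Finset.sum_congr rfl
  intro i _
  simp only [neg_eq_iff_eq_neg, localTime_neg]
  split_ifs
  · rw [show -(k - 1) = -k + 1 by ring, show -(k + 1) = -k - 1 by ring, add_comm]
  · rfl

theorem jumpComp_nonneg {w : ℕ → ℝ} (hp : ∀ k, 0 < w k) (x : ℕ → ℤ) (T n : ℕ) (k : ℤ) :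
    0 ≤ jumpComp w x T n k := by
  apply Finset.sum_nonneg
  intro i _
  have h1 := hp (localTime x i (k - 1))
  have h2 := hp (localTime x i (k + 1))
  split_ifs <;> positivity

theorem jumpComp_eq_zero (w : ℕ → ℝ) {x : ℕ → ℤ} {T n : ℕ} {k : ℤ} (h : ∀ i ≤ n, x i ≠ k) :
    jumpComp w x T n k = 0 := by
  apply Finset.sum_eq_zero
  intro i hi
  rw [if_neg (h i (Finset.mem_Ico.1 hi).2.le)]

theorem jumpComp_mono {w : ℕ → ℝ} (hp : ∀ k, 0 < w k) (x : ℕ → ℤ) {T m n : ℕ} (hmn : m ≤ n)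
    (k : ℤ) : jumpComp w x T m k ≤ jumpComp w x T n k := by
  unfold jumpComp
  apply Finset.sum_le_sum_of_subset_of_nonneg (Finset.Ico_subset_Ico_right hmn)
  intro i _ _
  have h1 := hp (localTime x i (k - 1))
  have h2 := hp (localTime x i (k + 1))
  split_ifs <;> positivity

/-- Each new visit to y is the arrival of exactly one jump, from y-1 or y+1, weighted by the local
time of y just before the arrival. -/
theorem sum_Ico_localTime (w : ℕ → ℝ) {x : ℕ → ℤ} {T n : ℕ} (hT : T ≤ n) (h : IsNNPath x n)
    (y : ℤ) : ∑ j ∈ Finset.Ico (localTime x T y) (localTime x n y), 1 / w j =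
      jumpSum w x T n (y - 1) y + jumpSum w x T n (y + 1) y := by
  induction n, hT using Nat.le_induction with
  | base => simp [jumpSum]
  | succ n hn ih =>
    rw [jumpSum_succ w x hn, jumpSum_succ w x hn, localTime_succ]
    have ih := ih fun i hi => h i (by omega)
    have hs := h n (by omega)
    by_cases hy : x (n + 1) = y
    · rw [if_pos hy, Finset.sum_Ico_succ_top (localTime_mono x y hn), ih]
      rcases hs with hs | hs
      · rw [if_pos ⟨by omega, hy⟩, if_neg (by omega)]; ring
      · rw [if_neg (by omega), if_pos ⟨by omega, hy⟩]; ring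
    · rw [if_neg hy, if_neg (by tauto), if_neg (by tauto)]
      simpa using ih

variable {w : ℕ → ℝ}

theorem bigW_succ_bounds (hp : ∀ k, 0 < w k) (hw : Monotone w) (j : ℕ) :
    1 / w (j + 1) ≤ bigW w (j + 1) - bigW w j ∧ bigW w (j + 1) - bigW w j ≤ 1 / w j := by
  have hj : (0 : ℝ) ≤ j := Nat.cast_nonneg j
  have hI := intervalIntegrable_one_div_weightFun hp hw hj (by linarith : (0 : ℝ) ≤ j + 1)
  rw [bigW_sub_eq hp hw hj (by linarith)]
  have hc : ∀ c : ℝ, ∫ _ in (j : ℝ)..(j + 1), c = c := by intro c; simp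
  have hpt : ∀ u ∈ Icc (j : ℝ) (j + 1), 1 / w (j + 1) ≤ 1 / weightFun w u ∧
      1 / weightFun w u ≤ 1 / w j := by
    intro u hu
    have hu0 : 0 ≤ u := hj.trans hu.1
    have h1 := weightFun_monotoneOn hw hj hu0 hu.1
    have h2 := weightFun_monotoneOn hw hu0 (by simp only [mem_Ici]; linarith) hu.2
    rw [weightFun_natCast] at h1
    rw [show ((j : ℝ) + 1) = ((j + 1 : ℕ) : ℝ) by push_cast; ring, weightFun_natCast] at h2
    exact ⟨one_div_le_one_div_of_le (weightFun_pos hp hw hu0) h2,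
      one_div_le_one_div_of_le (hp j) h1⟩
  constructor
  · rw [← hc (1 / w (j + 1))]
    exact intervalIntegral.integral_mono_on (by linarith) (by simp) hI fun u hu => (hpt u hu).1
  · rw [← hc (1 / w j)]
    exact intervalIntegral.integral_mono_on (by linarith) hI (by simp) fun u hu => (hpt u hu).2

theorem bigW_sub_le_sum (hp : ∀ k, 0 < w k) (hw : Monotone w) {a b : ℕ} (hab : a ≤ b) :
    bigW w b - bigW w a ≤ ∑ j ∈ Finset.Ico a b, 1 / w j := by
  induction b, hab using Nat.le_induction with
  | base => simp
  | succ b hb ih =>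
    rw [Finset.sum_Ico_succ_top hb]
    have := (bigW_succ_bounds hp hw b).2
    push_cast
    linarith

theorem sum_le_bigW_sub (hp : ∀ k, 0 < w k) (hw : Monotone w) {a b : ℕ} (hab : a ≤ b) :
    ∑ j ∈ Finset.Ico a b, 1 / w (j + 1) ≤ bigW w b - bigW w a := by
  induction b, hab using Nat.le_induction with
  | base => simp
  | succ b hb ih =>
    rw [Finset.sum_Ico_succ_top hb]
    have := (bigW_succ_bounds hp hw b).1
    push_cast
    linarith

/-- The left Riemann sum of the decreasing function 1/w exceeds its integral by at most the
telescoping difference 1/w(a) - 1/w(b). -/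
theorem sum_le_bigW_sub_add (hp : ∀ k, 0 < w k) (hw : Monotone w) {a b : ℕ} (hab : a ≤ b) :
    ∑ j ∈ Finset.Ico a b, 1 / w j ≤ bigW w b - bigW w a + 1 / w 0 := by
  have h : ∑ j ∈ Finset.Ico a b, 1 / w j ≤ bigW w b - bigW w a + 1 / w a - 1 / w b := by
    induction b, hab using Nat.le_induction with
    | base => simp
    | succ b hb ih =>
      rw [Finset.sum_Ico_succ_top hb]
      have := (bigW_succ_bounds hp hw b).1
      push_cast
      linarith
  have h1 : 1 / w a ≤ 1 / w 0 := one_div_le_one_div_of_le (hp 0) (hw (Nat.zero_le a))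
  have h2 : 0 < 1 / w b := one_div_pos.2 (hp b)
  linarith

/-- A path in `[-K, K]` whose local times follow their mean field approximation between the
times `T` and `n`. -/
structure IsBalanced (w : ℕ → ℝ) (K : ℕ) (x : ℕ → ℤ) (T n : ℕ) : Prop where
  abs_le : ∀ i ≤ n, |x i| ≤ K
  step : IsNNPath x n
  approx : ∀ i, T ≤ i → i ≤ n → ∀ y : ℤ, |y| ≤ K →
    |bigW w (localTime x i y) - bigW w (localTime x T y) -
      jumpComp w x T i (y - 1) - jumpComp w x T i (y + 1)| ≤ 3

theorem IsBalanced.mono {K : ℕ} {x : ℕ → ℤ} {T m n : ℕ} (h : IsBalanced w K x T n) (hmn : m ≤ n) :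
    IsBalanced w K x T m :=
  ⟨fun i hi => h.abs_le i (hi.trans hmn), fun i hi => h.step i (hi.trans_le hmn),
    fun i h1 h2 => h.approx i h1 (h2.trans hmn)⟩

theorem IsBalanced.neg {K : ℕ} {x : ℕ → ℤ} {T n : ℕ} (h : IsBalanced w K x T n) :
    IsBalanced w K (fun i => -x i) T n := by
  refine ⟨fun i hi => by rw [abs_neg]; exact h.abs_le i hi, fun i hi => ?_, ?_⟩
  · have := h.step i hi
    omega
  · intro i h1 h2 y hy
    have := h.approx i h1 h2 (-y) (by rwa [abs_neg])
    simp only [localTime_neg, jumpComp_neg]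
    rw [show -(y - 1) = -y + 1 by ring, show -(y + 1) = -y - 1 by ring]
    convert this using 2
    ring

/-- The 3 in `IsBalanced` is made of two fluctuations of size 1 and of 1/w(0) ≤ 1 for replacing the
sum of 1/w(j) by W. -/
theorem IsBalanced.of_jumpSum (hp : ∀ k, 0 < w k) (hw : Monotone w) (hw0 : 1 ≤ w 0)
    {K : ℕ} {x : ℕ → ℤ} {T n : ℕ} (h1 : ∀ i ≤ n, |x i| ≤ K) (h2 : IsNNPath x n)
    (h3 : ∀ i, T ≤ i → i ≤ n → ∀ y : ℤ, |y| ≤ K →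
      |jumpSum w x T i (y - 1) y - jumpComp w x T i (y - 1)| ≤ 1 ∧
      |jumpSum w x T i (y + 1) y - jumpComp w x T i (y + 1)| ≤ 1) :
    IsBalanced w K x T n := by
  refine ⟨h1, h2, fun i hT hi y hy => ?_⟩
  obtain ⟨a1, a2⟩ := h3 i hT hi y hy
  have hZ := localTime_mono x y hT
  have e := sum_Ico_localTime w hT (fun j hj => h2 j (by omega)) y
  have b1 := bigW_sub_le_sum hp hw hZ
  have b2 := sum_le_bigW_sub_add hp hw hZ
  have b3 : 1 / w 0 ≤ 1 := by rw [div_le_one (hp 0)]; exact hw0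
  simp only at b1 b2
  rw [e] at b1 b2
  rw [_root_.abs_le] at a1 a2 ⊢
  constructor <;> linarith

end Paths

end

end VRRW

/-! ### Thresholds for the crude envelope -/

namespace VRRW

noncomputable section

/-- Telescoping bound for the tails of `∑ 1 / (j log² j)`. -/
theorem sum_one_div_mul_log_sq_le {s t : ℕ} (hs : 3 ≤ s) :
    ∑ j ∈ Finset.Ico s t, 1 / (((j + 1 : ℕ) : ℝ) * Real.log ((j + 1 : ℕ) : ℝ) ^ 2) ≤
      1 / Real.log s := by
  rcases le_total t s with hts | hst
  · rw [Finset.Ico_eq_empty_of_le hts, Finset.sum_empty]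
    have : 0 ≤ Real.log s := Real.log_natCast_nonneg s
    positivity
  have key : ∑ j ∈ Finset.Ico s t, 1 / (((j + 1 : ℕ) : ℝ) * Real.log ((j + 1 : ℕ) : ℝ) ^ 2) ≤
      1 / Real.log s - 1 / Real.log t := by
    induction t, hst using Nat.le_induction with
    | base => simp
    | succ t ht ih =>
      rw [Finset.sum_Ico_succ_top ht]
      have ht3 : (3 : ℝ) ≤ t := by exact_mod_cast hs.trans ht
      have hl0 : 0 < Real.log t := Real.log_pos (by linarith)
      have hll : Real.log t ≤ Real.log ((t + 1 : ℕ) : ℝ) :=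
        Real.log_le_log (by linarith) (by push_cast; linarith)
      have hd : 1 / ((t + 1 : ℕ) : ℝ) ≤ Real.log ((t + 1 : ℕ) : ℝ) - Real.log t := by
        have h1 := Real.log_le_sub_one_of_pos (x := (t : ℝ) / ((t + 1 : ℕ) : ℝ))
          (by positivity)
        rw [Real.log_div (by linarith) (by positivity)] at h1
        have h2 : (t : ℝ) / ((t + 1 : ℕ) : ℝ) - 1 = -(1 / ((t + 1 : ℕ) : ℝ)) := by
          push_cast; field_simp; simp
        linarith
      set p := Real.log ((t + 1 : ℕ) : ℝ) with hp
      have hp0 : 0 < p := hl0.trans_le hll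
      have : 1 / (((t + 1 : ℕ) : ℝ) * p ^ 2) ≤ 1 / Real.log t - 1 / p := by
        rw [div_sub_div _ _ hl0.ne' hp0.ne', one_mul, mul_one, ← div_div, div_le_div_iff₀
          (by positivity) (by positivity)]
        calc 1 / ((t + 1 : ℕ) : ℝ) * (Real.log t * p) ≤ (p - Real.log t) * (p * p) := by
              gcongr
          _ = _ := by ring
      linarith
  have : 0 ≤ Real.log t := Real.log_natCast_nonneg t
  have : 0 ≤ 1 / Real.log t := by positivity
  linarith

/-- The quantitative largeness conditions used for the crude envelope. -/
structure CrudeThreshold (w : ℕ → ℝ) (α a L : ℝ) : Prop where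
  large : Real.exp 100 + 16 ≤ L
  weight_le : ∀ j z : ℕ, L ≤ j → (j : ℝ) ≤ z * Real.exp (-Real.log z ^ a) → w j ≤ 1 / 1024 * w z
  inv_weight_le : ∀ j z : ℕ, L ≤ j → (j : ℝ) ≤ z * Real.exp (-Real.log z ^ a) →
    1 / w z ≤ slowFactor α z * (1 / (j * Real.log j ^ 2))
  add_one_le : ∀ z : ℝ, L ≤ z → z * Real.exp (-Real.log z ^ a) + 1 ≤ z
  le_half : ∀ z : ℝ, L ≤ z → z * Real.exp (-Real.log z ^ a) ≤ z / 2
  half_lt : ∀ z : ℝ, L ≤ z → 1 / 2 * bigW w z < bigW w (z * Real.exp (-Real.log z ^ a))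
  weight_mul_le : ∀ j : ℕ, L ≤ j → w (8 * j) ≤ 32 * w j
  half_le : ∀ z : ℝ, L ≤ z → 1 / 2 * bigW w z ≤ bigW w (z / 9)
  mul_lt : ∀ z : ℝ, L ≤ z →
    (1 - 1 / 256) * bigW w (9 * z) < bigW w (z * Real.exp (-Real.log z ^ a))
  gap : ∀ z : ℝ, L ≤ z → 7 + 1 / 100 * slowFactor α z < bigW w z - bigW w (z / 4)

variable {w : ℕ → ℝ} {α : ℝ}

theorem eventually_forall_ge_of_log {p : ℝ → Prop} (h : ∀ᶠ l in atTop, p (Real.exp l)) :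
    ∀ᶠ L : ℝ in atTop, ∀ z, L ≤ z → p z := by
  rw [eventually_forall_ge_atTop]
  filter_upwards [Real.tendsto_log_atTop.eventually h, eventually_gt_atTop 0] with z hz h0
  rwa [Real.exp_log h0] at hz

theorem IsLogPowerWeight.eventually_nat_bounds (h : IsLogPowerWeight α w) :
    ∀ᶠ L : ℝ in atTop, ∀ k : ℕ, L ≤ k →
      (k : ℝ) / (2 * slowFactor α k) ≤ w k ∧ w k ≤ 2 * k / slowFactor α k := by
  obtain ⟨k0, hk0⟩ := h.bounds_nat
  filter_upwards [eventually_ge_atTop (k0 : ℝ)] with L hL k hk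
  exact hk0 k (by exact_mod_cast hL.trans hk)

/-- With 0 < a < 1-α, the factor exp(-log^a z) is too mild to change W by a fixed proportion, yet
strong enough to divide w by any constant and to gain a factor log² z. The whole crude envelope
exploits this contrast. -/
theorem IsLogPowerWeight.eventually_crudeThreshold (h : IsLogPowerWeight α w) (h0 : 0 < α)
    (h1 : α < 1) {a : ℝ} (ha : 0 < a) (haα : a < 1 - α) :
    ∀ᶠ L : ℝ in atTop, CrudeThreshold w α a L := by
  have hS := h.scaleBounds h0.le
  have eexp : ∀ l : ℝ, Real.exp l * Real.exp (-Real.log (Real.exp l) ^ a) = Real.exp (l - l ^ a) := by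
    intro l; rw [Real.log_exp, ← Real.exp_add, sub_eq_add_neg]
  have e9 : ∀ l : ℝ, 9 * Real.exp l = Real.exp (l + Real.log 9) := by
    intro l; rw [Real.exp_add, Real.exp_log (by norm_num)]; ring
  have hWmono : ∀ {x y : ℝ}, 0 ≤ x → x ≤ y → bigW w x ≤ bigW w y := fun hx hxy =>
    (bigW_le_iff h.pos h.mono hx (hx.trans hxy)).2 hxy
  -- pointwise facts about the pair `(j, z)`
  have hpair : ∀ᶠ L : ℝ in atTop, ∀ z, L ≤ z →
      2 * Real.log 4096 ≤ Real.log z ^ a ∧ Real.log z ^ (α - 1) ≤ 1 / 2 ∧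
      2 * Real.exp (-Real.log z ^ a) ≤ (Real.log z ^ 2)⁻¹ ∧ 1 ≤ Real.log z := by
    apply eventually_forall_ge_of_log
    filter_upwards [eventually_const_le_rpow ha (2 * Real.log 4096),
      eventually_mul_rpow_le (by linarith : α - 1 < 0) 2, eventually_mul_log_le_rpow ha 4,
      eventually_const_le_rpow ha (2 * Real.log 2), eventually_ge_atTop 1] with l h2 h3 h4 h5 h6
    rw [Real.log_exp]
    rw [Real.rpow_zero] at h3
    refine ⟨h2, by linarith, ?_, h6⟩
    have hl : 0 < l := by linarith
    rw [← Real.exp_log (by positivity : 0 < (l ^ 2)⁻¹), Real.log_inv, Real.log_pow]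
    nth_rewrite 1 [← Real.exp_log (by norm_num : (0 : ℝ) < 2)]
    rw [← Real.exp_add]
    apply Real.exp_le_exp.2
    push_cast
    linarith
  have hadd : ∀ᶠ L : ℝ in atTop, ∀ z, L ≤ z → z * Real.exp (-Real.log z ^ a) ≤ z / 2 := by
    apply eventually_forall_ge_of_log
    filter_upwards [eventually_const_le_rpow ha 1] with l h2
    rw [Real.log_exp]
    have h4 : Real.exp (-l ^ a) ≤ Real.exp (-1) := Real.exp_le_exp.2 (by linarith)
    have h5 : Real.exp (-1) ≤ 1 / 2 := by
      rw [Real.exp_neg, one_div]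
      exact inv_anti₀ (by norm_num) (by linarith [Real.add_one_le_exp (1 : ℝ)])
    nlinarith [Real.exp_pos l]
  have hhalf : ∀ᶠ L : ℝ in atTop, ∀ z, L ≤ z →
      1 / 2 * bigW w z < bigW w (z * Real.exp (-Real.log z ^ a)) := by
    apply eventually_forall_ge_of_log
    filter_upwards [hS.eventually_mul_shift_lt h0 h1 (by norm_num : (1 / 2 : ℝ) < 1) le_rfl ha haα]
      with l hl
    rw [eexp]
    simpa using hl
  have hmul : ∀ᶠ L : ℝ in atTop, ∀ z, L ≤ z →
      (1 - 1 / 256) * bigW w (9 * z) < bigW w (z * Real.exp (-Real.log z ^ a)) := by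
    apply eventually_forall_ge_of_log
    filter_upwards [hS.eventually_mul_shift_lt h0 h1 (by norm_num : (1 - 1 / 256 : ℝ) < 1)
      (Real.log_nonneg (by norm_num : (1 : ℝ) ≤ 9)) ha haα] with l hl
    rw [eexp, e9]
    exact hl
  -- The scale bounds over [l - log 4, l] give at least exp(l^α - 1) / 4, hence exp(l^α) / 12; since
  -- exp(l^α) ≥ 201 this beats 7 + exp(l^α) / 100.
  have hgap : ∀ᶠ L : ℝ in atTop, ∀ z, L ≤ z →
      7 + 1 / 100 * slowFactor α z < bigW w z - bigW w (z / 4) := by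
    apply eventually_forall_ge_of_log
    obtain ⟨l0, hl0, hb⟩ := hS.exists_bounds
    have hlog4 : (1 : ℝ) ≤ Real.log 4 := by
      rw [Real.le_log_iff_exp_le (by norm_num)]; linarith [Real.exp_one_lt_d9]
    have hlog4' : Real.log 4 ≤ 3 := by
      linarith [Real.log_le_sub_one_of_pos (by norm_num : (0 : ℝ) < 4)]
    filter_upwards [eventually_ge_atTop (l0 + 3),
      eventually_mul_rpow_le (by linarith : α - 1 < 0) 3,
      eventually_const_le_rpow h0 200] with l h2 h3 h4
    rw [Real.rpow_zero] at h3
    have hl : 0 < l := by linarith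
    have e4 : Real.exp l / 4 = Real.exp (l - Real.log 4) := by
      rw [Real.exp_sub, Real.exp_log (by norm_num)]
    have h5 := (hb (l - Real.log 4) l (by linarith) (by linarith)).1
    have h6 := rpow_sub_rpow_le h1 (m := l - Real.log 4) (l := l) (by linarith) (by linarith) hl
    rw [sub_sub_cancel] at h5 h6
    have hp : 0 < l ^ (α - 1) := by positivity
    have h7 : l ^ (α - 1) * Real.log 4 ≤ 1 := by nlinarith
    have h8 : Real.exp (l ^ α - 1) ≤ Real.exp ((l - Real.log 4) ^ α) :=
      Real.exp_le_exp.2 (by linarith)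
    rw [e4]
    simp only [slowFactor, Real.log_exp]
    have h9 : Real.exp (l ^ α) * (1 / 3) ≤ Real.exp (l ^ α - 1) := by
      rw [Real.exp_sub, div_eq_mul_inv _ (Real.exp 1), one_div]
      have h3 : Real.exp 1 ≤ 3 := by linarith [Real.exp_one_lt_d9]
      gcongr
    have h10 : 201 ≤ Real.exp (l ^ α) := by linarith [Real.add_one_le_exp (l ^ α)]
    have h11 : 1 / 4 * 1 * Real.exp ((l - Real.log 4) ^ α) ≤
        1 / 4 * Real.log 4 * Real.exp ((l - Real.log 4) ^ α) := by gcongr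
    linarith
  have hsh : ∀ᶠ L : ℝ in atTop, ∀ z, L ≤ z → Real.log 9 ≤ Real.log z ^ a := by
    apply eventually_forall_ge_of_log
    filter_upwards [eventually_const_le_rpow ha (Real.log 9)] with l hl
    rwa [Real.log_exp]
  filter_upwards [hpair, hadd, hhalf, hmul, hgap, h.eventually_nat_bounds,
    eventually_ge_atTop (Real.exp 100 + 16),
hsh] with L hpair hadd hhalf hmul hgap hnat hL hsh
  have hLpos : 0 < L := by linarith [Real.exp_pos 100]
  have hjz : ∀ j z : ℕ, L ≤ j → (j : ℝ) ≤ z * Real.exp (-Real.log z ^ a) →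
      L ≤ z ∧ (j : ℝ) ≤ z := by
    intro j z hj hjz
    have hz0 : 0 ≤ Real.log (z : ℝ) := Real.log_natCast_nonneg z
    have h3 : (j : ℝ) ≤ z := by
      refine hjz.trans (mul_le_of_le_one_right (Nat.cast_nonneg z) ?_)
      rw [Real.exp_le_one_iff]
      have : 0 ≤ Real.log (z : ℝ) ^ a := by positivity
      linarith
    exact ⟨hj.trans h3, h3⟩
  refine ⟨hL, ?_, ?_, fun z hz => by linarith [hadd z hz, Real.exp_pos 100], hadd, hhalf, ?_, ?_,
    hmul, hgap⟩
  · intro j z hj hjz'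
    obtain ⟨hLz, hjz''⟩ := hjz j z hj hjz'
    obtain ⟨p1, p2, p3, p4⟩ := hpair z hLz
    have hj0 : (0 : ℝ) < j := hLpos.trans_le hj
    have hz0 : (0 : ℝ) < z := hLpos.trans_le hLz
    have q1 := (hpair j hj).2.2.2
    have b1 := (hnat j hj).2
    have b2 := (hnat z hLz).1
    set lz := Real.log (z : ℝ) with hlz
    set lj := Real.log (j : ℝ) with hlj
    have hd : lj ≤ lz - lz ^ a := by
      have := Real.log_le_log hj0 hjz'
      rwa [Real.log_mul hz0.ne' (Real.exp_pos _).ne', Real.log_exp, ← sub_eq_add_neg] at this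
    have hpa : 0 < lz ^ a := by positivity
    have h6 := rpow_sub_rpow_le h1 (m := lj) (l := lz) (by linarith) (by linarith) (by linarith)
    have h7 : lz ^ (α - 1) * (lz - lj) ≤ 1 / 2 * (lz - lj) := by gcongr; linarith
    have ej : (2 : ℝ) * j / slowFactor α j = 2 * Real.exp (lj - lj ^ α) := by
      rw [Real.exp_sub, hlj, Real.exp_log hj0, slowFactor]; ring
    have ez : (z : ℝ) / (2 * slowFactor α z) = 1 / 2 * Real.exp (lz - lz ^ α) := by
      rw [Real.exp_sub, hlz, Real.exp_log hz0, slowFactor]; field_simp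
    rw [ej] at b1
    rw [ez] at b2
    -- 4096 = 4 * 1024, the 4 paying for the factors 2 in the bounds on w(j) and w(z).
    have h8 : Real.exp (lj - lj ^ α) ≤ Real.exp (lz - lz ^ α) * (1 / 4096) := by
      rw [← Real.exp_log (by norm_num : (0 : ℝ) < 1 / 4096), ← Real.exp_add, one_div, Real.log_inv]
      apply Real.exp_le_exp.2
      linarith
    linarith
  · intro j z hj hjz'
    obtain ⟨hLz, hjz''⟩ := hjz j z hj hjz'
    obtain ⟨p1, p2, p3, p4⟩ := hpair z hLz
    have hj0 : (0 : ℝ) < j := hLpos.trans_le hj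
    have hz0 : (0 : ℝ) < z := hLpos.trans_le hLz
    have q1 := (hpair j hj).2.2.2
    have b2 := (hnat z hLz).1
    have hs := slowFactor_pos α z
    have hlog : Real.log (j : ℝ) ≤ Real.log z := Real.log_le_log hj0 hjz''
    have h1 : 1 / w z ≤ slowFactor α z * (2 / z) := by
      rw [div_le_iff₀ (h.pos z)]
      rw [div_le_iff₀ (by positivity)] at b2
      have : slowFactor α z * (2 / z) * w z = w z * (2 * slowFactor α z) / z := by ring
      rw [this, le_div_iff₀ hz0]
      linarith
    refine h1.trans (mul_le_mul_of_nonneg_left ?_ hs.le)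
    have h2 : 2 * (j : ℝ) ≤ z * (Real.log z ^ 2)⁻¹ := by nlinarith
    have h3 : (Real.log z ^ 2)⁻¹ ≤ (Real.log (j : ℝ) ^ 2)⁻¹ := by gcongr
    rw [div_le_div_iff₀ hz0 (by positivity), one_mul]
    calc 2 * ((j : ℝ) * Real.log j ^ 2) = 2 * j * Real.log j ^ 2 := by ring
      _ ≤ z * (Real.log (j : ℝ) ^ 2)⁻¹ * Real.log j ^ 2 := by
        gcongr ?_ * _
        exact h2.trans (by gcongr)
      _ = z := by field_simp
  · intro j hj
    have hj0 : (0 : ℝ) < j := hLpos.trans_le hj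
    have q1 := (hpair j hj).2.2.2
    have h8j : L ≤ ((8 * j : ℕ) : ℝ) := by push_cast; linarith
    have b1 := (hnat (8 * j) h8j).2
    have b2 := (hnat j hj).1
    have hs := slowFactor_pos α j
    have hj1 : (1 : ℝ) ≤ j := by linarith [Real.exp_pos 100]
    have hmono : slowFactor α j ≤ slowFactor α ((8 * j : ℕ) : ℝ) :=
      slowFactor_mono h0.le hj1 (by push_cast; linarith)
    refine b1.trans ?_
    calc 2 * ((8 * j : ℕ) : ℝ) / slowFactor α ((8 * j : ℕ) : ℝ)
        ≤ 2 * ((8 * j : ℕ) : ℝ) / slowFactor α j := by gcongr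
      _ = 32 * (j / (2 * slowFactor α j)) := by push_cast; field_simp; norm_num
      _ ≤ _ := by gcongr
  · intro z hz
    have hpr := hsh z hz
    have hz0 : 0 < z := hLpos.trans_le hz
    refine (hhalf z hz).le.trans (hWmono (by positivity) ?_)
    rw [div_eq_mul_inv]
    gcongr
    rw [Real.exp_neg]
    rw [Real.log_le_iff_le_exp (by norm_num)] at hpr
    gcongr

end

end VRRW

/-! ### The crude envelope -/

namespace VRRW

noncomputable section

section Crude

variable {w : ℕ → ℝ} {α a L : ℝ} {K : ℕ} {x : ℕ → ℤ} {T n : ℕ}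

/-- The crude envelope, on the right of the origin, at time `i`. -/
structure CrudeRight (w : ℕ → ℝ) (a : ℝ) (K : ℕ) (x : ℕ → ℤ) (i : ℕ) : Prop where
  decay : ∀ k : ℤ, 1 ≤ k → k + 1 ≤ K → (localTime x i (k + 1) : ℝ) ≤
    localTime x i k * Real.exp (-Real.log (localTime x i k) ^ a)
  center : localTime x i 0 ≤ 8 * localTime x i 1
  second : bigW w (localTime x i 2) ≤ (1 - 1 / 256) * bigW w (localTime x i 0)

/-- The conditions on the configuration at time `T`, on the right of the origin. -/
structure CrudeInit (w : ℕ → ℝ) (a L : ℝ) (K : ℕ) (x : ℕ → ℤ) (T : ℕ) : Prop where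
  large : ∀ y : ℤ, |y| ≤ K → L ≤ visitsBefore x T y
  right : CrudeRight w a K x T
  start : ∀ k : ℤ, 2 ≤ k → k + 1 ≤ K →
    bigW w (localTime x T (k + 1)) + 3 ≤ 1 / 4 * bigW w (localTime x T k)
  second : bigW w (localTime x T 2) + 7 ≤ 1 / 2 * bigW w (localTime x T 0)
  center : localTime x T 1 ≤ localTime x T 0
  sym : |bigW w (localTime x T 1) - bigW w (localTime x T (-1))| ≤ 1

theorem CrudeInit.le_localTime (h : CrudeInit w a L K x T) {y : ℤ} (hy : |y| ≤ K) {i : ℕ}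
    (hi : T ≤ i) : L ≤ localTime x i y := by
  refine (h.large y hy).trans ?_
  have h1 := visitsBefore_le_localTime x T y
  have h2 := localTime_mono x y hi
  exact_mod_cast h1.trans h2

theorem bigW_nat_mono (hp : ∀ k, 0 < w k) (hw : Monotone w) {m k : ℕ} (h : m ≤ k) :
    bigW w m ≤ bigW w k :=
  (bigW_le_iff hp hw (Nat.cast_nonneg m) (Nat.cast_nonneg k)).2 (by exact_mod_cast h)

/-- The weight of the outer neighbour k + 2 is dropped from the denominator, and the visits to k + 1
are then indexed by their count. -/
theorem jumpComp_le_sum (hp : ∀ k, 0 < w k) {k : ℤ} (hT : T ≤ n) {g : ℕ → ℝ}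
    (h : ∀ i, T ≤ i → i < n → x i = k + 1 → 1 / w (localTime x i k) ≤ g (localTime x i (k + 1))) :
    jumpComp w x T n (k + 1) ≤
      ∑ j ∈ Finset.Ico (visitsBefore x T (k + 1)) (visitsBefore x n (k + 1)), g (j + 1) := by
  rw [← sum_visits x (k + 1) g hT]
  unfold jumpComp
  apply Finset.sum_le_sum
  intro i hi
  rw [Finset.mem_Ico] at hi
  split_ifs with hx
  · refine le_trans ?_ (h i hi.1 hi.2 hx)
    rw [add_sub_cancel_right]
    exact one_div_le_one_div_of_le (hp _) (by linarith [hp (localTime x i (k + 1 + 1))])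
  · exact le_rfl

theorem visit_bounds {i : ℕ} {y : ℤ} (hi : T ≤ i) (hL : L ≤ visitsBefore x T y) :
    L ≤ localTime x i y := by
  refine hL.trans ?_
  have h1 := visitsBefore_le_localTime x T y
  have h2 := localTime_mono x y hi
  exact_mod_cast h1.trans h2

/-- At each visit to k + 1, the inner site k is at least 1024 times heavier than k + 1, and the sum
of 1/w over the visits to k + 1 is at most W of its local time. -/
theorem jumpComp_le_bigW (hp : ∀ k, 0 < w k) (hw : Monotone w) (hth : CrudeThreshold w α a L)
    {k : ℤ} (hT : T ≤ n) (hL : L ≤ visitsBefore x T (k + 1))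
    (hdec : ∀ i, T ≤ i → i < n → (localTime x i (k + 1) : ℝ) ≤
      localTime x i k * Real.exp (-Real.log (localTime x i k) ^ a)) :
    jumpComp w x T n (k + 1) ≤ 1 / 1024 * bigW w (localTime x n (k + 1)) := by
  refine (jumpComp_le_sum hp hT (g := fun j => 1 / 1024 * (1 / w j)) ?_).trans ?_
  · intro i hi hin _
    have h1 := hth.weight_le _ _ (visit_bounds hi hL) (hdec i hi hin)
    rw [one_div_mul_one_div, one_div_le_one_div (hp _) (mul_pos (by norm_num) (hp _))]
    linarith
  · rw [← Finset.mul_sum]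
    have h1 := sum_le_bigW_sub hp hw (visitsBefore_mono x (k + 1) hT)
    simp only at h1
    have h2 := bigW_nonneg hp hw (Nat.cast_nonneg (visitsBefore x T (k + 1)) (α := ℝ))
    have h3 := bigW_nat_mono hp hw (visitsBefore_le_localTime x n (k + 1))
    gcongr
    linarith

/-- With j the local time of k + 1, the decay makes 1/w(Z(k)) at most the slow factor times the
summable 1 / (j log² j). The tail is at most 1 / log L ≤ 1/100, which is the role of exp 100 in
`CrudeThreshold`. -/
theorem jumpComp_le_slowFactor (hp : ∀ k, 0 < w k) (hth : CrudeThreshold w α a L) (h0 : 0 ≤ α)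
    {k : ℤ} (hT : T ≤ n) (hL : L ≤ visitsBefore x T (k + 1)) (hLk : L ≤ visitsBefore x T k)
    (hdec : ∀ i, T ≤ i → i < n → (localTime x i (k + 1) : ℝ) ≤
      localTime x i k * Real.exp (-Real.log (localTime x i k) ^ a)) :
    jumpComp w x T n (k + 1) ≤ 1 / 100 * slowFactor α (localTime x n k) := by
  have hL1 := hth.large
  have hpos := slowFactor_pos α (localTime x n k)
  refine (jumpComp_le_sum hp hT
    (g := fun j => slowFactor α (localTime x n k) * (1 / (j * Real.log j ^ 2))) ?_).trans ?_
  · intro i hi hin _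
    refine (hth.inv_weight_le _ _ (visit_bounds hi hL) (hdec i hi hin)).trans ?_
    have h1 := visit_bounds hi hLk
    gcongr
    apply slowFactor_mono h0
    · linarith [Real.exp_pos 100]
    · exact_mod_cast localTime_mono x k hin.le
  · rw [← Finset.mul_sum, mul_comm]
    gcongr
    have h3 : (16 : ℝ) ≤ visitsBefore x T (k + 1) := by linarith [Real.exp_pos 100]
    refine (sum_one_div_mul_log_sq_le ?_).trans ?_
    · have : 16 ≤ visitsBefore x T (k + 1) := by exact_mod_cast h3
      omega
    · apply one_div_le_one_div_of_le (by norm_num)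
      rw [Real.le_log_iff_exp_le (by linarith)]
      linarith

/-- When the walk leaves 1, both competing weights w(Z(0)) and w(Z(2)) are at most 32 w(Z(1)),
whence 1/64. The term -1 pays for the shift of the index by one. -/
theorem le_jumpComp_one (hp : ∀ k, 0 < w k) (hw : Monotone w) (hw0 : 1 ≤ w 0)
    (hth : CrudeThreshold w α a L) (hT : T ≤ n) (hL : L ≤ visitsBefore x T 1)
    (h8 : ∀ i, T ≤ i → i < n → localTime x i 0 ≤ 8 * localTime x i 1 ∧
      localTime x i 2 ≤ localTime x i 1) :
    1 / 64 * (bigW w (localTime x n 1) - bigW w (localTime x T 1) - 1) ≤ jumpComp w x T n 1 := by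
  have h1 : 1 / 64 * ∑ j ∈ Finset.Ico (visitsBefore x T 1) (visitsBefore x n 1), 1 / w (j + 1) ≤
      jumpComp w x T n 1 := by
    rw [Finset.mul_sum]
    have := sum_visits x 1 (fun j => 1 / 64 * (1 / w j)) hT
    rw [← this]
    unfold jumpComp
    apply Finset.sum_le_sum
    intro i hi
    rw [Finset.mem_Ico] at hi
    split_ifs with hx
    · obtain ⟨b1, b2⟩ := h8 i hi.1 hi.2
      have c0 := hth.weight_mul_le _ (visit_bounds hi.1 hL)
      have c1 := hw b1
      have c2 := hw (b2.trans (by omega : _ ≤ 8 * localTime x i 1))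
      rw [one_div_mul_one_div]
      have p1 := hp (localTime x i 0)
      have p2 := hp (localTime x i 2)
      apply one_div_le_one_div_of_le
      · rw [sub_self, one_add_one_eq_two]; linarith
      · rw [sub_self, one_add_one_eq_two]; linarith
    · exact le_rfl
  refine le_trans ?_ h1
  gcongr
  have h2 := bigW_sub_le_sum hp hw (Nat.succ_le_succ (visitsBefore_mono x 1 hT))
  rw [Nat.succ_eq_add_one, Nat.succ_eq_add_one, ← Finset.sum_Ico_add' _ _ _ 1] at h2
  have h3 := bigW_nat_mono hp hw (localTime_le_visitsBefore_add_one x n 1)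
  have h4 := bigW_nat_mono hp hw (Nat.succ_le_succ (visitsBefore_le_localTime x T 1))
  have h5 := (bigW_succ_bounds hp hw (localTime x T 1)).2
  have h6 : 1 / w (localTime x T 1) ≤ 1 := by
    rw [div_le_one (hp _)]; exact hw0.trans (hw (Nat.zero_le _))
  push_cast at h2 h3 h4
  linarith

/-- A bootstrap in time: the envelope before n bounds the compensators up to n, which involve
earlier times only, and balance converts them into bounds on W of the local times at n. -/
theorem crudeRight_step (hw' : IsLogPowerWeight α w) (h0 : 0 ≤ α) (hw0 : 1 ≤ w 0)
    (hth : CrudeThreshold w α a L) (hK : 2 ≤ K) (hTn : T < n)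
    (hbal : IsBalanced w K x T n) (hi1 : CrudeInit w a L K x T)
    (hi2 : CrudeInit w a L K (fun i => -x i) T)
    (hr1 : ∀ i, T ≤ i → i < n → CrudeRight w a K x i)
    (hr2 : ∀ i, T ≤ i → i < n → CrudeRight w a K (fun i => -x i) i) :
    CrudeRight w a K x n := by
  have hp := hw'.pos
  have hw := hw'.mono
  obtain ⟨m, rfl⟩ : ∃ m, n = m + 1 := ⟨n - 1, by omega⟩
  have hTm : T ≤ m := by omega
  have hTn' : T ≤ m + 1 := by omega
  have hKr : (2 : ℤ) ≤ K := by exact_mod_cast hK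
  have hLpos : 16 ≤ L := by linarith [hth.large, Real.exp_pos 100]
  have habs : ∀ k : ℤ, -(K : ℤ) ≤ k → k ≤ K → |k| ≤ (K : ℤ) := fun k h1 h2 => abs_le.2 ⟨h1, h2⟩
  have hlt : ∀ i, T ≤ i → ∀ k : ℤ, -(K : ℤ) ≤ k → k ≤ K → L ≤ localTime x i k :=
    fun i hi k h1 h2 => hi1.le_localTime (habs k h1 h2) hi
  have hdecr : ∀ k : ℤ, 1 ≤ k → k + 1 ≤ K →
      localTime x (m + 1) (k + 1) ≤ localTime x (m + 1) k := by
    intro k hk1 hk2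
    have h1 := (hr1 m hTm (by omega)).decay k hk1 hk2
    have h2 := hth.add_one_le _ (hlt m hTm k (by omega) (by omega))
    have h3 : localTime x m (k + 1) + 1 ≤ localTime x m k := by
      have : (localTime x m (k + 1) : ℝ) + 1 ≤ localTime x m k := by linarith
      exact_mod_cast this
    have h4 := localTime_succ_le x m (k + 1)
    have h5 := localTime_mono x k (Nat.le_succ m)
    simp only [Nat.succ_eq_add_one] at h5
    omega
  have hAW : ∀ k : ℤ, 1 ≤ k → k ≤ K →
      jumpComp w x T (m + 1) (k + 1) ≤ 1 / 1024 * bigW w (localTime x (m + 1) k) := by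
    intro k hk1 hk2
    rcases hk2.eq_or_lt with rfl | hk2
    · rw [jumpComp_eq_zero]
      · have := bigW_nonneg hp hw (Nat.cast_nonneg (localTime x (m + 1) K) (α := ℝ))
        positivity
      · intro i hi h
        have := hbal.abs_le i hi
        rw [h, abs_le] at this
        omega
    · refine (jumpComp_le_bigW hp hw hth hTn' (hi1.large _ (habs _ (by omega) (by omega)))
        fun i h1 h2 => (hr1 i h1 h2).decay k hk1 (by omega)).trans ?_
      have := bigW_nat_mono hp hw (hdecr k hk1 (by omega))
      gcongr
  have hAW' : ∀ k : ℤ, 1 ≤ k → k + 1 ≤ K →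
      jumpComp w x T (m + 1) (k + 1) ≤ 1 / 1024 * bigW w (localTime x (m + 1) (k + 1)) := by
    intro k hk1 hk2
    exact jumpComp_le_bigW hp hw hth hTn' (hi1.large _ (habs _ (by omega) (by omega)))
        fun i h1 h2 => (hr1 i h1 h2).decay k hk1 hk2
  have happ : ∀ k : ℤ, -(K : ℤ) ≤ k → k ≤ K → _ := fun k h1 h2 =>
    abs_le.1 (hbal.approx (m + 1) hTn' le_rfl k (habs k h1 h2))
  have hWpos : ∀ k, 0 ≤ bigW w (localTime x (m + 1) k) := fun k =>
    bigW_nonneg hp hw (Nat.cast_nonneg _)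
  have hWT : ∀ k, bigW w (localTime x T k) ≤ bigW w (localTime x (m + 1) k) := fun k =>
    bigW_nat_mono hp hw (localTime_mono x k hTn')
  have hAnn : ∀ k, 0 ≤ jumpComp w x T (m + 1) k := jumpComp_nonneg hp x T (m + 1)
  have hlt_of : ∀ {c z : ℕ} {ρ : ℝ}, bigW w c ≤ ρ →
      ρ < bigW w (z * Real.exp (-Real.log z ^ a)) →
      (c : ℝ) ≤ z * Real.exp (-Real.log z ^ a) := by
    intro c z ρ h1 h2
    rw [← bigW_le_iff hp hw (Nat.cast_nonneg c) (by positivity)]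
    linarith
  have hcm := (hr1 m hTm (by omega)).center
  have hcm2 := (hr2 m hTm (by omega)).center
  simp only [localTime_neg, neg_zero] at hcm2
  have hz0 := localTime_succ_le x m 0
  have hz1 := localTime_mono x 1 (Nat.le_succ m)
  have hzm1 := localTime_mono x (-1) (Nat.le_succ m)
  simp only [Nat.succ_eq_add_one] at hz1 hzm1
  have hL1 := hlt m hTm 1 (by omega) (by omega)
  have hLm1 := hlt m hTm (-1) (by omega) (by omega)
  have hL1' : 16 ≤ localTime x m 1 := by exact_mod_cast hLpos.trans hL1
  have hLm1' : 16 ≤ localTime x m (-1) := by exact_mod_cast hLpos.trans hLm1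
  -- W(Z(0)) receives the compensators at 1 and -1, W(Z(2)) those at 1 and 3. The one at -1 is at
  -- least about W(Z(-1)) / 64 ≥ W(Z(0)) / 128 and the one at 3 at most W(Z(2)) / 1024, so site 2
  -- lags by a definite proportion; the initial gap 7 covers the additive errors.
  have hsecond : bigW w (localTime x (m + 1) 2) ≤
      (1 - 1 / 256) * bigW w (localTime x (m + 1) 0) := by
    have b0 := happ 0 (by omega) (by omega)
    have b2 := happ 2 (by omega) (by omega)
    norm_num at b0 b2
    have c3 := hAW 2 (by omega) (by omega)
    norm_num at c3
    have hl := le_jumpComp_one (x := fun i => -x i) hp hw hw0 hth hTn'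
      (hi2.large 1 (habs 1 (by omega) (by omega))) (by
        intro i h1 h2
        refine ⟨(hr2 i h1 h2).center, ?_⟩
        have d1 := (hr2 i h1 h2).decay 1 le_rfl (by omega)
        norm_num at d1
        have d2 := hth.add_one_le (localTime (fun i => -x i) i 1)
          (hi2.le_localTime (habs 1 (by omega) (by omega)) h1)
        exact_mod_cast (by linarith : (localTime (fun i => -x i) i 2 : ℝ) ≤
          localTime (fun i => -x i) i 1))
    simp only [localTime_neg, jumpComp_neg] at hl
    have e1 : bigW w (localTime x T (-1)) ≤ bigW w (localTime x T 0) := by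
      have := hi2.center
      simp only [localTime_neg, neg_zero] at this
      exact bigW_nat_mono hp hw this
    have e2 : 1 / 2 * bigW w (localTime x (m + 1) 0) ≤ bigW w (localTime x (m + 1) (-1)) := by
      refine (hth.half_le _ (hlt _ hTn' 0 (by omega) (by omega))).trans ?_
      refine (bigW_le_iff hp hw (by positivity) (Nat.cast_nonneg _)).2 ?_
      rw [div_le_iff₀ (by norm_num)]
      have : localTime x (m + 1) 0 ≤ localTime x (m + 1) (-1) * 9 := by omega
      exact_mod_cast this
    have e3 := hi1.second
    have e4 := bigW_nonneg hp hw (Nat.cast_nonneg (localTime x T 0) (α := ℝ))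
    linarith [hWpos 2, hWpos 0]
  refine ⟨?_, ?_, hsecond⟩
  · intro k hk1 hk2
    rcases hk1.eq_or_lt with rfl | hk1
    -- In one step Z(0) gains at most 1, so Z(0) ≤ 8 Z(1) + 1 ≤ 9 Z(1) holds before the central
    -- bound is restored.
    · refine hlt_of (hsecond.trans ?_) (hth.mul_lt _ (hlt _ hTn' 1 (by omega) (by omega)))
      gcongr
      refine (bigW_le_iff hp hw (by positivity) (by positivity)).2 ?_
      have : localTime x (m + 1) 0 ≤ 9 * localTime x (m + 1) 1 := by omega
      exact_mod_cast this
    -- For k ≥ 2, W(Z(k+1)) is at most its initial value plus 3 plus the compensators at k and k +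
    -- 2, that is (1/4 + 2/1024) W(Z(k)), which is below half.
    · refine hlt_of ?_ (hth.half_lt _ (hlt _ hTn' k (by omega) (by omega)))
      have b := happ (k + 1) (by omega) (by omega)
      rw [add_sub_cancel_right] at b
      have c1 := hAW (k + 1) (by omega) (by omega)
      have c2 := hAW' (k - 1) (by omega) (by omega)
      rw [sub_add_cancel] at c2
      have c3 := hi1.start k (by omega) hk2
      have c4 := bigW_nat_mono hp hw (hdecr k (by omega) hk2)
      linarith [hWT k, hWpos k]
  -- If Z(0) > 8 Z(1), then Z(0) ≤ Z(-1) + Z(1) + 1 forces Z(1) ≤ Z(-1) / 4. But the sites 1 and -1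
  -- share the compensator at 0, so W(Z(-1)) - W(Z(1)) is at most 3 + 3 + 1 plus the compensator at
  -- -2, which contradicts `CrudeThreshold.gap`.
  · by_contra hcon
    push Not at hcon
    have hnn := hbal.step.localTime_le 0
    norm_num at hnn
    have b1 := happ 1 (by omega) (by omega)
    have b2 := happ (-1) (by omega) (by omega)
    norm_num at b1 b2
    have c1 := hAnn 2
    have c2 := jumpComp_le_slowFactor (x := fun i => -x i) hp hth h0 (k := 1) hTn'
      (hi2.large _ (habs _ (by omega) (by omega))) (hi2.large _ (habs _ (by omega) (by omega)))
      fun i h1 h2 => (hr2 i h1 h2).decay 1 le_rfl (by omega)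
    norm_num [localTime_neg, jumpComp_neg] at c2
    have c3 := abs_le.1 hi1.sym
    have c4 := hth.gap _ (hlt _ hTn' (-1) (by omega) (by omega))
    have c5 : bigW w (localTime x (m + 1) 1) ≤ bigW w (localTime x (m + 1) (-1) / 4) := by
      refine (bigW_le_iff hp hw (by positivity) (by positivity)).2 ?_
      rw [le_div_iff₀ (by norm_num)]
      have : localTime x (m + 1) 1 * 4 ≤ localTime x (m + 1) (-1) := by omega
      exact_mod_cast this
    linarith

/-- Both sides of the origin are propagated together, since the step for one uses the other; the
reflection of the path exchanges them. -/
theorem crude_of_balanced (hw' : IsLogPowerWeight α w) (h0 : 0 ≤ α) (hw0 : 1 ≤ w 0)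
    (hth : CrudeThreshold w α a L) (hK : 2 ≤ K)
    (hbal : IsBalanced w K x T n) (hi1 : CrudeInit w a L K x T)
    (hi2 : CrudeInit w a L K (fun i => -x i) T) :
    ∀ i, T ≤ i → i ≤ n → CrudeRight w a K x i ∧ CrudeRight w a K (fun i => -x i) i := by
  intro i
  induction i using Nat.strong_induction_on with
  | _ i ih =>
    intro hTi hin
    rcases hTi.eq_or_lt with rfl | hTi
    · exact ⟨hi1.right, hi2.right⟩
    · have hb := hbal.mono hin
      have r1 := fun j h1 h2 => (ih j h2 h1 (by omega)).1
      have r2 := fun j h1 h2 => (ih j h2 h1 (by omega)).2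
      refine ⟨crudeRight_step hw' h0 hw0 hth hK hTi hb hi1 hi2 r1 r2,
        crudeRight_step hw' h0 hw0 hth hK hTi hb.neg hi2 (by simpa using hi1) r2
          (by simpa using r1)⟩

end Crude

end

end VRRW

/-! ### Exponents and thresholds for the fine envelope -/

namespace VRRW

noncomputable section

section Fine

/-- Exponent of the lower envelope at the site `k`. -/
def lowerExp (α τ : ℝ) (k : ℤ) : ℝ := (k - 1) * (1 - α) + k * τ

/-- Exponent of the upper envelope at the site `k`. -/
def upperExp (α τ : ℝ) (k : ℤ) : ℝ := (k - 1) * (1 - α) - k * τ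

/-- Exponent of the starting configuration at the site `k`. -/
def midExp (α τ : ℝ) (k : ℤ) : ℝ := (k - 1) * (1 - α) + τ / 2

/-- The exponents `α` and `τ` suit the localization on `[-K, K]`. -/
structure Exponents (α τ : ℝ) (K : ℕ) : Prop where
  two_le : 2 ≤ K
  pos : 0 < α
  lt_one : α < 1
  tau_pos : 0 < τ
  small : 2 * K * τ < 1 - α
  lower : lowerExp α τ K < 1
  upper : α < upperExp α τ K

/-- The quantitative largeness conditions used for the fine envelope. -/
structure FineThreshold (w : ℕ → ℝ) (α τ : ℝ) (K : ℕ) (L : ℝ) : Prop where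
  one_le : 1 ≤ L
  lower_step : ∀ l, L ≤ l → ∀ k : ℤ, 1 ≤ k → k + 1 ≤ K →
    bigW w (Real.exp (l - l ^ lowerExp α τ (k + 1))) + 3 ≤
      Real.exp (l ^ α - 2 * l ^ lowerExp α τ k)
  lower_large : ∀ l, L ≤ l → ∀ k : ℤ, 1 ≤ k → k ≤ K → Real.log 24 ≤ l ^ lowerExp α τ k
  lower_add : ∀ l, L ≤ l → ∀ k : ℤ, 1 ≤ k → k + 1 ≤ K →
    Real.log 4 + l ^ lowerExp α τ k + l ^ midExp α τ (k + 1) ≤ l ^ lowerExp α τ (k + 1)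
  lower_le_upper : ∀ l, L ≤ l → ∀ k : ℤ, 2 ≤ k → k ≤ K →
    2 * l ^ lowerExp α τ (k - 1) ≤ l ^ upperExp α τ k
  upper_two : ∀ l, L ≤ l →
    (1 - 1 / 256) * bigW w (Real.exp l) < bigW w (Real.exp (l - l ^ upperExp α τ 2))
  upper_step : ∀ l, L ≤ l → ∀ k : ℤ, 2 ≤ k → k + 1 ≤ K →
    16 * (l * Real.exp (l ^ α - 1 / 2 * l ^ upperExp α τ k) + 1) ≤
      bigW w (Real.exp (l - l ^ upperExp α τ (k + 1)))
  mono : ∀ m l, L ≤ m → m ≤ l → ∀ k : ℤ, 2 ≤ k → k + 1 ≤ K →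
    m ^ α - 1 / 2 * m ^ upperExp α τ k ≤ l ^ α - 1 / 2 * l ^ upperExp α τ k
  upper_last : ∀ l, L ≤ l → 4 * Real.exp (l ^ α - 1 / 2 * l ^ upperExp α τ K) ≤ (l ^ 2)⁻¹
  le_weight : ∀ l, L ≤ l → ∀ k : ℤ, 1 ≤ k → k ≤ K →
    Real.exp (l - l ^ lowerExp α τ k - l ^ α) ≤
      4 * weightFun w (Real.exp (l - l ^ lowerExp α τ k))
  weight_le : ∀ z : ℕ, L ≤ Real.log z → w (3 * z) ≤ 6 * z / slowFactor α z

variable {α τ : ℝ} {K : ℕ} {w : ℕ → ℝ}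

namespace Exponents

theorem k_le {k : ℤ} (hk : k ≤ K) : (k : ℝ) ≤ K := by exact_mod_cast hk

theorem tau_mul_le (h : Exponents α τ K) {k : ℤ} (hk : k ≤ K) : k * τ ≤ K * τ :=
  mul_le_mul_of_nonneg_right (k_le hk) h.tau_pos.le

theorem lowerExp_pos (h : Exponents α τ K) {k : ℤ} (hk : 1 ≤ k) : 0 < lowerExp α τ k := by
  have h1 : (1 : ℝ) ≤ k := by exact_mod_cast hk
  have h2 := h.tau_pos
  have h3 : 0 < 1 - α := by linarith [h.lt_one]
  have h4 : 0 ≤ ((k : ℝ) - 1) * (1 - α) := mul_nonneg (by linarith) h3.le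
  have h5 : 0 < (k : ℝ) * τ := by positivity
  unfold lowerExp; linarith

theorem lowerExp_lt_one (h : Exponents α τ K) {k : ℤ} (hk : k ≤ K) : lowerExp α τ k < 1 := by
  refine lt_of_le_of_lt ?_ h.lower
  have h1 := k_le hk
  have h2 := h.tau_pos
  have h3 : 0 < 1 - α := by linarith [h.lt_one]
  unfold lowerExp
  push_cast
  gcongr

theorem upperExp_pos (h : Exponents α τ K) {k : ℤ} (hk : 2 ≤ k) (hkK : k ≤ K) :
    0 < upperExp α τ k := by
  have h1 : (2 : ℝ) ≤ k := by exact_mod_cast hk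
  have h2 := h.tau_mul_le hkK
  have h3 := h.small
  have h6 : 0 < 1 - α := by linarith [h.lt_one]
  have h4 : 1 * (1 - α) ≤ ((k : ℝ) - 1) * (1 - α) := by gcongr; linarith
  unfold upperExp; linarith

theorem upperExp_le_lowerExp (h : Exponents α τ K) {k : ℤ} (hk : 0 ≤ k) :
    upperExp α τ k ≤ lowerExp α τ k := by
  have h1 : (0 : ℝ) ≤ k := by exact_mod_cast hk
  have := h.tau_pos
  have : 0 ≤ (k : ℝ) * τ := by positivity
  unfold upperExp lowerExp; linarith

/-- That `lowerExp` at k + 1 is below 1 means k(1-α) + (k+1)τ < 1; subtract 1-α. -/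
theorem upperExp_lt (h : Exponents α τ K) {k : ℤ} (hk : 2 ≤ k) (hkK : k + 1 ≤ K) :
    upperExp α τ k < α := by
  have h1 := h.lowerExp_lt_one hkK
  have h2 := h.tau_pos
  have h3 : (2 : ℝ) ≤ k := by exact_mod_cast hk
  have h4 : 0 < (k : ℝ) * τ := by positivity
  unfold lowerExp at h1
  unfold upperExp
  push_cast at h1
  linarith

/-- From one site to the next `lowerExp` grows by 1-α+τ, more than the critical 1-α (for
`eventually_shift_add_le`), and `upperExp` by 1-α-τ, less than it (for `eventually_le_shift`). The
condition 2Kτ < 1-α keeps `lowerExp` at k-1 below `upperExp` at k. -/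
theorem eventually_fineThreshold (h : Exponents α τ K) (hw : IsLogPowerWeight α w) :
    ∀ᶠ L : ℝ in atTop, FineThreshold w α τ K L := by
  have h0 := h.pos
  have h1 := h.lt_one
  have hτ := h.tau_pos
  have hS := hw.scaleBounds h0.le
  have hK2 : (2 : ℤ) ≤ K := by exact_mod_cast h.two_le
  have hall : ∀ {p : ℤ → ℝ → Prop} (A B : ℤ), (∀ k, A ≤ k → k ≤ B → ∀ᶠ l in atTop, p k l) →
      ∀ᶠ L : ℝ in atTop, ∀ l, L ≤ l → ∀ k, A ≤ k → k ≤ B → p k l := by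
    intro p A B hp
    rw [eventually_forall_ge_atTop]
    have := (eventually_all_finite (Set.finite_Icc A B) (p := p) (l := atTop)).2
      fun k hk => hp k hk.1 hk.2
    filter_upwards [this] with l hl k h1 h2 using hl k ⟨h1, h2⟩
  have e1 := hall (p := fun k l => bigW w (Real.exp (l - l ^ lowerExp α τ (k + 1))) + 3 ≤
      Real.exp (l ^ α - 2 * l ^ lowerExp α τ k)) 1 (K - 1) (by
    intro k hk1 hk2
    refine hS.eventually_shift_add_le h0 h1 (h.lowerExp_pos hk1).le ?_
      (h.lowerExp_lt_one (by omega)) 2 3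
    unfold lowerExp; push_cast; linarith)
  have e2 := hall (p := fun k l => Real.log 24 ≤ l ^ lowerExp α τ k) 1 K
    fun k hk1 hk2 => eventually_const_le_rpow (h.lowerExp_pos hk1) _
  have e3 := hall (p := fun k l => Real.log 4 + l ^ lowerExp α τ k + l ^ midExp α τ (k + 1) ≤
      l ^ lowerExp α τ (k + 1)) 1 (K - 1) (by
    intro k hk1 hk2
    have hk : (1 : ℝ) ≤ k := by exact_mod_cast hk1
    have hkt : τ ≤ k * τ := by nlinarith
    filter_upwards [eventually_const_le_rpow (h.lowerExp_pos (by omega : 1 ≤ k + 1))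
      (3 * Real.log 4), eventually_mul_rpow_le (p := lowerExp α τ k) (q := lowerExp α τ (k + 1))
      (by unfold lowerExp; push_cast; linarith) 3,
      eventually_mul_rpow_le (p := midExp α τ (k + 1)) (q := lowerExp α τ (k + 1))
      (by unfold lowerExp midExp; push_cast; linarith) 3] with l q1 q2 q3
    linarith)
  have e4 := hall (p := fun k l => 2 * l ^ lowerExp α τ (k - 1) ≤ l ^ upperExp α τ k) 2 K (by
    intro k hk1 hk2
    apply eventually_mul_rpow_le
    have q1 := h.tau_mul_le hk2
    have q2 := h.small
    unfold lowerExp upperExp; push_cast; linarith)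
  have e5 : ∀ᶠ L : ℝ in atTop, ∀ l, L ≤ l →
      (1 - 1 / 256) * bigW w (Real.exp l) < bigW w (Real.exp (l - l ^ upperExp α τ 2)) := by
    rw [eventually_forall_ge_atTop]
    filter_upwards [hS.eventually_mul_shift_lt h0 h1 (by norm_num : (1 - 1 / 256 : ℝ) < 1) le_rfl
      (h.upperExp_pos le_rfl hK2) (by unfold upperExp; push_cast; linarith)] with l hl
    rwa [add_zero] at hl
  have e6 := hall (p := fun k l => 16 * (l * Real.exp (l ^ α - 1 / 2 * l ^ upperExp α τ k) + 1) ≤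
      bigW w (Real.exp (l - l ^ upperExp α τ (k + 1)))) 2 (K - 1) (by
    intro k hk1 hk2
    refine hS.eventually_le_shift h0 h1 (h.upperExp_pos hk1 (by omega)) (by norm_num) ?_ ?_ 16
    · unfold upperExp; push_cast; linarith
    · exact (h.upperExp_le_lowerExp (by omega)).trans_lt (h.lowerExp_lt_one (by omega)))
  have e7 := hall (p := fun k m => ∀ l, m ≤ l →
      m ^ α - 1 / 2 * m ^ upperExp α τ k ≤ l ^ α - 1 / 2 * l ^ upperExp α τ k) 2 (K - 1) (by
    intro k hk1 hk2
    obtain ⟨Λ, -, hΛ⟩ := exists_rpow_sub_mono h0 h1 (h.upperExp_pos hk1 (by omega))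
      (h.upperExp_lt hk1 (by omega))
    filter_upwards [eventually_ge_atTop Λ] with m hm l hl using hΛ m l hm hl)
  have e8 : ∀ᶠ L : ℝ in atTop, ∀ l, L ≤ l →
      4 * Real.exp (l ^ α - 1 / 2 * l ^ upperExp α τ K) ≤ (l ^ 2)⁻¹ := by
    rw [eventually_forall_ge_atTop]
    have hq := h.upperExp_pos hK2 le_rfl
    filter_upwards [eventually_mul_rpow_le h.upper 8, eventually_mul_log_le_rpow hq 16,
      eventually_const_le_rpow hq (16 * Real.log 4), eventually_ge_atTop 1] with l q1 q2 q3 q4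
    have hl : 0 < l := by linarith
    rw [← Real.exp_log (by positivity : 0 < (l ^ 2)⁻¹), Real.log_inv, Real.log_pow]
    nth_rewrite 1 [← Real.exp_log (by norm_num : (0 : ℝ) < 4)]
    rw [← Real.exp_add]
    apply Real.exp_le_exp.2
    push_cast
    have : 0 ≤ l ^ upperExp α τ K := by positivity
    linarith
  have e9 := hall (p := fun k l => Real.exp (l - l ^ lowerExp α τ k - l ^ α) ≤
      4 * weightFun w (Real.exp (l - l ^ lowerExp α τ k))) 1 K (by
    intro k hk1 hk2
    obtain ⟨l0, hl0, hb⟩ := hw.exp_bounds h0.le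
    filter_upwards [eventually_mul_rpow_le (h.lowerExp_lt_one hk2) 2, eventually_ge_atTop (2 * l0)]
      with l q1 q2
    rw [Real.rpow_one] at q1
    have hl : 0 < l := by linarith
    refine le_trans (Real.exp_le_exp.2 ?_) (hb (l - l ^ lowerExp α τ k) (by linarith)).1
    have : 0 ≤ l ^ lowerExp α τ k := by positivity
    have : (l - l ^ lowerExp α τ k) ^ α ≤ l ^ α := by
      apply Real.rpow_le_rpow <;> linarith
    linarith)
  have e10 : ∀ᶠ L : ℝ in atTop, ∀ z : ℕ, L ≤ Real.log z → w (3 * z) ≤ 6 * z / slowFactor α z := by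
    obtain ⟨L0, hL0⟩ := hw.eventually_nat_bounds.exists
    filter_upwards [eventually_ge_atTop (max 1 (Real.log (max L0 1)))] with L hL z hz
    have hz1 : 1 ≤ Real.log (z : ℝ) := (le_max_left _ _).trans (hL.trans hz)
    have hz0 : (0 : ℝ) < z := by
      rcases Nat.eq_zero_or_pos z with rfl | hz
      · simp at hz1; linarith
      · exact_mod_cast hz
    have hz2 : max L0 1 ≤ z := by
      rw [← Real.log_le_log_iff (by positivity) hz0]
      exact (le_max_right _ _).trans (hL.trans hz)
    have hzL := (le_max_left _ _).trans hz2
    have hz3 := (le_max_right _ _).trans hz2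
    have b := (hL0 (3 * z) (by push_cast; linarith)).2
    have hs := slowFactor_pos α z
    refine b.trans ?_
    have : slowFactor α z ≤ slowFactor α ((3 * z : ℕ) : ℝ) :=
      slowFactor_mono h0.le hz3 (by push_cast; linarith)
    gcongr ?_ / ?_
    push_cast; linarith
  filter_upwards [e1, e2, e3, e4, e5, e6, e7, e8, e9, e10, eventually_ge_atTop 1]
    with L e1 e2 e3 e4 e5 e6 e7 e8 e9 e10 e11
  exact ⟨e11, fun l hl k h1 h2 => e1 l hl k h1 (by omega), e2,
    fun l hl k h1 h2 => e3 l hl k h1 (by omega), e4, e5,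
    fun l hl k h1 h2 => e6 l hl k h1 (by omega),
    fun m l hm hml k h1 h2 => e7 m hm k h1 (by omega) l hml, e8, e9, e10⟩

end Exponents

end Fine

end

end VRRW

/-! ### The fine envelope -/

namespace VRRW

noncomputable section

section Envelope

variable {w : ℕ → ℝ} {α τ L : ℝ} {K : ℕ} {x : ℕ → ℤ} {T n : ℕ}

/-- What the fine estimates to the right of the origin use of the crude ones. -/
structure CoarseEnvelope (w : ℕ → ℝ) (L : ℝ) (K : ℕ) (x : ℕ → ℤ) (T n : ℕ) : Prop where
  one_le : ∀ k : ℤ, 1 ≤ k → k ≤ K → 3 ≤ visitsBefore x T k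
  log_large : L ≤ Real.log (localTime x T 0)
  init_le : ∀ k : ℤ, 1 ≤ k → k ≤ K → localTime x T k ≤ localTime x T 0
  le_center : ∀ i, T ≤ i → i ≤ n → ∀ k : ℤ, 0 ≤ k → k ≤ K + 1 →
    localTime x i k ≤ 3 * localTime x i 0
  center_le : ∀ i, T ≤ i → i ≤ n → localTime x i 0 ≤ 8 * localTime x i 1
  second : ∀ i, T ≤ i → i ≤ n →
    bigW w (localTime x i 2) ≤ (1 - 1 / 256) * bigW w (localTime x i 0)
  jump_le : ∀ i, T ≤ i → i ≤ n → ∀ k : ℤ, 1 ≤ k → k ≤ K →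
    jumpComp w x T i (k + 1) ≤ 1 / 1024 * bigW w (localTime x i k)

/-- The fine conditions on the configuration at time `T`, on the right of the origin. -/
structure FineInit (w : ℕ → ℝ) (α τ : ℝ) (K : ℕ) (x : ℕ → ℤ) (T : ℕ) : Prop where
  lower : ∀ k : ℤ, 2 ≤ k → k ≤ K →
    Real.exp (Real.log (localTime x T 0) - Real.log (localTime x T 0) ^ midExp α τ k) ≤
      localTime x T k
  upper : ∀ k : ℤ, 3 ≤ k → k ≤ K → 4 * bigW w (localTime x T k) ≤
    bigW w (Real.exp (Real.log (localTime x T 0) - Real.log (localTime x T 0) ^ upperExp α τ k))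

theorem sub_rpow_mono {p m l : ℝ} (hp : p < 1) (hm : 1 ≤ m) (hml : m ≤ l) :
    m - m ^ p ≤ l - l ^ p := by
  have h1 := rpow_sub_rpow_le hp (by linarith : 0 ≤ m) hml (by linarith)
  have h2 : l ^ (p - 1) ≤ 1 := Real.rpow_le_one_of_one_le_of_nonpos (by linarith) (by linarith)
  have h3 : l ^ (p - 1) * (l - m) ≤ 1 * (l - m) := by gcongr
  linarith

theorem CoarseEnvelope.log_mono (hL : 1 ≤ L) (hc : CoarseEnvelope w L K x T n) {i j : ℕ}
    (hi : T ≤ i) (hij : i ≤ j) :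
    0 < (localTime x i 0 : ℝ) ∧ L ≤ Real.log (localTime x i 0) ∧
      Real.log (localTime x i 0) ≤ Real.log (localTime x j 0) := by
  have h0 : 0 < localTime x T 0 := by
    rcases Nat.eq_zero_or_pos (localTime x T 0) with h | h
    · have := hc.log_large
      rw [h] at this
      simp at this
      linarith
    · exact h
  have h1 := localTime_mono x 0 hi
  have h2 := localTime_mono x 0 hij
  simp only at h1 h2
  have h3 : (0 : ℝ) < localTime x T 0 := by exact_mod_cast h0
  have h4 : (localTime x T 0 : ℝ) ≤ localTime x i 0 := by exact_mod_cast h1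
  refine ⟨h3.trans_le h4, hc.log_large.trans (Real.log_le_log h3 h4),
    Real.log_le_log (h3.trans_le h4) (by exact_mod_cast h2)⟩

theorem le_jumpComp (hp : ∀ k, 0 < w k) (hw : Monotone w) {k : ℤ} {B : ℕ} (hT : T ≤ n)
    (h : ∀ i, T ≤ i → i < n → localTime x i (k - 1) ≤ B ∧ localTime x i (k + 1) ≤ B) :
    ((visitsBefore x n k : ℝ) - visitsBefore x T k) * (1 / (2 * w B)) ≤ jumpComp w x T n k := by
  have h1 := sum_visits x k (fun _ => 1 / (2 * w B)) hT
  have h2 := visitsBefore_mono x k hT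
  simp only at h2
  simp only [Finset.sum_const, Nat.card_Ico, nsmul_eq_mul, Nat.cast_sub h2] at h1
  rw [← h1]
  unfold jumpComp
  apply Finset.sum_le_sum
  intro i hi
  rw [Finset.mem_Ico] at hi
  split_ifs
  · obtain ⟨b1, b2⟩ := h i hi.1 hi.2
    apply one_div_le_one_div_of_le (by linarith [hp (localTime x i (k - 1)), hp (localTime x i (k + 1))])
    linarith [hw b1, hw b2]
  · exact le_rfl

/-- Induction outward. If k has been visited often since T, each visit adds at least 1 / (2 w(3
Z(0))) to the compensator at k, which feeds W(Z(k+1)). Otherwise log Z(0) has changed little since T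
and the initial configuration still suffices. -/
theorem lower_envelope (hw' : IsLogPowerWeight α w) (he : Exponents α τ K)
    (hth : FineThreshold w α τ K L) (hbal : IsBalanced w K x T n)
    (hc : CoarseEnvelope w L K x T n) (hi : FineInit w α τ K x T) {i : ℕ} (hTi : T ≤ i)
    (hin : i ≤ n) {k : ℤ} (hk1 : 1 ≤ k) (hkK : k ≤ K) :
    Real.exp (Real.log (localTime x i 0) - Real.log (localTime x i 0) ^ lowerExp α τ k) ≤
      localTime x i k := by
  have hp := hw'.pos
  have hw := hw'.mono
  obtain ⟨hZ, hl, -⟩ := hc.log_mono hth.one_le hTi le_rfl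
  obtain ⟨hZT, hlT, hlTi⟩ := hc.log_mono hth.one_le le_rfl hTi
  induction k, hk1 using Int.leInduction with
  | base =>
    have h1 := hth.lower_large _ hl 1 le_rfl hkK
    have h2 : (localTime x i 0 : ℝ) ≤ 8 * localTime x i 1 := by
      exact_mod_cast hc.center_le i hTi hin
    rw [Real.exp_sub, Real.exp_log hZ, div_le_iff₀ (Real.exp_pos _)]
    have h3 := Real.exp_le_exp.2 h1
    rw [Real.exp_log (by norm_num)] at h3
    nlinarith [Nat.cast_nonneg (α := ℝ) (localTime x i 1)]
  | succ k hk ih =>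
    have ih := ih (by omega)
    set l := Real.log (localTime x i 0) with hldef
    have habs : |k + 1| ≤ (K : ℤ) := abs_le.2 ⟨by omega, by omega⟩
    have hv := hc.one_le k hk (by omega)
    have hvi := visitsBefore_mono x k hTi
    have hvl := visitsBefore_le_localTime x i k
    have hvl' := localTime_le_visitsBefore_add_one x i k
    have hvT := visitsBefore_le_localTime x T k
    simp only at hvi
    have hzk : (0 : ℝ) < localTime x i k := by exact_mod_cast (by omega : 0 < localTime x i k)
    rcases le_total (4 * localTime x T k) (localTime x i k) with h4 | h4
    · rw [← bigW_le_iff hp hw (Real.exp_pos _).le (Nat.cast_nonneg _)]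
      have hb := (abs_le.1 (hbal.approx i hTi hin (k + 1) habs)).1
      rw [add_sub_cancel_right] at hb
      have b1 := jumpComp_nonneg hp x T i (k + 1 + 1)
      have b2 := bigW_nonneg hp hw (Nat.cast_nonneg (localTime x T (k + 1)) (α := ℝ))
      have b3 := hth.lower_step _ hl k hk hkK
      have b4 := le_jumpComp hp hw (k := k) (x := x) (B := 3 * localTime x i 0) hTi (fun j hj hji => by
        have c1 := hc.le_center j hj (by omega) (k - 1) (by omega) (by omega)
        have c2 := hc.le_center j hj (by omega) (k + 1) (by omega) (by omega)
        have c3 := localTime_mono x 0 hji.le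
        simp only at c3
        omega)
      have b5 : (localTime x i k : ℝ) / 2 ≤ (visitsBefore x i k : ℝ) - visitsBefore x T k := by
        have d1 : (4 * visitsBefore x T k : ℝ) ≤ localTime x i k := by
          exact_mod_cast (by omega : 4 * visitsBefore x T k ≤ localTime x i k)
        have d2 : (localTime x i k : ℝ) ≤ visitsBefore x i k + 1 := by exact_mod_cast hvl'
        have d3 : (12 : ℝ) ≤ localTime x i k := by
          exact_mod_cast (by omega : 12 ≤ localTime x i k)
        linarith
      have b6 := hth.weight_le _ hl
      -- One copy of l^lowerExp comes from the bound on Z(k); the other absorbs 24 = 6 * 4, with 6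
      -- from the bound on w(3 Z(0)) and 4 from the two halvings.
      have b7 : Real.exp (l ^ α - 2 * l ^ lowerExp α τ k) ≤
          (localTime x i k : ℝ) / 2 * (1 / (2 * w (3 * localTime x i 0))) := by
        have d1 := hth.lower_large _ hl k hk (by omega)
        have d2 : Real.exp (l ^ α - 2 * l ^ lowerExp α τ k) =
            Real.exp (l - l ^ lowerExp α τ k) * (slowFactor α (localTime x i 0) /
              localTime x i 0) * Real.exp (-l ^ lowerExp α τ k) := by
          rw [slowFactor, ← hldef]
          have d3 : (localTime x i 0 : ℝ) = Real.exp l := (Real.exp_log hZ).symm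
          rw [d3, ← Real.exp_sub, ← Real.exp_add, ← Real.exp_add]
          congr 1
          ring
        have d3 : Real.exp (-l ^ lowerExp α τ k) ≤ 1 / 24 := by
          rw [Real.exp_neg, inv_le_comm₀ (Real.exp_pos _) (by norm_num)]
          have := Real.exp_le_exp.2 d1
          rw [Real.exp_log (by norm_num)] at this
          norm_num at this ⊢
          exact this
        have d4 : slowFactor α (localTime x i 0) / localTime x i 0 ≤
            6 * (1 / w (3 * localTime x i 0)) := by
          have hs := slowFactor_pos α (localTime x i 0)
          have hw3 := hp (3 * localTime x i 0)
          rw [le_div_iff₀ hs] at b6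
          rw [mul_one_div, div_le_div_iff₀ hZ hw3]
          linarith
        have hs := slowFactor_pos α (localTime x i 0)
        have hw3 := hp (3 * localTime x i 0)
        rw [d2]
        calc _ ≤ (localTime x i k : ℝ) * (6 * (1 / w (3 * localTime x i 0))) * (1 / 24) := by
              gcongr
          _ = _ := by field_simp; norm_num
      have b8 : (localTime x i k : ℝ) / 2 * (1 / (2 * w (3 * localTime x i 0))) ≤
          jumpComp w x T i k := by
        refine le_trans ?_ b4
        have := hp (3 * localTime x i 0)
        gcongr
      linarith
    · have h1 := hi.lower (k + 1) (by omega) hkK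
      have h2 := localTime_mono x (k + 1) hTi
      simp only at h2
      refine le_trans ?_ (h1.trans (by exact_mod_cast h2))
      apply Real.exp_le_exp.2
      set m := Real.log (localTime x T 0) with hm
      -- Here Z(k) is at most 4 times its value at T, hence 4 times the initial Z(0) = e^m, while
      -- the induction hypothesis bounds Z(k) below in terms of the current l.
      have h3 : l - l ^ lowerExp α τ k ≤ Real.log 4 + m := by
        rw [← Real.exp_le_exp, Real.exp_add, Real.exp_log (by norm_num), hm, Real.exp_log hZT]
        have c1 := hc.init_le k hk (by omega)
        refine ih.trans ?_
        exact_mod_cast h4.trans (by omega)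
      have h4 := hth.lower_add _ hl k hk hkK
      have hL1 := hth.one_le
      have h5 : m ^ midExp α τ (k + 1) ≤ l ^ midExp α τ (k + 1) := by
        apply Real.rpow_le_rpow (by linarith) hlTi
        unfold midExp
        have := he.tau_pos
        have := he.lt_one
        have : (1 : ℝ) ≤ k := by exact_mod_cast hk
        push_cast
        have : 0 ≤ (k : ℝ) * (1 - α) := mul_nonneg (by linarith) (by linarith)
        linarith
      linarith

/-- The lower envelope at k and the upper one at k + 1 make Z(k+1) / w(Z(k)) at most 4 exp(l^α +
l^lowerExp(k) - l^upperExp(k+1)); the first correction is at most half of the second. -/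
theorem one_div_weight_le (hw' : IsLogPowerWeight α w) (he : Exponents α τ K)
    (hth : FineThreshold w α τ K L) (hbal : IsBalanced w K x T n)
    (hc : CoarseEnvelope w L K x T n) (hi : FineInit w α τ K x T) {i : ℕ} (hTi : T ≤ i)
    (hin : i ≤ n) {k : ℤ} (hk1 : 1 ≤ k) (hkK : k + 1 ≤ K)
    (hup : (localTime x i (k + 1) : ℝ) ≤
      Real.exp (Real.log (localTime x i 0) - Real.log (localTime x i 0) ^ upperExp α τ (k + 1))) :
    1 / w (localTime x i k) ≤ 4 * Real.exp (Real.log (localTime x i 0) ^ α -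
      1 / 2 * Real.log (localTime x i 0) ^ upperExp α τ (k + 1)) *
      (1 / localTime x i (k + 1)) := by
  have hp := hw'.pos
  have hw := hw'.mono
  obtain ⟨hZ, hl, -⟩ := hc.log_mono hth.one_le hTi le_rfl
  have h1 := lower_envelope hw' he hth hbal hc hi hTi hin hk1 (by omega)
  set l := Real.log (localTime x i 0)
  have h2 := hth.le_weight _ hl k hk1 (by omega)
  have h3 := weightFun_monotoneOn hw (mem_Ici.2 (Real.exp_pos _).le)
    (mem_Ici.2 (Nat.cast_nonneg (localTime x i k))) h1
  rw [weightFun_natCast] at h3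
  have h4 := hth.lower_le_upper _ hl (k + 1) (by omega) hkK
  rw [add_sub_cancel_right] at h4
  have hpos : (0 : ℝ) < localTime x i (k + 1) := by
    have c1 := hc.one_le (k + 1) (by omega) hkK
    have c2 := visitsBefore_le_localTime x T (k + 1)
    have c3 := localTime_mono x (k + 1) hTi
    simp only at c3
    exact_mod_cast (by omega : 0 < localTime x i (k + 1))
  rw [mul_one_div, div_le_div_iff₀ (hp _) hpos, one_mul]
  calc (localTime x i (k + 1) : ℝ) ≤ Real.exp (l - l ^ upperExp α τ (k + 1)) := hup
    _ ≤ Real.exp (l ^ α - 1 / 2 * l ^ upperExp α τ (k + 1)) *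
        Real.exp (l - l ^ lowerExp α τ k - l ^ α) := by
        rw [← Real.exp_add]
        apply Real.exp_le_exp.2
        linarith
    _ ≤ Real.exp (l ^ α - 1 / 2 * l ^ upperExp α τ (k + 1)) * (4 * w (localTime x i k)) := by
        gcongr
        linarith
    _ = _ := by ring

theorem sum_one_div_succ_le {s t : ℕ} (hs : 1 ≤ s) (hst : s ≤ t) :
    ∑ j ∈ Finset.Ico s t, 1 / ((j + 1 : ℕ) : ℝ) ≤ Real.log t - Real.log s := by
  induction t, hst using Nat.le_induction with
  | base => simp
  | succ t ht ih =>
    rw [Finset.sum_Ico_succ_top ht]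
    have ht0 : (0 : ℝ) < t := by exact_mod_cast hs.trans ht
    have h1 := Real.log_le_sub_one_of_pos (x := (t : ℝ) / ((t + 1 : ℕ) : ℝ)) (by positivity)
    rw [Real.log_div ht0.ne' (by positivity)] at h1
    have h2 : (t : ℝ) / ((t + 1 : ℕ) : ℝ) - 1 = -(1 / ((t + 1 : ℕ) : ℝ)) := by
      push_cast; field_simp; simp
    linarith

/-- Induction outward, starting from `CoarseEnvelope.second`. Summing `one_div_weight_le` over the
visits gives a harmonic sum of size at most l, so the inner compensator fits under W at the next
exponent; the outer one is a small fraction of W of the local time being bounded and is absorbed. -/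
theorem upper_envelope (hw' : IsLogPowerWeight α w) (he : Exponents α τ K)
    (hth : FineThreshold w α τ K L) (hbal : IsBalanced w K x T n)
    (hc : CoarseEnvelope w L K x T n) (hi : FineInit w α τ K x T) {k : ℤ} (hk2 : 2 ≤ k)
    (hkK : k ≤ K) : ∀ i, T ≤ i → i ≤ n → (localTime x i k : ℝ) ≤
      Real.exp (Real.log (localTime x i 0) - Real.log (localTime x i 0) ^ upperExp α τ k) := by
  have hp := hw'.pos
  have hw := hw'.mono
  induction k, hk2 using Int.leInduction with
  | base =>
    intro i hTi hin
    obtain ⟨hZ, hl, -⟩ := hc.log_mono hth.one_le hTi le_rfl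
    rw [← bigW_le_iff hp hw (Nat.cast_nonneg _) (Real.exp_pos _).le]
    have h1 := hth.upper_two _ hl
    rw [Real.exp_log hZ] at h1
    exact (hc.second i hTi hin).trans h1.le
  | succ k hk ih =>
    intro i hTi hin
    have ih := ih (by omega)
    obtain ⟨hZ, hl, -⟩ := hc.log_mono hth.one_le hTi le_rfl
    obtain ⟨hZT, hlT, hlTi⟩ := hc.log_mono hth.one_le le_rfl hTi
    have hL1 := hth.one_le
    obtain ⟨q, rfl⟩ : ∃ q, k = q + 1 := ⟨k - 1, by ring⟩
    have habs : |q + 1 + 1| ≤ (K : ℤ) := abs_le.2 ⟨by omega, by omega⟩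
    set l := Real.log (localTime x i 0) with hldef
    set e := Real.exp (l ^ α - 1 / 2 * l ^ upperExp α τ (q + 1)) with hedef
    have hA : jumpComp w x T i (q + 1) ≤ 4 * e * l := by
      refine (jumpComp_le_sum hp hTi (g := fun j => 4 * e * (1 / j)) ?_).trans ?_
      · intro j hj hji _
        refine (one_div_weight_le hw' he hth hbal hc hi hj (by omega) (by omega) (by omega)
          (ih j hj (by omega))).trans ?_
        obtain ⟨-, hlj, hlji⟩ := hc.log_mono hth.one_le hj hji.le
        have := hth.mono _ _ hlj hlji (q + 1) hk hkK
        gcongr ?_ * _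
        gcongr 4 * ?_
        exact Real.exp_le_exp.2 this
      · rw [← Finset.mul_sum]
        have hv := hc.one_le (q + 1) (by omega) (by omega)
        have hvm := visitsBefore_mono x (q + 1) hTi
        simp only at hvm
        have c1 := sum_one_div_succ_le (by omega : 1 ≤ visitsBefore x T (q + 1)) hvm
        have c2 := Real.log_natCast_nonneg (visitsBefore x T (q + 1))
        have c3 : Real.log (visitsBefore x i (q + 1)) ≤ l := by
          rw [Real.log_le_iff_le_exp (by exact_mod_cast (by omega : 0 < visitsBefore x i (q + 1)))]
          have d1 := ih i hTi hin
          have d2 : (visitsBefore x i (q + 1) : ℝ) ≤ localTime x i (q + 1) := by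
            exact_mod_cast visitsBefore_le_localTime x i (q + 1)
          refine d2.trans (d1.trans (Real.exp_le_exp.2 ?_))
          have : 0 ≤ l ^ upperExp α τ (q + 1) := Real.rpow_nonneg (by linarith) _
          linarith
        gcongr
        linarith
    rw [← bigW_le_iff hp hw (Nat.cast_nonneg _) (Real.exp_pos _).le]
    have hb := (abs_le.1 (hbal.approx i hTi hin (q + 1 + 1) habs)).2
    rw [add_sub_cancel_right] at hb
    have b1 := hc.jump_le i hTi hin (q + 1 + 1) (by omega) hkK
    have b2 := hi.upper (q + 1 + 1) (by omega) hkK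
    have b3 := hth.upper_step _ hl (q + 1) hk hkK
    have b4 : bigW w (Real.exp (Real.log (localTime x T 0) -
        Real.log (localTime x T 0) ^ upperExp α τ (q + 1 + 1))) ≤
        bigW w (Real.exp (l - l ^ upperExp α τ (q + 1 + 1))) := by
      rw [bigW_le_iff hp hw (Real.exp_pos _).le (Real.exp_pos _).le]
      apply Real.exp_le_exp.2
      exact sub_rpow_mono ((he.upperExp_le_lowerExp (by omega)).trans_lt
        (he.lowerExp_lt_one hkK)) (by linarith) hlTi
    have b5 := bigW_nonneg hp hw (Nat.cast_nonneg (localTime x i (q + 1 + 1)) (α := ℝ))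
    have b6 : 16 * (l * e + 1) ≤
      bigW w (Real.exp (l - l ^ upperExp α τ (q + 1 + 1))) := b3
    linarith

/-- Since α < `upperExp` at K, the exponential factor is at most 1/l² with l ≥ log Z(K), so the
terms are at most 1 / (j log² j): the bound is uniform in n. Balance up to n controls the
compensator at n + 1, which is determined by the path up to n. -/
theorem jumpComp_last_le (hw' : IsLogPowerWeight α w) (he : Exponents α τ K)
    (hth : FineThreshold w α τ K L) (hbal : IsBalanced w K x T n)
    (hc : CoarseEnvelope w L K x T n) (hi : FineInit w α τ K x T) (hTn : T ≤ n) :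
    jumpComp w x T (n + 1) K ≤ 1 / Real.log (visitsBefore x T K) := by
  have hp := hw'.pos
  have hK2 : (2 : ℤ) ≤ K := by exact_mod_cast he.two_le
  obtain ⟨q, hq⟩ : ∃ q : ℤ, (K : ℤ) = q + 1 := ⟨K - 1, by ring⟩
  have hup := upper_envelope hw' he hth hbal hc hi hK2 le_rfl
  have hul := hth.upper_last
  have hv := hc.one_le K (by omega) le_rfl
  have huK : upperExp α τ ((K : ℕ) : ℤ) = upperExp α τ (q + 1) := by rw [hq]
  have hL1 := hth.one_le
  rw [hq] at hup hv ⊢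
  refine (jumpComp_le_sum hp (by omega) (g := fun j => 1 / (j * Real.log j ^ 2)) ?_).trans
    (sum_one_div_mul_log_sq_le hv)
  intro j hj hjn _
  have hjn : j ≤ n := by omega
  refine (one_div_weight_le hw' he hth hbal hc hi hj hjn (by omega) (by omega)
    (hup j hj hjn)).trans ?_
  obtain ⟨hZ, hl, -⟩ := hc.log_mono hth.one_le hj le_rfl
  have h1 := hul _ hl
  rw [huK] at h1
  have h2 := hup j hj hjn
  set l := Real.log (localTime x j 0)
  have hz : 3 ≤ localTime x j (q + 1) := by
    have c2 := visitsBefore_le_localTime x T (q + 1)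
    have c3 := localTime_mono x (q + 1) hj
    simp only at c3
    omega
  have hz' : (3 : ℝ) ≤ localTime x j (q + 1) := by exact_mod_cast hz
  have h3 : 0 < Real.log (localTime x j (q + 1)) := Real.log_pos (by linarith)
  have h4 : Real.log (localTime x j (q + 1)) ≤ l := by
    rw [Real.log_le_iff_le_exp (by linarith)]
    refine h2.trans (Real.exp_le_exp.2 ?_)
    have : 0 ≤ l ^ upperExp α τ (q + 1) := Real.rpow_nonneg (by linarith) _
    linarith
  calc _ ≤ (l ^ 2)⁻¹ * (1 / (localTime x j (q + 1) : ℝ)) := by gcongr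
    _ ≤ (Real.log (localTime x j (q + 1)) ^ 2)⁻¹ * (1 / (localTime x j (q + 1) : ℝ)) := by
        gcongr
    _ = _ := by rw [← one_div, one_div_mul_one_div, mul_comm]

end Envelope

end

end VRRW

/-! ### From a good start to localization, pathwise -/

namespace VRRW

noncomputable section

section Window

variable {w : ℕ → ℝ} {α τ a L L' : ℝ} {K : ℕ} {x : ℕ → ℤ} {T n : ℕ}

theorem coarseEnvelope_of_balanced (hw' : IsLogPowerWeight α w) (h0 : 0 ≤ α) (hw0 : 1 ≤ w 0)
    (hth : CrudeThreshold w α a L) (hK : 2 ≤ K) (hLL : L' ≤ Real.log L)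
    (hbal : IsBalanced w K x T n) (hi1 : CrudeInit w a L K x T)
    (hi2 : CrudeInit w a L K (fun i => -x i) T) : CoarseEnvelope w L' K x T n := by
  have hp := hw'.pos
  have hw := hw'.mono
  have hr := fun i h1 h2 => (crude_of_balanced hw' h0 hw0 hth hK hbal hi1 hi2 i h1 h2).1
  have hKr : (2 : ℤ) ≤ K := by exact_mod_cast hK
  have hLpos : 16 ≤ L := by linarith [hth.large, Real.exp_pos 100]
  have habs : ∀ k : ℤ, -(K : ℤ) ≤ k → k ≤ K → |k| ≤ (K : ℤ) := fun k h1 h2 => abs_le.2 ⟨h1, h2⟩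
  have hlt : ∀ i, T ≤ i → ∀ k : ℤ, -(K : ℤ) ≤ k → k ≤ K → L ≤ localTime x i k :=
    fun i hi k h1 h2 => hi1.le_localTime (habs k h1 h2) hi
  have hdecr' : ∀ i, T ≤ i → ∀ k : ℤ, 1 ≤ k → k + 1 ≤ K → CrudeRight w a K x i →
      localTime x i (k + 1) ≤ localTime x i k := by
    intro i hTi k hk1 hk2 hri
    have h1 := hri.decay k hk1 hk2
    have h2 := hth.add_one_le _ (hlt i hTi k (by omega) (by omega))
    exact_mod_cast (by linarith : (localTime x i (k + 1) : ℝ) ≤ localTime x i k)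
  refine ⟨?_, ?_, ?_, ?_, fun i h1 h2 => (hr i h1 h2).center, fun i h1 h2 => (hr i h1 h2).second, ?_⟩
  · intro k hk1 hk2
    have h1 := hi1.large k (habs k (by omega) hk2)
    have h2 : (3 : ℝ) ≤ visitsBefore x T k := by linarith
    exact_mod_cast h2
  · exact hLL.trans (Real.log_le_log (by linarith) (hlt T le_rfl 0 (by omega) (by omega)))
  · intro k hk1
    induction k, hk1 using Int.leInduction with
    | base => exact fun _ => hi1.center
    | succ k hk ih =>
      intro hkK
      exact (hdecr' T le_rfl k hk hkK hi1.right).trans (ih (by omega))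
  · intro i hTi hin k hk0 hkK
    -- Z(1) ≤ Z(0) + Z(2) + 1 together with Z(2) ≤ Z(1) / 2 gives Z(1) ≤ 2 Z(0) + 2 ≤ 3 Z(0).
    have hone : localTime x i 1 ≤ 3 * localTime x i 0 := by
      have h1 := (hbal.mono hin).step.localTime_le 1
      norm_num at h1
      have h2 := (hr i hTi hin).decay 1 le_rfl (by omega)
      have h3 := hth.le_half _ (hlt i hTi 1 (by omega) (by omega))
      norm_num at h2
      have h4 : 2 * localTime x i 2 ≤ localTime x i 1 := by
        exact_mod_cast (by linarith : 2 * (localTime x i 2 : ℝ) ≤ localTime x i 1)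
      have h5 : 2 ≤ localTime x i 0 := by
        have := hlt i hTi 0 (by omega) (by omega)
        exact_mod_cast (by linarith : (2 : ℝ) ≤ localTime x i 0)
      omega
    rcases hk0.eq_or_lt with rfl | hk1
    · omega
    have hk1 : 1 ≤ k := by omega
    induction k, hk1 using Int.leInduction with
    | base => exact hone
    | succ k hk ih =>
      rcases hkK.eq_or_lt with h | h
      · have : localTime x i (k + 1) = 0 := by
          unfold localTime
          rw [Finset.card_eq_zero, Finset.filter_eq_empty_iff]
          intro j hj hjk
          have := hbal.abs_le j (by rw [Finset.mem_range] at hj; omega)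
          rw [hjk, abs_le] at this
          omega
        omega
      · exact (hdecr' i hTi k hk (by omega) (hr i hTi hin)).trans
          (ih (by omega) (by omega) (by omega))
  · intro i hTi hin k hk1 hk2
    rcases hk2.eq_or_lt with rfl | hk2
    · rw [jumpComp_eq_zero]
      · have := bigW_nonneg hp hw (Nat.cast_nonneg (localTime x i K) (α := ℝ))
        positivity
      · intro j hj h
        have := hbal.abs_le j (by omega)
        rw [h, abs_le] at this
        omega
    · refine (jumpComp_le_bigW hp hw hth hTi (hi1.large _ (habs _ (by omega) (by omega)))
        fun j h1 h2 => (hr j h1 (by omega)).decay k hk1 (by omega)).trans ?_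
      have := bigW_nat_mono hp hw (hdecr' i hTi k hk1 (by omega) (hr i hTi hin))
      gcongr

/-- The path `x` has reached at time `T` a configuration from which the walk remains in
`[-K, K]` with positive probability. -/
structure IsGoodStart (w : ℕ → ℝ) (α τ a L : ℝ) (K : ℕ) (x : ℕ → ℤ) (T : ℕ) : Prop where
  crude : CrudeInit w a L K x T
  crude_neg : CrudeInit w a L K (fun i => -x i) T
  fine : FineInit w α τ K x T
  fine_neg : FineInit w α τ K (fun i => -x i) T

theorem IsGoodStart.neg (h : IsGoodStart w α τ a L K x T) :
    IsGoodStart w α τ a L K (fun i => -x i) T :=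
  ⟨h.crude_neg, by simpa using h.crude, h.fine_neg, by simpa using h.fine⟩

/-- The largeness conditions on `L`. -/
structure Threshold (w : ℕ → ℝ) (α τ a : ℝ) (K : ℕ) (L : ℝ) : Prop where
  crude : CrudeThreshold w α a L
  fine : FineThreshold w α τ K (Real.log L)

theorem IsGoodStart.envelope (hw' : IsLogPowerWeight α w) (hw0 : 1 ≤ w 0)
    (he : Exponents α τ K) (hth : Threshold w α τ a K L) (hbal : IsBalanced w K x T n)
    (hs : IsGoodStart w α τ a L K x T) : CoarseEnvelope w (Real.log L) K x T n :=
  coarseEnvelope_of_balanced hw' he.pos.le hw0 hth.crude he.two_le le_rfl hbal hs.crude hs.crude_neg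

theorem IsGoodStart.jumpComp_le (hw' : IsLogPowerWeight α w) (hw0 : 1 ≤ w 0)
    (he : Exponents α τ K) (hth : Threshold w α τ a K L) (hbal : IsBalanced w K x T n)
    (hs : IsGoodStart w α τ a L K x T) (hTn : T ≤ n) :
    jumpComp w x T (n + 1) K ≤ 1 / Real.log L := by
  refine (jumpComp_last_le hw' he hth.fine hbal (hs.envelope hw' hw0 he hth hbal) hs.fine hTn).trans
    ?_
  have h1 := hs.crude.large K (by simp)
  have h2 := hth.crude.large
  have h3 : 1 < L := by linarith [Real.exp_pos 100]
  exact one_div_le_one_div_of_le (Real.log_pos h3) (Real.log_le_log (by linarith) h1)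

theorem IsGoodStart.jumpComp_neg_le (hw' : IsLogPowerWeight α w) (hw0 : 1 ≤ w 0)
    (he : Exponents α τ K) (hth : Threshold w α τ a K L) (hbal : IsBalanced w K x T n)
    (hs : IsGoodStart w α τ a L K x T) (hTn : T ≤ n) :
    jumpComp w x T (n + 1) (-K) ≤ 1 / Real.log L := by
  have := hs.neg.jumpComp_le hw' hw0 he hth hbal.neg hTn
  rwa [jumpComp_neg] at this

theorem frequently_of_tendsto_localTime {k : ℤ}
    (h : Tendsto (fun n => (localTime x n k : ℝ)) atTop atTop) : ∃ᶠ n in atTop, x n = k := by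
  intro hev
  obtain ⟨N, hN⟩ := eventually_atTop.1 hev
  have hc : ∀ n, N ≤ n → localTime x n k = localTime x N k := by
    intro n hn
    induction n, hn using Nat.le_induction with
    | base => rfl
    | succ n hn ih => rw [localTime_succ, ih, if_neg (hN (n + 1) (by omega))]; rfl
  obtain ⟨n, hn1, hn2⟩ := ((h.eventually_gt_atTop (localTime x N k : ℝ)).and
    (eventually_ge_atTop N)).exists
  rw [hc n hn2] at hn1
  exact lt_irrefl _ hn1

theorem sum_localTime (h : ∀ i ≤ n, |x i| ≤ (K : ℤ)) :
    ∑ k ∈ Finset.Icc (-(K : ℤ)) K, localTime x n k = n + 1 := by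
  unfold localTime
  rw [← Finset.card_eq_sum_card_fiberwise, Finset.card_range]
  intro i hi
  simp only [Finset.coe_range, mem_Iio] at hi
  simpa [abs_le] using h i (by omega)

/-- The n + 1 time units are shared by 2K + 1 sites, each with local time at most 3 Z(0). -/
theorem IsGoodStart.tendsto_zero (hw' : IsLogPowerWeight α w) (hw0 : 1 ≤ w 0)
    (he : Exponents α τ K) (hth : Threshold w α τ a K L)
    (hs : IsGoodStart w α τ a L K x T) (hbal : ∀ n, T ≤ n → IsBalanced w K x T n) :
    Tendsto (fun n => (localTime x n 0 : ℝ)) atTop atTop := by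
  have key : ∀ n, T ≤ n → (n : ℝ) ≤ (2 * K + 1) * 3 * localTime x n 0 := by
    intro n hn
    have c1 := hs.envelope hw' hw0 he hth (hbal n hn)
    have c2 := hs.neg.envelope hw' hw0 he hth (hbal n hn).neg
    have h1 : ∀ k ∈ Finset.Icc (-(K : ℤ)) K, localTime x n k ≤ 3 * localTime x n 0 := by
      intro k hk
      rw [Finset.mem_Icc] at hk
      rcases le_total 0 k with h | h
      · exact c1.le_center n hn le_rfl k h (by omega)
      · have := c2.le_center n hn le_rfl (-k) (by omega) (by omega)
        simpa only [localTime_neg, neg_neg, neg_zero] using this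
    have h2 := Finset.sum_le_sum h1
    rw [sum_localTime (hbal n hn).abs_le, Finset.sum_const, Int.card_Icc, smul_eq_mul] at h2
    have h3 : ((K : ℤ) + 1 - -(K : ℤ)).toNat = 2 * K + 1 := by omega
    rw [h3] at h2
    have h4 : ((n + 1 : ℕ) : ℝ) ≤ ((2 * K + 1) * (3 * localTime x n 0) : ℕ) := by exact_mod_cast h2
    push_cast at h4
    linarith
  have hC : (0 : ℝ) < (2 * K + 1) * 3 := by positivity
  have h1 : Tendsto (fun n : ℕ => (n : ℝ) / ((2 * K + 1) * 3)) atTop atTop :=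
    tendsto_natCast_atTop_atTop.atTop_div_const hC
  refine tendsto_atTop_mono' _ ?_ h1
  filter_upwards [eventually_ge_atTop T] with n hn
  rw [div_le_iff₀ hC]
  linarith [key n hn]

/-- Since `lowerExp` is below 1 up to the site K, the lower envelope carries the divergence of Z(0)
to every site. -/
theorem IsGoodStart.frequently (hw' : IsLogPowerWeight α w) (hw0 : 1 ≤ w 0)
    (he : Exponents α τ K) (hth : Threshold w α τ a K L)
    (hs : IsGoodStart w α τ a L K x T) (hbal : ∀ n, T ≤ n → IsBalanced w K x T n) {k : ℤ}
    (hk0 : 0 ≤ k) (hkK : k ≤ K) : ∃ᶠ n in atTop, x n = k := by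
  have hz := hs.tendsto_zero hw' hw0 he hth hbal
  apply frequently_of_tendsto_localTime
  rcases hk0.eq_or_lt with rfl | hk1
  · exact hz
  have hl := Real.tendsto_log_atTop.comp hz
  have hexp : Tendsto (fun l : ℝ => Real.exp (l - l ^ lowerExp α τ k)) atTop atTop := by
    apply Real.tendsto_exp_atTop.comp
    refine tendsto_atTop_mono' _ ?_ (tendsto_id.atTop_div_const (by norm_num : (0 : ℝ) < 2))
    filter_upwards [eventually_mul_rpow_le (he.lowerExp_lt_one hkK) 2] with l h
    rw [Real.rpow_one] at h
    simp only [id_eq]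
    linarith
  refine tendsto_atTop_mono' _ ?_ (hexp.comp hl)
  filter_upwards [eventually_ge_atTop T] with n hn
  exact lower_envelope hw' he hth.fine (hbal n hn) (hs.envelope hw' hw0 he hth (hbal n hn))
    hs.fine hn le_rfl (by omega) hkK

theorem IsGoodStart.localizes (hw' : IsLogPowerWeight α w) (hw0 : 1 ≤ w 0)
    (he : Exponents α τ K) (hth : Threshold w α τ a K L)
    (hs : IsGoodStart w α τ a L K x T) (hbal : ∀ n, T ≤ n → IsBalanced w K x T n) :
    Localizes x ∧ (visitedInfinitelyOften x).ncard = 2 * K + 1 := by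
  have hmem : ∀ n, x n ∈ Icc (-(K : ℤ)) K := by
    intro n
    have := (hbal (max T n) (le_max_left _ _)).abs_le n (le_max_right _ _)
    rwa [_root_.abs_le] at this
  refine ⟨(Set.finite_Icc (-(K : ℤ)) K).subset (by rintro _ ⟨n, rfl⟩; exact hmem n), ?_⟩
  have : visitedInfinitelyOften x = Icc (-(K : ℤ)) K := by
    ext k
    constructor
    · intro hk
      obtain ⟨n, hn⟩ := hk.exists
      rw [← hn]
      exact hmem n
    · intro hk
      rcases le_total 0 k with h | h
      · exact hs.frequently hw' hw0 he hth hbal h hk.2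
      · have := hs.neg.frequently hw' hw0 he hth (fun n hn => (hbal n hn).neg) (k := -k)
          (by omega) (by have := hk.1; omega)
        simp only [neg_inj] at this
        exact this
  rw [this, ← Finset.coe_Icc, Set.ncard_coe_finset, Int.card_Icc]
  omega

end Window

end

end VRRW

/-! ### The supermartingale -/

namespace VRRW

noncomputable section

section Potential

variable {w : ℕ → ℝ} {K : ℕ} {δ : ℝ} {x y : ℕ → ℤ} {T n : ℕ}

/-- The tails of the series `∑ 1 / w(j)²`. -/
def weightTail (w : ℕ → ℝ) (s : ℕ) : ℝ := ∑' j, 1 / w (j + s) ^ 2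

theorem weightTail_nonneg (w : ℕ → ℝ) (s : ℕ) : 0 ≤ weightTail w s :=
  tsum_nonneg fun j => by positivity

theorem weightTail_eq (hs : Summable fun j => 1 / w j ^ 2) (s : ℕ) :
    weightTail w s = 1 / w s ^ 2 + weightTail w (s + 1) := by
  unfold weightTail
  rw [((summable_nat_add_iff s).2 hs).tsum_eq_zero_add, zero_add]
  simp only [add_assoc, add_comm 1 s]

theorem tendsto_weightTail (w : ℕ → ℝ) : Tendsto (weightTail w) atTop (𝓝 0) :=
  tendsto_sum_nat_add fun j => 1 / w j ^ 2

/-- Difference between the weighted number of jumps from `k` to `y` and its compensator. -/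
def fluctuation (w : ℕ → ℝ) (x : ℕ → ℤ) (T n : ℕ) (k y : ℤ) : ℝ :=
  jumpSum w x T n k y - jumpComp w x T n k

/-- The part of the potential attached to the site `y`. -/
def sitePotential (w : ℕ → ℝ) (x : ℕ → ℤ) (T n : ℕ) (y : ℤ) : ℝ :=
  fluctuation w x T n (y - 1) y ^ 2 + fluctuation w x T n (y + 1) y ^ 2 +
    weightTail w (localTime x n y)

/-- The part of the potential that controls the exit from `[-K, K]`. -/
def exitPotential (w : ℕ → ℝ) (K : ℕ) (δ : ℝ) (x : ℕ → ℤ) (T n : ℕ) : ℝ :=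
  w 0 * (2 * δ - jumpComp w x T n K - jumpComp w x T n (-K)) + if |x n| ≤ K then 0 else 1

/-- A supermartingale which exceeds `1` as soon as the path is no longer balanced. -/
def potential (w : ℕ → ℝ) (K : ℕ) (δ : ℝ) (x : ℕ → ℤ) (T n : ℕ) : ℝ :=
  ∑ y ∈ Finset.Icc (-(K : ℤ)) K, sitePotential w x T n y + exitPotential w K δ x T n

/-- The path `x` up to time `n`, followed by a jump to `z`. -/
def stepTo (x : ℕ → ℤ) (n : ℕ) (z : ℤ) : ℕ → ℤ := Function.update x (n + 1) z

theorem stepTo_succ (x : ℕ → ℤ) (n : ℕ) (z : ℤ) : stepTo x n z (n + 1) = z := by simp [stepTo]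

theorem stepTo_of_le (x : ℕ → ℤ) {n i : ℕ} (z : ℤ) (h : i ≤ n) : stepTo x n z i = x i :=
  Function.update_of_ne (by omega) _ _

theorem jumpComp_congr (w : ℕ → ℝ) (h : ∀ i < n, x i = y i) (k : ℤ) :
    jumpComp w x T n k = jumpComp w y T n k := by
  unfold jumpComp
  apply Finset.sum_congr rfl
  intro i hi
  rw [Finset.mem_Ico] at hi
  have h1 := localTime_congr (x := x) (y := y) (n := i) fun j hj => h j (by omega)
  simp only [h i hi.2, h1]

theorem jumpSum_congr (w : ℕ → ℝ) (h : ∀ i ≤ n, x i = y i) (k z : ℤ) :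
    jumpSum w x T n k z = jumpSum w y T n k z := by
  unfold jumpSum
  apply Finset.sum_congr rfl
  intro i hi
  rw [Finset.mem_Ico] at hi
  have h1 := localTime_congr (x := x) (y := y) (n := i) fun j hj => h j (by omega)
  simp only [h i hi.2.le, h (i + 1) hi.2, h1]

theorem fluctuation_congr (w : ℕ → ℝ) (h : ∀ i ≤ n, x i = y i) (k z : ℤ) :
    fluctuation w x T n k z = fluctuation w y T n k z := by
  unfold fluctuation
  rw [jumpSum_congr w h, jumpComp_congr w fun i hi => h i hi.le]

theorem jumpComp_stepTo (w : ℕ → ℝ) (hT : T ≤ n) (z k : ℤ) :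
    jumpComp w (stepTo x n z) T (n + 1) k = jumpComp w x T n k + if x n = k then
      1 / (w (localTime x n (k - 1)) + w (localTime x n (k + 1))) else 0 := by
  rw [← jumpComp_succ w x hT]
  exact jumpComp_congr w (fun i hi => stepTo_of_le x z (by omega)) k

theorem fluctuation_stepTo (w : ℕ → ℝ) (hT : T ≤ n) (z k y : ℤ) :
    fluctuation w (stepTo x n z) T (n + 1) k y = fluctuation w x T n k y +
      ((if x n = k ∧ z = y then 1 / w (localTime x n y) else 0) - if x n = k then
        1 / (w (localTime x n (k - 1)) + w (localTime x n (k + 1))) else 0) := by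
  have h : ∀ i ≤ n, stepTo x n z i = x i := fun i hi => stepTo_of_le x z hi
  unfold fluctuation
  rw [jumpComp_stepTo w hT, jumpSum_succ w _ hT, jumpSum_congr w h, h n le_rfl, stepTo_succ,
    localTime_congr h]
  ring

theorem localTime_stepTo (z y : ℤ) :
    localTime (stepTo x n z) (n + 1) y = localTime x n y + if z = y then 1 else 0 := by
  rw [localTime_succ, stepTo_succ, localTime_congr fun i hi => stepTo_of_le x z hi]

/-- Let the walk be next to y, with b the weight of y and a that of the other neighbour. The
fluctuation has centred increments of variance b/(a+b) · 1/b² - 1/(a+b)², while the weight tail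
drops on average by b/(a+b) · 1/b². The net drift is -1/(a+b)². -/
theorem sitePotential_step (hp : ∀ k, 0 < w k) (hs : Summable fun j => 1 / w j ^ 2) (hT : T ≤ n)
    (y : ℤ) :
    leftProb w x n * sitePotential w (stepTo x n (x n - 1)) T (n + 1) y +
      rightProb w x n * sitePotential w (stepTo x n (x n + 1)) T (n + 1) y ≤
      sitePotential w x T n y := by
  unfold sitePotential
  simp only [fluctuation_stepTo w hT, localTime_stepTo]
  have key : ∀ {p q F G t a b : ℝ}, 0 < a → 0 < b → p = a / (a + b) → q = b / (a + b) →
      p * ((F - 1 / (a + b)) ^ 2 + G + t) +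
        q * ((F + (1 / b - 1 / (a + b))) ^ 2 + G + (t - 1 / b ^ 2)) ≤ F ^ 2 + G + t := by
    intro p q F G t a b ha hb hp hq
    have h1 : p * ((F - 1 / (a + b)) ^ 2 + G + t) +
        q * ((F + (1 / b - 1 / (a + b))) ^ 2 + G + (t - 1 / b ^ 2)) =
        F ^ 2 + G + t - 1 / (a + b) ^ 2 := by
      rw [hp, hq]
      field_simp
      ring
    rw [h1]
    have : 0 < 1 / (a + b) ^ 2 := by positivity
    linarith
  have ht := weightTail_eq hs (localTime x n y)
  have ht' : weightTail w (localTime x n y + 1) =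
      weightTail w (localTime x n y) - 1 / w (localTime x n y) ^ 2 := by linarith
  have hsum := leftProb_add_rightProb hp x n
  rcases eq_or_ne (x n) (y - 1) with h1 | h1
  · have e1 : ¬ x n = y + 1 := by omega
    have e2 : ¬ x n - 1 = y := by omega
    have e3 := eq_true (by omega : x n + 1 = y)
    simp only [e1, e2, e3, eq_true h1, and_false, and_true, if_true, if_false, sub_zero, add_zero,
      sub_add_cancel, ht', zero_sub, ← sub_eq_add_neg]
    apply key (hp _) (hp _)
    · unfold leftProb; rw [h1, sub_add_cancel]
    · unfold rightProb; rw [h1, sub_add_cancel]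
  rcases eq_or_ne (x n) (y + 1) with h2 | h2
  · have e2 := eq_true (by omega : x n - 1 = y)
    have e3 : ¬ x n + 1 = y := by omega
    simp only [e2, e3, h1, eq_true h2, and_false, and_true, if_true, if_false, sub_zero,
      add_zero, add_sub_cancel_right, ht', zero_sub, ← sub_eq_add_neg]
    have := key (F := fluctuation w x T n (y + 1) y) (G := fluctuation w x T n (y - 1) y ^ 2)
      (t := weightTail w (localTime x n y)) (p := rightProb w x n) (q := leftProb w x n)
      (hp (localTime x n (y + 1 + 1))) (hp (localTime x n y))
      (by unfold rightProb; rw [h2, add_sub_cancel_right, add_comm (w (localTime x n y))])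
      (by unfold leftProb; rw [h2, add_sub_cancel_right, add_comm (w (localTime x n y))])
    rw [add_comm (w (localTime x n (y + 1 + 1)))] at this
    linarith
  · have e2 : ¬ x n - 1 = y := by omega
    have e3 : ¬ x n + 1 = y := by omega
    simp only [e2, e3, h1, h2, false_and, if_false, sub_zero, add_zero]
    rw [← add_mul, hsum, one_mul]

/-- At K the outer neighbour is unvisited and has weight w(0), so the exit probability is exactly
w(0) times the increment of the compensator; likewise at -K. The process is a martingale up to the
exit. -/
theorem exitPotential_step (hp : ∀ k, 0 < w k) (hT : T ≤ n) (hK : 1 ≤ K) (hx : |x n| ≤ K)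
    (h1 : localTime x n (K + 1) = 0) (h2 : localTime x n (-K - 1) = 0) :
    leftProb w x n * exitPotential w K δ (stepTo x n (x n - 1)) T (n + 1) +
      rightProb w x n * exitPotential w K δ (stepTo x n (x n + 1)) T (n + 1) ≤
      exitPotential w K δ x T n := by
  unfold exitPotential
  simp only [jumpComp_stepTo w hT, stepTo_succ]
  rw [if_pos hx]
  have hsum := leftProb_add_rightProb hp x n
  have hx' := abs_le.1 hx
  have hl : leftProb w x n = 1 - rightProb w x n := by linarith
  rcases eq_or_ne (x n) K with e | e
  · have e1 : ¬ x n = -K := by omega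
    have e2 : |x n - 1| ≤ (K : ℤ) := abs_le.2 ⟨by omega, by omega⟩
    have e3 : ¬ |x n + 1| ≤ (K : ℤ) := fun h => by have := abs_le.1 h; omega
    have e4 : rightProb w x n =
        w 0 * (1 / (w (localTime x n (K - 1)) + w (localTime x n (K + 1)))) := by
      unfold rightProb; rw [e, h1, mul_one_div]
    rw [if_neg e1, if_pos e2, if_neg e3, if_pos e, hl]
    have e5 : w 0 * (2 * δ - (jumpComp w x T n K +
        1 / (w (localTime x n (K - 1)) + w (localTime x n (K + 1)))) -
        (jumpComp w x T n (-K) + 0)) =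
        w 0 * (2 * δ - jumpComp w x T n K - jumpComp w x T n (-K)) - rightProb w x n := by
      rw [e4]; ring
    rw [e5]
    apply le_of_eq; ring
  rcases eq_or_ne (x n) (-K) with e' | e'
  · have e2 : |x n + 1| ≤ (K : ℤ) := abs_le.2 ⟨by omega, by omega⟩
    have e3 : ¬ |x n - 1| ≤ (K : ℤ) := fun h => by have := abs_le.1 h; omega
    have e4 : leftProb w x n =
        w 0 * (1 / (w (localTime x n (-K - 1)) + w (localTime x n (-K + 1)))) := by
      unfold leftProb; rw [e', h2, mul_one_div]
    rw [if_neg e, if_pos e2, if_neg e3, if_pos e']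
    have e5 : w 0 * (2 * δ - (jumpComp w x T n K + 0) - (jumpComp w x T n (-K) +
        1 / (w (localTime x n (-K - 1)) + w (localTime x n (-K + 1))))) =
        w 0 * (2 * δ - jumpComp w x T n K - jumpComp w x T n (-K)) - leftProb w x n := by
      rw [e4]; ring
    rw [e5, show rightProb w x n = 1 - leftProb w x n by linarith]
    apply le_of_eq; ring
  · have e2 : |x n + 1| ≤ (K : ℤ) := abs_le.2 ⟨by omega, by omega⟩
    have e3 : |x n - 1| ≤ (K : ℤ) := abs_le.2 ⟨by omega, by omega⟩
    rw [if_neg e, if_neg e', if_pos e2, if_pos e3, hl]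
    apply le_of_eq; ring

theorem potential_step (hp : ∀ k, 0 < w k) (hs : Summable fun j => 1 / w j ^ 2) (hT : T ≤ n)
    (hK : 1 ≤ K) (hx : ∀ i ≤ n, |x i| ≤ K) :
    leftProb w x n * potential w K δ (stepTo x n (x n - 1)) T (n + 1) +
      rightProb w x n * potential w K δ (stepTo x n (x n + 1)) T (n + 1) ≤
      potential w K δ x T n := by
  have hz : ∀ k : ℤ, (K : ℤ) < |k| → localTime x n k = 0 := by
    intro k hk
    unfold localTime
    rw [Finset.card_eq_zero, Finset.filter_eq_empty_iff]
    rintro i hi rfl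
    have := hx i (by rw [Finset.mem_range] at hi; omega)
    omega
  have h1 := exitPotential_step (δ := δ) hp hT hK (hx n le_rfl)
    (hz _ (lt_abs.2 (Or.inl (by omega)))) (hz _ (lt_abs.2 (Or.inr (by omega))))
  have h2 := Finset.sum_le_sum fun y (_ : y ∈ Finset.Icc (-(K : ℤ)) K) =>
    sitePotential_step (x := x) hp hs hT y
  rw [Finset.sum_add_distrib, ← Finset.mul_sum, ← Finset.mul_sum] at h2
  unfold potential
  linarith

theorem sitePotential_nonneg (w : ℕ → ℝ) (x : ℕ → ℤ) (T n : ℕ) (y : ℤ) :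
    0 ≤ sitePotential w x T n y := by
  have := weightTail_nonneg w (localTime x n y)
  unfold sitePotential
  positivity

theorem le_potential_of_fluctuation {z : ℤ} (hz : |z| ≤ K)
    (h : ¬ (|fluctuation w x T n (z - 1) z| ≤ 1 ∧ |fluctuation w x T n (z + 1) z| ≤ 1)) :
    1 + exitPotential w K δ x T n ≤ potential w K δ x T n := by
  have h1 := Finset.single_le_sum (f := fun y => sitePotential w x T n y)
    (fun y _ => sitePotential_nonneg w x T n y) (Finset.mem_Icc.2 (abs_le.1 hz))
  have h2 : 1 ≤ sitePotential w x T n z := by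
    have h3 := weightTail_nonneg w (localTime x n z)
    unfold sitePotential
    by_cases h4 : |fluctuation w x T n (z - 1) z| ≤ 1
    · have h5 : 1 < |fluctuation w x T n (z + 1) z| := by
        by_contra h6
        exact h ⟨h4, not_lt.1 h6⟩
      have h6 := (one_lt_sq_iff_one_lt_abs _).2 h5
      have := sq_nonneg (fluctuation w x T n (z - 1) z)
      linarith
    · have h6 := (one_lt_sq_iff_one_lt_abs _).2 (not_le.1 h4)
      have := sq_nonneg (fluctuation w x T n (z + 1) z)
      linarith
  unfold potential
  linarith

theorem potential_self (hT : |x T| ≤ K) : potential w K δ x T T =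
    ∑ y ∈ Finset.Icc (-(K : ℤ)) K, weightTail w (localTime x T y) + w 0 * (2 * δ) := by
  unfold potential exitPotential sitePotential fluctuation jumpSum jumpComp
  simp [hT]

end Potential

end

end VRRW

/-! ### Positive probability of staying tame -/

namespace VRRW

noncomputable section

section Probability

variable {w : ℕ → ℝ} {K : ℕ} {δ : ℝ} {x y : ℕ → ℤ} {T n : ℕ}

/-- Up to time `n`, the nearest neighbour path `x` remains in `[-K, K]` and its fluctuations since
time `T` are at most `1`. -/
structure IsTame (w : ℕ → ℝ) (K : ℕ) (x : ℕ → ℤ) (T n : ℕ) : Prop where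
  abs_le : ∀ i ≤ n, |x i| ≤ K
  step : IsNNPath x n
  fluct : ∀ i, T ≤ i → i ≤ n → ∀ z : ℤ, |z| ≤ K →
    |fluctuation w x T i (z - 1) z| ≤ 1 ∧ |fluctuation w x T i (z + 1) z| ≤ 1

theorem IsTame.congr (h : IsTame w K x T n) (hxy : ∀ i ≤ n, x i = y i) : IsTame w K y T n := by
  refine ⟨fun i hi => hxy i hi ▸ h.abs_le i hi, fun i hi => ?_, fun i h1 h2 z hz => ?_⟩
  · rw [← hxy i hi.le, ← hxy (i + 1) hi]
    exact h.step i hi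
  · have e := fun j (hj : j ≤ i) => hxy j (hj.trans h2)
    rw [← fluctuation_congr w e, ← fluctuation_congr w e]
    exact h.fluct i h1 h2 z hz

theorem IsTame.isBalanced (h : IsTame w K x T n) (hp : ∀ k, 0 < w k) (hw : Monotone w)
    (hw0 : 1 ≤ w 0) : IsBalanced w K x T n :=
  IsBalanced.of_jumpSum hp hw hw0 h.abs_le h.step h.fluct

theorem exitPotential_nonneg (hp : ∀ k, 0 < w k)
    (h : jumpComp w x T n K + jumpComp w x T n (-K) ≤ 2 * δ) :
    0 ≤ exitPotential w K δ x T n ∧ (¬ |x n| ≤ K → 1 ≤ exitPotential w K δ x T n) := by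
  have h1 : 0 ≤ w 0 * (2 * δ - jumpComp w x T n K - jumpComp w x T n (-K)) :=
    mul_nonneg (hp 0).le (by linarith)
  unfold exitPotential
  refine ⟨?_, fun hx => ?_⟩
  · split_ifs <;> linarith
  · rw [if_neg hx]; linarith

theorem potential_nonneg (hp : ∀ k, 0 < w k)
    (h : jumpComp w x T n K + jumpComp w x T n (-K) ≤ 2 * δ) : 0 ≤ potential w K δ x T n :=
  add_nonneg (Finset.sum_nonneg fun y _ => sitePotential_nonneg w x T n y)
    (exitPotential_nonneg hp h).1

/-- A first failure shows in the potential: either the exit indicator is 1 or some squared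
fluctuation exceeds 1, and the remaining terms are nonnegative by the bound on the exit
compensators. These depend on the path up to n only, so the new jump does not matter. -/
theorem IsTame.stepTo (hp : ∀ k, 0 < w k) (h : IsTame w K x T n)
    (hexit : jumpComp w x T (n + 1) K + jumpComp w x T (n + 1) (-K) ≤ 2 * δ) {z : ℤ}
    (hz : z = x n + 1 ∨ z = x n - 1) :
    IsTame w K (stepTo x n z) T (n + 1) ∨ 1 ≤ potential w K δ (stepTo x n z) T (n + 1) := by
  have hc : ∀ i ≤ n, x i = VRRW.stepTo x n z i := fun i hi => (stepTo_of_le x z hi).symm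
  have h' := h.congr hc
  have hexit' : jumpComp w (VRRW.stepTo x n z) T (n + 1) K +
      jumpComp w (VRRW.stepTo x n z) T (n + 1) (-K) ≤ 2 * δ := by
    rw [← jumpComp_congr w fun i hi => hc i (by omega), ← jumpComp_congr w fun i hi => hc i (by omega)]
    exact hexit
  obtain ⟨e1, e2⟩ := exitPotential_nonneg hp hexit'
  rw [or_iff_not_imp_right]
  intro hlt
  refine ⟨fun i hi => ?_, fun i hi => ?_, fun i h1 h2 y hy => ?_⟩
  · rcases Nat.le_succ_iff.1 hi with hi | rfl
    · exact h'.abs_le i hi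
    · by_contra hcon
      have h3 := e2 hcon
      have h4 := Finset.sum_nonneg fun y (_ : y ∈ Finset.Icc (-(K : ℤ)) K) =>
        sitePotential_nonneg w (VRRW.stepTo x n z) T (n + 1) y
      unfold potential at hlt
      exact hlt (by linarith)
  · rcases Nat.lt_succ_iff_lt_or_eq.1 hi with hi | rfl
    · exact h'.step i hi
    · rw [stepTo_succ, stepTo_of_le x z le_rfl]
      exact hz
  · rcases Nat.le_succ_iff.1 h2 with h2 | rfl
    · exact h'.fluct i h1 h2 y hy
    · by_contra hcon
      have := le_potential_of_fluctuation (δ := δ) hy hcon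
      exact hlt (by linarith)

theorem history_stepTo {Ω : Type*} (X : ℕ → Ω → ℤ) (x : ℕ → ℤ) (n : ℕ) (z : ℤ) :
    history X (stepTo x n z) (n + 1) = history X x n ∩ {ω | X (n + 1) ω = z} := by
  ext ω
  constructor
  · intro h
    refine ⟨fun i hi => ?_, ?_⟩
    · rw [h i (by omega), stepTo_of_le x z hi]
    · have := h (n + 1) le_rfl
      rwa [stepTo_succ] at this
  · rintro ⟨h1, h2⟩ i hi
    rcases Nat.le_succ_iff.1 hi with hi | rfl
    · rw [h1 i hi, stepTo_of_le x z hi]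
    · rw [stepTo_succ]; exact h2

variable {Ω : Type*} [MeasurableSpace Ω] {P : Measure Ω} {X : ℕ → Ω → ℤ}

theorem IsVRRW.measurableSet_history (hX : IsVRRW P w X) (x : ℕ → ℤ) (n : ℕ) :
    MeasurableSet (history X x n) := by
  have : history X x n = ⋂ i ∈ Finset.range (n + 1), {ω | X i ω = x i} := by
    ext ω; simp [history]
  rw [this]
  exact Finset.measurableSet_biInter _ fun i _ => hX.measurable i (measurableSet_singleton _)

theorem measureReal_inter_of_cond [IsProbabilityMeasure P] {A B : Set Ω} (hA : MeasurableSet A)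
    {p : ℝ} (hp : 0 ≤ p) (h : P A ≠ 0 → ProbabilityTheory.cond P A B = ENNReal.ofReal p) :
    P.real (A ∩ B) = P.real A * p := by
  by_cases h0 : P A = 0
  · have h1 : P.real A = 0 := by simp [Measure.real, h0]
    rw [h1, zero_mul, Measure.real, measure_mono_null inter_subset_left h0, ENNReal.toReal_zero]
  · have h1 := h h0
    rw [ProbabilityTheory.cond_apply hA] at h1
    have h2 : P (A ∩ B) = P A * ENNReal.ofReal p := by
      rw [← h1, ← mul_assoc, ENNReal.mul_inv_cancel h0 (measure_ne_top P A), one_mul]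
    rw [Measure.real, h2, ENNReal.toReal_mul, ENNReal.toReal_ofReal hp, Measure.real]

theorem IsVRRW.history_right [IsProbabilityMeasure P] (hX : IsVRRW P w X) (hp : ∀ k, 0 < w k)
    (x : ℕ → ℤ) (n : ℕ) :
    P.real (history X (stepTo x n (x n + 1)) (n + 1)) =
      P.real (history X x n) * rightProb w x n := by
  rw [history_stepTo]
  exact measureReal_inter_of_cond (hX.measurableSet_history x n) (rightProb_pos hp x n).le
    (hX.jump_right n x)

theorem IsVRRW.history_left [IsProbabilityMeasure P] (hX : IsVRRW P w X) (hp : ∀ k, 0 < w k)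
    (x : ℕ → ℤ) (n : ℕ) :
    P.real (history X (stepTo x n (x n - 1)) (n + 1)) =
      P.real (history X x n) * leftProb w x n := by
  rw [history_stepTo]
  exact measureReal_inter_of_cond (hX.measurableSet_history x n) (leftProb_pos hp x n).le
    (hX.jump_left n x)

theorem IsVRRW.history_pos [IsProbabilityMeasure P] (hX : IsVRRW P w X) (hp : ∀ k, 0 < w k)
    (h0 : x 0 = 0) (hx : IsNNPath x n) : 0 < P.real (history X x n) := by
  induction n with
  | zero =>
    have h1 : P (history X x 0) = 1 := by
      rw [prob_compl_eq_zero_iff (hX.measurableSet_history x 0) |>.symm]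
      have := hX.start
      rw [ae_iff] at this
      convert this using 2
      ext ω
      simp [history, h0]
    simp [Measure.real, h1]
  | succ n ih =>
    have ih := ih fun i hi => hx i (by omega)
    have hc : x = stepTo x n (x (n + 1)) := (Function.update_eq_self _ _).symm
    rcases hx n (by omega) with h | h
    · rw [hc, h, hX.history_right hp]
      exact mul_pos ih (rightProb_pos hp x n)
    · rw [hc, h, hX.history_left hp]
      exact mul_pos ih (leftProb_pos hp x n)

/-- Optional stopping as an induction on the number of remaining steps, splitting on the next jump.
The alternative that the potential is at least 1 stands for stopped paths, for which the left side
is nonpositive. -/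
theorem IsVRRW.le_measure_tame [IsProbabilityMeasure P] (hX : IsVRRW P w X) (hp : ∀ k, 0 < w k)
    (hs : Summable fun j => 1 / w j ^ 2) (hK : 1 ≤ K)
    (hexit : ∀ y n, T ≤ n → (∀ i ≤ T, y i = x i) → IsTame w K y T n →
      jumpComp w y T (n + 1) K + jumpComp w y T (n + 1) (-K) ≤ 2 * δ) (m : ℕ) :
    ∀ n y, T ≤ n → (∀ i ≤ T, y i = x i) → (IsTame w K y T n ∨ 1 ≤ potential w K δ y T n) →
      P.real (history X y n) * (1 - potential w K δ y T n) ≤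
        P.real (history X y n ∩ {ω | IsTame w K (fun i => X i ω) T (n + m)}) := by
  induction m with
  | zero =>
    intro n y hT hy hor
    rcases hor with ht | h1
    · have e1 : history X y n ∩ {ω | IsTame w K (fun i => X i ω) T (n + 0)} = history X y n := by
        apply inter_eq_left.2
        intro ω hω
        exact ht.congr fun i hi => (hω i hi).symm
      have e2 := hexit y n hT hy ht
      have e3 := jumpComp_mono hp y (T := T) (Nat.le_succ n) K
      have e4 := jumpComp_mono hp y (T := T) (Nat.le_succ n) (-K)
      have e5 : 0 ≤ potential w K δ y T n :=
        potential_nonneg hp (by simp only [Nat.succ_eq_add_one] at e3 e4; linarith)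
      rw [e1]
      exact mul_le_of_le_one_right measureReal_nonneg (by linarith)
    · exact (mul_nonpos_of_nonneg_of_nonpos measureReal_nonneg (by linarith)).trans
        measureReal_nonneg
  | succ m ih =>
    intro n y hT hy hor
    rcases hor with ht | h1
    · have e2 := hexit y n hT hy ht
      have hy' : ∀ z, ∀ i ≤ T, stepTo y n z i = x i := fun z i hi => by
        rw [stepTo_of_le y z (hi.trans hT), hy i hi]
      have r1 := ih (n + 1) _ (by omega) (hy' (y n + 1)) (ht.stepTo hp e2 (Or.inl rfl))
      have r2 := ih (n + 1) _ (by omega) (hy' (y n - 1)) (ht.stepTo hp e2 (Or.inr rfl))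
      rw [hX.history_right hp, history_stepTo] at r1
      rw [hX.history_left hp, history_stepTo] at r2
      have hstep := potential_step (δ := δ) hp hs hT hK ht.abs_le
      have hsum := leftProb_add_rightProb hp y n
      rw [show n + 1 + m = n + (m + 1) by ring] at r1 r2
      set E := {ω | IsTame w K (fun i => X i ω) T (n + (m + 1))}
      have hm : MeasurableSet {ω | X (n + 1) ω = y n + 1} :=
        hX.measurable (n + 1) (measurableSet_singleton _)
      have hsplit := measureReal_inter_add_sdiff (μ := P) (s := history X y n ∩ E) hm
      have hd : P.real (history X y n ∩ {ω | X (n + 1) ω = y n - 1} ∩ E) ≤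
          P.real ((history X y n ∩ E) \ {ω | X (n + 1) ω = y n + 1}) := by
        refine measureReal_mono ?_ (measure_ne_top P _)
        rintro ω ⟨⟨h1, h2⟩, h3⟩
        refine ⟨⟨h1, h3⟩, fun h4 => ?_⟩
        simp only [mem_ofPred_eq] at h2 h4
        omega
      rw [inter_right_comm] at r1
      have hnn : 0 ≤ P.real (history X y n) := measureReal_nonneg
      have := mul_le_mul_of_nonneg_left hstep hnn
      have e : rightProb w y n = 1 - leftProb w y n := by linarith
      rw [e] at this r1
      linarith
    · exact (mul_nonpos_of_nonneg_of_nonpos measureReal_nonneg (by linarith)).trans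
        measureReal_nonneg

/-- The event depends on finitely many integer positions, and every subset of a countable discrete
space is measurable. -/
theorem IsVRRW.measurableSet_tame (hX : IsVRRW P w X) (T n : ℕ) :
    MeasurableSet {ω | IsTame w K (fun i => X i ω) T n} := by
  have hr : Measurable fun ω => fun i : Fin (n + 1) => X i ω :=
    measurable_pi_lambda _ fun i => hX.measurable i
  have : {ω | IsTame w K (fun i => X i ω) T n} = (fun ω => fun i : Fin (n + 1) => X i ω) ⁻¹'
      {h | ∃ y : ℕ → ℤ, (∀ i : Fin (n + 1), y i = h i) ∧ IsTame w K y T n} := by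
    ext ω
    constructor
    · intro h
      exact ⟨fun i => X i ω, fun i => rfl, h⟩
    · rintro ⟨y, h1, h2⟩
      exact h2.congr fun i hi => h1 ⟨i, by omega⟩
  rw [this]
  exact hr (Set.to_countable _).measurableSet

/-- The lower bound of `le_measure_tame` does not depend on m, so continuity from above carries it
to the intersection. -/
theorem IsVRRW.measure_forall_tame_pos [IsProbabilityMeasure P] (hX : IsVRRW P w X)
    (hp : ∀ k, 0 < w k) (hs : Summable fun j => 1 / w j ^ 2) (hK : 1 ≤ K)
    (hexit : ∀ y n, T ≤ n → (∀ i ≤ T, y i = x i) → IsTame w K y T n →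
      jumpComp w y T (n + 1) K + jumpComp w y T (n + 1) (-K) ≤ 2 * δ) (h0 : x 0 = 0)
    (hstep : IsNNPath x T) (habs : ∀ i ≤ T, |x i| ≤ K) (hpot : potential w K δ x T T < 1) :
    0 < P (history X x T ∩ ⋂ m, {ω | IsTame w K (fun i => X i ω) T (T + m)}) := by
  have htame : IsTame w K x T T := by
    refine ⟨habs, hstep, fun i h1 h2 z _ => ?_⟩
    obtain rfl : i = T := le_antisymm h2 h1
    simp [fluctuation, jumpSum, jumpComp]
  have hlow := fun m => hX.le_measure_tame (T := T) (x := x) hp hs hK hexit m T x le_rfl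
    (fun i _ => rfl) (Or.inl htame)
  have hpos := mul_pos (hX.history_pos hp h0 hstep) (sub_pos.2 hpot)
  rw [inter_iInter]
  have hanti : Antitone fun m => history X x T ∩ {ω | IsTame w K (fun i => X i ω) T (T + m)} := by
    intro m m' hm ω hω
    have h : IsTame w K (fun i => X i ω) T (T + m') := hω.2
    exact ⟨hω.1, fun i hi => h.abs_le i (by omega), fun i hi => h.step i (by omega),
      fun i h1 h2 => h.fluct i h1 (by omega)⟩
  have hlim := tendsto_measure_iInter_atTop (μ := P)
    (fun m => ((hX.measurableSet_history x T).inter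
      (hX.measurableSet_tame (K := K) T (T + m))).nullMeasurableSet) hanti
    ⟨0, measure_ne_top P _⟩
  refine lt_of_lt_of_le (ENNReal.ofReal_pos.2 hpos) (ge_of_tendsto' hlim fun m => ?_)
  exact (ENNReal.ofReal_le_iff_le_toReal (measure_ne_top P _)).2 (hlow m)

theorem IsGoodStart.congr {α τ a L : ℝ} (h : IsGoodStart w α τ a L K x T)
    (hxy : ∀ i ≤ T, x i = y i) : IsGoodStart w α τ a L K y T := by
  have key : ∀ {x y : ℕ → ℤ}, (∀ i ≤ T, x i = y i) →
      (CrudeInit w a L K x T → CrudeInit w a L K y T) ∧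
      (FineInit w α τ K x T → FineInit w α τ K y T) := by
    intro x y hxy
    have e1 : localTime x T = localTime y T := funext fun k => localTime_congr hxy k
    have e2 : visitsBefore x T = visitsBefore y T := by
      funext k
      unfold visitsBefore
      congr 1
      apply Finset.filter_congr
      intro i hi
      rw [hxy i (Finset.mem_range.1 hi).le]
    refine ⟨fun h => ⟨?_, ⟨?_, ?_, ?_⟩, ?_, ?_, ?_, ?_⟩, fun h => ⟨?_, ?_⟩⟩
    all_goals first | rw [← e2] | rw [← e1]
    exacts [h.large, h.right.decay, h.right.center, h.right.second, h.start, h.second, h.center,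
      h.sym, h.lower, h.upper]
  have hn : ∀ i ≤ T, -x i = -y i := fun i hi => by rw [hxy i hi]
  exact ⟨(key hxy).1 h.crude, (key hn).1 h.crude_neg, (key hxy).2 h.fine, (key hn).2 h.fine_neg⟩

theorem IsVRRW.localizes_pos [IsProbabilityMeasure P] {α τ a L : ℝ} (hX : IsVRRW P w X)
    (hw : IsLogPowerWeight α w) (hw0 : 1 ≤ w 0) (hs : Summable fun j => 1 / w j ^ 2)
    (he : Exponents α τ K) (hth : Threshold w α τ a K L)
    (htail : ∀ z : ℕ, L ≤ z → (2 * K + 1) * weightTail w z + w 0 * (2 * (1 / Real.log L)) < 1)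
    (hgood : IsGoodStart w α τ a L K x T) (h0 : x 0 = 0) (hstep : IsNNPath x T)
    (habs : ∀ i ≤ T, |x i| ≤ K) :
    0 < P {ω | Localizes (fun n => X n ω) ∧
      (visitedInfinitelyOften (fun n => X n ω)).ncard = 2 * K + 1} := by
  have hp := hw.pos
  have hK : 1 ≤ K := by have := he.two_le; omega
  refine (hX.measure_forall_tame_pos (T := T) (x := x) (δ := 1 / Real.log L) hp hs hK ?_ h0 hstep
    habs ?_).trans_le (measure_mono ?_)
  · intro y n hT hy ht
    have hg := hgood.congr fun i hi => (hy i hi).symm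
    have hb := ht.isBalanced hp hw.mono hw0
    have h1 := hg.jumpComp_le hw hw0 he hth hb hT
    have h2 := hg.jumpComp_neg_le hw hw0 he hth hb hT
    linarith
  · rw [potential_self (habs T le_rfl)]
    -- The 2K + 1 tails are bounded by the largest one, whose local time is at least L, so that
    -- `htail` applies.
    obtain ⟨y, hy, hmax⟩ := Finset.exists_max_image (Finset.Icc (-(K : ℤ)) K)
      (fun y => weightTail w (localTime x T y)) ⟨0, by simp⟩
    have h1 := Finset.sum_le_card_nsmul _ _ _ hmax
    have h3 : ((K : ℤ) + 1 - -(K : ℤ)).toNat = 2 * K + 1 := by omega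
    rw [Int.card_Icc, h3, nsmul_eq_mul] at h1
    push_cast at h1
    have h2 := htail (localTime x T y)
      (hgood.crude.le_localTime (abs_le.2 (Finset.mem_Icc.1 hy)) le_rfl)
    linarith
  · rintro ω ⟨h1, h2⟩
    refine (hgood.congr fun i hi => (h1 i hi).symm).localizes hw hw0 he hth fun n hn => ?_
    have h3 := mem_iInter.1 h2 (n - T)
    rw [Nat.add_sub_cancel' hn] at h3
    exact IsTame.isBalanced h3 hp hw.mono hw0

end Probability

end

end VRRW

/-! ### Paths with prescribed local times -/

namespace VRRW

noncomputable section

section Reachable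

variable {K : ℕ} {p : ℤ} {Z : ℤ → ℕ}

/-- Some nearest neighbour path in `[-K, K]` leads from the origin to `p` with local times `Z`. -/
def IsReachable (K : ℕ) (p : ℤ) (Z : ℤ → ℕ) : Prop :=
  ∃ (x : ℕ → ℤ) (T : ℕ), x 0 = 0 ∧ IsNNPath x T ∧ (∀ i ≤ T, |x i| ≤ K) ∧ x T = p ∧
    localTime x T = Z

theorem isReachable_zero (K : ℕ) : IsReachable K 0 (Pi.single 0 1) := by
  refine ⟨fun _ => 0, 0, rfl, fun i hi => by omega, fun i _ => by simp, rfl, ?_⟩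
  funext y
  rw [localTime_eq_add]
  simp [visitsBefore, Pi.single_apply, eq_comm]

theorem IsReachable.step (h : IsReachable K p Z) {z : ℤ} (hz : z = p + 1 ∨ z = p - 1)
    (hK : |z| ≤ K) : IsReachable K z (Z + Pi.single z 1) := by
  obtain ⟨x, T, h0, h1, h2, rfl, rfl⟩ := h
  refine ⟨stepTo x T z, T + 1, ?_, fun i hi => ?_, fun i hi => ?_, stepTo_succ x T z, ?_⟩
  · rw [stepTo_of_le x z (Nat.zero_le T), h0]
  · rcases Nat.lt_succ_iff_lt_or_eq.1 hi with hi | rfl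
    · rw [stepTo_of_le x z hi, stepTo_of_le x z hi.le]
      exact h1 i hi
    · rw [stepTo_succ, stepTo_of_le x z le_rfl]
      exact hz
  · rcases Nat.le_succ_iff.1 hi with hi | rfl
    · rw [stepTo_of_le x z hi]; exact h2 i hi
    · rw [stepTo_succ]; exact hK
  · funext y
    rw [localTime_stepTo, Pi.add_apply, Pi.single_apply]
    simp only [eq_comm]

theorem IsReachable.neg (h : IsReachable K p Z) : IsReachable K (-p) fun y => Z (-y) := by
  obtain ⟨x, T, h0, h1, h2, rfl, rfl⟩ := h
  refine ⟨fun i => -x i, T, by simp [h0], fun i hi => ?_, fun i hi => by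
    rw [abs_neg]; exact h2 i hi, rfl, funext fun y => localTime_neg x T y⟩
  rcases h1 i hi with h | h
  · right; simp only [h]; ring
  · left; simp only [h]; ring

theorem IsReachable.bounce (h : IsReachable K p Z) (h1 : |p| ≤ K) (h2 : |p + 1| ≤ K) (j : ℕ) :
    IsReachable K p (Z + j • (Pi.single p 1 + Pi.single (p + 1) 1)) := by
  induction j with
  | zero => simpa using h
  | succ j ih =>
    have := (ih.step (Or.inl rfl) h2).step (z := p) (Or.inr (by ring)) h1
    convert this using 1
    rw [succ_nsmul]
    abel

/-- From k make c(k) - 1 round trips to k + 1, step right, perform the excursion from k + 1, and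
step back. The edge is used for c(k) round trips, each adding one visit to both its ends. -/
theorem IsReachable.excursion {c : ℕ → ℕ} (hc : ∀ i, 1 ≤ c i) {k : ℕ} (hk : k ≤ K)
    (h : IsReachable K k Z) : IsReachable K k (Z + ∑ i ∈ Finset.Ico k K,
      c i • (Pi.single (i : ℤ) 1 + Pi.single ((i : ℤ) + 1) 1)) := by
  induction hk using Nat.decreasingInduction generalizing Z with
  | self => simpa using h
  | of_succ k hk ih =>
    have a1 : |(k : ℤ)| ≤ K := abs_le.2 ⟨by omega, by omega⟩
    have a2 : |(k : ℤ) + 1| ≤ K := abs_le.2 ⟨by omega, by omega⟩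
    have h1 := (h.bounce a1 a2 (c k - 1)).step (Or.inl rfl) a2
    have h2 := ih (by exact_mod_cast h1)
    have h3 := h2.step (z := k) (Or.inr (by push_cast; ring)) a1
    convert h3 using 1
    rw [Finset.sum_eq_sum_Ico_succ_bot hk]
    obtain ⟨j, hj⟩ : ∃ j, c k = j + 1 := ⟨c k - 1, by have := hc k; omega⟩
    rw [hj, succ_nsmul, Nat.add_sub_cancel]
    push_cast
    abel

theorem exists_path_localTime {c : ℕ → ℕ} (hc : ∀ i, 1 ≤ c i) (hK : 1 ≤ K) :
    ∃ (x : ℕ → ℤ) (T : ℕ), x 0 = 0 ∧ IsNNPath x T ∧ (∀ i ≤ T, |x i| ≤ K) ∧ x T = 0 ∧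
      localTime x T 0 = 2 * c 0 + 1 ∧ (∀ k, localTime x T (-k) = localTime x T k) ∧
      (∀ k : ℕ, 1 ≤ k → k < K → localTime x T k = c (k - 1) + c k) ∧
      localTime x T K = c (K - 1) := by
  set e : ℤ → ℕ := ∑ i ∈ Finset.Ico 0 K, c i • (Pi.single (i : ℤ) 1 + Pi.single ((i : ℤ) + 1) 1)
    with he
  have h0 : IsReachable K ((0 : ℕ) : ℤ) (Pi.single 0 1) := isReachable_zero K
  -- An excursion to the right, a reflection, and a second excursion to the right produce a
  -- symmetric profile.
  have h1 := h0.excursion hc (Nat.zero_le K)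
  have h2 := h1.neg
  rw [Nat.cast_zero, neg_zero] at h2
  have h3 := IsReachable.excursion (k := 0) hc (Nat.zero_le K) h2
  obtain ⟨x, T, a1, a2, a3, a4, a5⟩ := h3
  have hZ : ∀ y, localTime x T y = Pi.single (M := fun _ : ℤ => ℕ) (0 : ℤ) 1 y + e (-y) + e y := by
    intro y
    rw [a5]
    simp only [Pi.add_apply, ← he]
    congr 2
    simp [Pi.single_apply]
  have hev : ∀ y, e y = ∑ i ∈ Finset.Ico 0 K,
      c i * ((if y = i then 1 else 0) + if y = (i : ℤ) + 1 then 1 else 0) := by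
    intro y
    simp [he, Finset.sum_apply, Pi.single_apply, mul_add]
  have hneg : ∀ k : ℕ, 1 ≤ k → e (-k) = 0 := by
    intro k hk
    rw [hev]
    apply Finset.sum_eq_zero
    intro i _
    rw [if_neg (by omega), if_neg (by omega)]; rfl
  have hzero : e 0 = c 0 := by
    rw [hev, Finset.sum_eq_single 0]
    · simp
    · intro i _ hi
      rw [if_neg (by omega), if_neg (by omega)]; rfl
    · intro h
      exact absurd (Finset.mem_Ico.2 ⟨le_rfl, hK⟩) h
  have hpos : ∀ k : ℕ, 1 ≤ k → k ≤ K → e k = c (k - 1) + if k < K then c k else 0 := by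
    intro k hk hkK
    obtain ⟨q, rfl⟩ : ∃ q, k = q + 1 := ⟨k - 1, by omega⟩
    rw [hev]
    simp only [mul_add, Finset.sum_add_distrib]
    rw [add_comm, Finset.sum_eq_single q]
    · simp only [mul_ite, mul_one, mul_zero, Nat.cast_add, Nat.cast_one, if_true,
        Nat.add_sub_cancel]
      congr 1
      have : ∀ i : ℕ, ((q : ℤ) + 1 = i) = (q + 1 = i) := fun i => by
        rw [eq_iff_iff]; omega
      simp only [this, Finset.sum_ite_eq, Finset.mem_Ico, Nat.zero_le, true_and]
    · intro i _ hi
      rw [if_neg (by omega), mul_zero]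
    · intro h
      exact absurd (Finset.mem_Ico.2 ⟨Nat.zero_le q, hkK⟩) h
  have hs : ∀ k : ℕ, 1 ≤ k → Pi.single (M := fun _ : ℤ => ℕ) (0 : ℤ) 1 (k : ℤ) = 0 := by
    intro k hk
    rw [Pi.single_apply, if_neg (by omega)]
  refine ⟨x, T, a1, a2, a3, by simpa using a4, ?_, ?_, ?_, ?_⟩
  · rw [hZ, neg_zero, hzero, Pi.single_eq_same]; ring
  · intro k
    rw [hZ, hZ, neg_neg]
    simp only [Pi.single_apply, neg_eq_zero]
    ring
  · intro k hk1 hk2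
    rw [hZ, hneg k hk1, hpos k hk1 hk2.le, if_pos hk2, hs k hk1]; ring
  · rw [hZ, hneg K hK, hpos K hK le_rfl, if_neg (lt_irrefl K), hs K hK]; ring

end Reachable

end

end VRRW

/-! ### The starting configuration -/

namespace VRRW

noncomputable section

section Start

/-- Both sides are compared with exp(l^α - 2 l^b), where b lies strictly between q - (1-α) and p -
(1-α) and is positive. -/
theorem ScaleBounds.eventually_mul_add_le {α : ℝ} {V : ℝ → ℝ} (h : ScaleBounds α V) (h0 : 0 < α)
    (h1 : α < 1) {p q : ℝ} (hqp : q < p) (hp1 : p < 1) (hpα : 1 - α < p) (C : ℝ) (hC : 0 ≤ C) :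
    ∀ᶠ l in atTop, C * (V (l - l ^ p) + C) ≤ V (l - l ^ q) := by
  obtain ⟨b, hb1, hb2⟩ := exists_between (max_lt (by linarith : 0 < p - (1 - α))
    (by linarith : q - (1 - α) < p - (1 - α)))
  have hb0 := (le_max_left _ _).trans_lt hb1
  have hbq := (le_max_right _ _).trans_lt hb1
  filter_upwards [h.eventually_shift_add_le h0 h1 hb0.le (by linarith : b + (1 - α) < p) hp1 2 C,
    h.eventually_le_shift h0 h1 hb0 (by norm_num : (0 : ℝ) < 2) (by linarith : q < b + (1 - α))
    (by linarith) C, eventually_ge_atTop 1] with l e1 e2 e3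
  refine (mul_le_mul_of_nonneg_left (e1.trans ?_) hC).trans e2
  have := Real.exp_pos (l ^ α - 2 * l ^ b)
  nlinarith

/-- Upper exponent of the starting configuration at the site `k`. -/
def outerExp (α τ : ℝ) (k : ℤ) : ℝ := (k - 1) * (1 - α) + τ / 4

/-- The quantitative largeness conditions used for the starting configuration. -/
structure StartScale (w : ℕ → ℝ) (α τ a : ℝ) (K : ℕ) (L l : ℝ) : Prop where
  large : 16 + 4 * L ≤ Real.exp l
  one_le : 1 ≤ l
  le_inner : ∀ k : ℤ, 2 ≤ k → k ≤ K → max L 2 ≤ Real.exp (l - l ^ midExp α τ k)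
  inner_anti : ∀ k : ℤ, 2 ≤ k → k + 1 ≤ K →
    Real.exp (l - l ^ midExp α τ (k + 1)) ≤ Real.exp (l - l ^ midExp α τ k)
  inner_le : ∀ k : ℤ, 2 ≤ k → k ≤ K →
    3 * Real.exp (l - l ^ midExp α τ k) ≤ Real.exp (l - l ^ outerExp α τ k)
  decay_one : Real.exp (l - l ^ outerExp α τ 2) ≤ Real.exp l / 4 * Real.exp (-l ^ a)
  decay : ∀ k : ℤ, 2 ≤ k → k + 1 ≤ K → Real.exp (l - l ^ outerExp α τ (k + 1)) ≤
    Real.exp (l - l ^ midExp α τ k) * Real.exp (-l ^ a)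
  start : ∀ k : ℤ, 2 ≤ k → k + 1 ≤ K → bigW w (Real.exp (l - l ^ outerExp α τ (k + 1))) + 3 ≤
    1 / 4 * bigW w (Real.exp (l - l ^ midExp α τ k))
  second : bigW w (Real.exp (l - l ^ outerExp α τ 2)) + 7 ≤ 1 / 2 * bigW w (Real.exp l)
  upper : ∀ k : ℤ, 3 ≤ k → k ≤ K → 4 * bigW w (Real.exp (l - l ^ outerExp α τ k)) ≤
    bigW w (Real.exp (l - l ^ upperExp α τ k))

variable {w : ℕ → ℝ} {α τ a L : ℝ} {K : ℕ} {x : ℕ → ℤ} {T : ℕ}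

theorem Exponents.outerExp_lt_one (h : Exponents α τ K) {k : ℤ} (hk1 : 1 ≤ k) (hk : k ≤ K) :
    outerExp α τ k < 1 := by
  have h1 := h.lowerExp_lt_one hk
  have h2 := h.tau_pos
  have h3 : (1 : ℝ) ≤ k := by exact_mod_cast hk1
  have h4 : 1 * τ ≤ k * τ := by gcongr
  unfold lowerExp at h1
  unfold outerExp
  linarith

/-- At each site k ≥ 1, `upperExp` < `outerExp` < `midExp` < `lowerExp`, and `midExp` at k is below
`outerExp` at k + 1. A larger exponent means a smaller local time, and any gap between exponents
pays for constants and rounding. -/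
theorem Exponents.eventually_startScale (h : Exponents α τ K) (hw : IsLogPowerWeight α w)
    (ha : 0 < a) (haα : a < 1 - α) (L : ℝ) : ∀ᶠ l in atTop, StartScale w α τ a K L l := by
  have h0 := h.pos
  have h1 := h.lt_one
  have hτ := h.tau_pos
  have hS := hw.scaleBounds h0.le
  have hK2 : (2 : ℤ) ≤ K := by exact_mod_cast h.two_le
  have hall : ∀ {p : ℤ → ℝ → Prop} (A B : ℤ), (∀ k, A ≤ k → k ≤ B → ∀ᶠ l in atTop, p k l) →
      ∀ᶠ l : ℝ in atTop, ∀ k, A ≤ k → k ≤ B → p k l := by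
    intro p A B hp
    filter_upwards [(eventually_all_finite (Set.finite_Icc A B) (p := p) (l := atTop)).2
      fun k hk => hp k hk.1 hk.2] with l hl k h1 h2 using hl k ⟨h1, h2⟩
  have htau : τ < 1 - α := by
    have := h.small
    have hK : (2 : ℝ) ≤ K := by exact_mod_cast h.two_le
    nlinarith
  have hmo : ∀ k : ℤ, outerExp α τ k < midExp α τ k := fun k => by
    unfold outerExp midExp; linarith
  have hm1 : ∀ k : ℤ, 1 ≤ k → k ≤ K → midExp α τ k < 1 := by
    intro k hk1 hk
    have h1 := h.lowerExp_lt_one hk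
    have h3 : (1 : ℝ) ≤ k := by exact_mod_cast hk1
    have h4 : 1 * τ ≤ k * τ := by gcongr
    unfold lowerExp at h1
    unfold midExp
    linarith
  have ho : ∀ k : ℤ, 2 ≤ k → 1 - α < outerExp α τ k := by
    intro k hk
    have h3 : (2 : ℝ) ≤ k := by exact_mod_cast hk
    have h4 : 1 * (1 - α) ≤ (k - 1 : ℝ) * (1 - α) := by gcongr; linarith
    unfold outerExp
    linarith
  have hmo' : ∀ k : ℤ, midExp α τ k < outerExp α τ (k + 1) := fun k => by
    unfold outerExp midExp; push_cast; linarith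
  have e1 : ∀ᶠ l : ℝ in atTop, 16 + 4 * L ≤ Real.exp l :=
    Real.tendsto_exp_atTop.eventually_ge_atTop _
  have e2 := hall (p := fun k l => max L 2 ≤ Real.exp (l - l ^ midExp α τ k)) 2 K (by
    intro k hk1 hk
    filter_upwards [eventually_mul_rpow_le (hm1 k (by omega) hk) 2,
      (Real.tendsto_exp_atTop.comp (tendsto_id.atTop_div_const
        (by norm_num : (0 : ℝ) < 2))).eventually_ge_atTop (max L 2)] with l q1 q2
    rw [Real.rpow_one] at q1
    refine q2.trans (Real.exp_le_exp.2 ?_)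
    simp only [id_eq]
    linarith)
  have e3 := hall (p := fun k l => 3 * Real.exp (l - l ^ midExp α τ k) ≤
      Real.exp (l - l ^ outerExp α τ k)) 2 K (by
    intro k hk1 hk
    filter_upwards [eventually_mul_rpow_le (hmo k) 2,
      eventually_const_le_rpow ((by linarith : (0 : ℝ) < 1 - α).trans (ho k hk1)) (Real.log 3)]
      with l q1 q2
    rw [← Real.exp_log (by norm_num : (0 : ℝ) < 3), ← Real.exp_add]
    apply Real.exp_le_exp.2
    linarith)
  have e4 : ∀ᶠ l : ℝ in atTop,
      Real.exp (l - l ^ outerExp α τ 2) ≤ Real.exp l / 4 * Real.exp (-l ^ a) := by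
    filter_upwards [eventually_mul_rpow_le (haα.trans (ho 2 le_rfl)) 2,
      eventually_const_le_rpow ha (Real.log 4)] with l q1 q2
    rw [div_eq_mul_inv, ← Real.exp_log (by norm_num : (0 : ℝ) < 4), ← Real.exp_neg, ← Real.exp_add,
      ← Real.exp_add]
    apply Real.exp_le_exp.2
    linarith
  have e5 := hall (p := fun k l => Real.exp (l - l ^ outerExp α τ (k + 1)) ≤
      Real.exp (l - l ^ midExp α τ k) * Real.exp (-l ^ a)) 2 (K - 1) (by
    intro k hk1 hk
    filter_upwards [eventually_mul_rpow_le (hmo' k) 2,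
      eventually_mul_rpow_le (haα.trans (ho (k + 1) (by omega))) 2] with l q1 q2
    rw [← Real.exp_add]
    apply Real.exp_le_exp.2
    linarith)
  have e6 := hall (p := fun k l => bigW w (Real.exp (l - l ^ outerExp α τ (k + 1))) + 3 ≤
      1 / 4 * bigW w (Real.exp (l - l ^ midExp α τ k))) 2 (K - 1) (by
    intro k hk1 hk
    filter_upwards [hS.eventually_mul_add_le h0 h1 (hmo' k)
      (h.outerExp_lt_one (by omega) (by omega)) (ho _ (by omega)) 4 (by norm_num)] with l q1
    linarith)
  have e7 : ∀ᶠ l : ℝ in atTop,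
      bigW w (Real.exp (l - l ^ outerExp α τ 2)) + 7 ≤ 1 / 2 * bigW w (Real.exp l) := by
    filter_upwards [hS.eventually_mul_add_le h0 h1 (lt_trans (by linarith) (ho 2 le_rfl) :
      0 < outerExp α τ 2) (h.outerExp_lt_one (by omega) hK2) (ho _ le_rfl) 7 (by norm_num)]
      with l q1
    have q2 : bigW w (Real.exp (l - l ^ (0 : ℝ))) ≤ bigW w (Real.exp l) := by
      rw [bigW_le_iff hw.pos hw.mono (Real.exp_pos _).le (Real.exp_pos _).le, Real.rpow_zero]
      exact Real.exp_le_exp.2 (by linarith)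
    have q3 := hS.nonneg (l - l ^ outerExp α τ 2)
    linarith
  have e8 := hall (p := fun k l => 4 * bigW w (Real.exp (l - l ^ outerExp α τ k)) ≤
      bigW w (Real.exp (l - l ^ upperExp α τ k))) 3 K (by
    intro k hk1 hk
    have hk3 : (3 : ℝ) ≤ k := by exact_mod_cast hk1
    have h5 : 0 ≤ (k : ℝ) * τ := by positivity
    filter_upwards [hS.eventually_mul_add_le h0 h1 (p := outerExp α τ k) (q := upperExp α τ k)
      (by unfold upperExp outerExp; linarith)
      (h.outerExp_lt_one (by omega) (by omega)) (ho _ (by omega)) 4 (by norm_num)] with l q1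
    linarith)
  filter_upwards [e1, e2, e3, e4, e5, e6, e7, e8, eventually_ge_atTop 1]
    with l e1 e2 e3 e4 e5 e6 e7 e8 e9
  refine ⟨e1, e9, e2, fun k h2 h3 => ?_, e3, e4, fun k h2 h3 => e5 k h2 (by omega),
    fun k h2 h3 => e6 k h2 (by omega), e7, e8⟩
  apply Real.exp_le_exp.2
  have : l ^ midExp α τ k ≤ l ^ midExp α τ (k + 1) := by
    apply Real.rpow_le_rpow_of_exponent_le e9
    unfold midExp; push_cast; linarith
  linarith

/-- The starting configuration, on the right of the origin. -/
structure IsStartProfile (α τ L : ℝ) (K : ℕ) (x : ℕ → ℤ) (T : ℕ) : Prop where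
  visits : ∀ y : ℤ, |y| ≤ K → L ≤ visitsBefore x T y
  one_le : localTime x T 0 ≤ 2 * localTime x T 1 + 1
  le_zero : localTime x T 1 ≤ localTime x T 0
  symm : localTime x T (-1) = localTime x T 1
  inner : ∀ k : ℤ, 2 ≤ k → k ≤ K → Real.exp (Real.log (localTime x T 0) -
    Real.log (localTime x T 0) ^ midExp α τ k) ≤ localTime x T k
  outer : ∀ k : ℤ, 2 ≤ k → k ≤ K → (localTime x T k : ℝ) ≤ Real.exp (Real.log (localTime x T 0) -
    Real.log (localTime x T 0) ^ outerExp α τ k)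

theorem IsStartProfile.init (hw : IsLogPowerWeight α w) (he : Exponents α τ K) (ha : 0 < a)
    (hL : 0 < L)
    (hs : StartScale w α τ a K L (Real.log (localTime x T 0))) (h : IsStartProfile α τ L K x T) :
    CrudeInit w a L K x T ∧ FineInit w α τ K x T := by
  have hp := hw.pos
  have hm := hw.mono
  have hK2 : (2 : ℤ) ≤ K := by exact_mod_cast he.two_le
  have hZ : (0 : ℝ) < localTime x T 0 := by
    rcases Nat.eq_zero_or_pos (localTime x T 0) with h0 | h0
    · have := hs.one_le
      rw [h0] at this
      simp at this
      linarith
    · exact_mod_cast h0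
  have hlarge := hs.large
  have hdecay1 := hs.decay_one
  have hsecond := hs.second
  rw [Real.exp_log hZ] at hlarge hdecay1 hsecond
  have hl1 := hs.one_le
  have hinn := h.inner
  have hout := h.outer
  have hlein := hs.le_inner
  have hdec := hs.decay
  have hst := hs.start
  have hup := hs.upper
  set l := Real.log (localTime x T 0) with hl
  have hlow1 : (localTime x T 0 : ℝ) / 4 ≤ localTime x T 1 := by
    have : (localTime x T 0 : ℝ) ≤ 2 * localTime x T 1 + 1 := by exact_mod_cast h.one_le
    linarith
  have hexp : ∀ z : ℕ, 1 ≤ z → (z : ℝ) ≤ localTime x T 0 →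
      Real.exp (-l ^ a) ≤ Real.exp (-Real.log z ^ a) := by
    intro z hz hzl
    have h1 : (1 : ℝ) ≤ z := by exact_mod_cast hz
    apply Real.exp_le_exp.2
    apply neg_le_neg
    exact Real.rpow_le_rpow (Real.log_nonneg h1) (Real.log_le_log (by linarith) hzl) ha.le
  have hle0 : ∀ k : ℤ, 2 ≤ k → k ≤ K → (localTime x T k : ℝ) ≤ localTime x T 0 := by
    intro k h1 h2
    refine (hout k h1 h2).trans ?_
    rw [← Real.exp_log hZ]
    apply Real.exp_le_exp.2
    have : 0 ≤ l ^ outerExp α τ k := by positivity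
    linarith
  refine ⟨⟨h.visits, ⟨?_, ?_, ?_⟩, ?_, ?_, h.le_zero, ?_⟩, ⟨hinn, ?_⟩⟩
  · intro k hk1 hk2
    rcases hk1.eq_or_lt with rfl | hk1
    · refine ((hout (1 + 1) le_rfl hk2).trans hdecay1).trans ?_
      have h1 := hexp (localTime x T 1) (by
        have : (1 : ℝ) ≤ localTime x T 1 := by linarith
        exact_mod_cast this) (by exact_mod_cast h.le_zero)
      gcongr
    · refine ((hout (k + 1) (by omega) hk2).trans (hdec k (by omega) hk2)).trans ?_
      have h0 := (hlein k (by omega) (by omega)).trans (hinn k (by omega) (by omega))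
      have h1 := hexp (localTime x T k) (by
        have : (2 : ℝ) ≤ localTime x T k := (le_max_right _ _).trans h0
        exact_mod_cast (by linarith : (1 : ℝ) ≤ localTime x T k)) (hle0 k (by omega) (by omega))
      have h2 := hinn k (by omega) (by omega)
      gcongr
  · have : 1 ≤ localTime x T 1 := by
      have : (1 : ℝ) ≤ localTime x T 1 := by linarith
      exact_mod_cast this
    have := h.one_le
    omega
  · have h1 := hout 2 le_rfl hK2
    rw [← bigW_le_iff hp hm (Nat.cast_nonneg _) (Real.exp_pos _).le] at h1
    have h2 := bigW_nonneg hp hm (Nat.cast_nonneg (localTime x T 0) (α := ℝ))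
    linarith
  · intro k hk1 hk2
    have h1 := hout (k + 1) (by omega) hk2
    rw [← bigW_le_iff hp hm (Nat.cast_nonneg _) (Real.exp_pos _).le] at h1
    have h2 := hinn k hk1 (by omega)
    rw [← bigW_le_iff hp hm (Real.exp_pos _).le (Nat.cast_nonneg _)] at h2
    have h3 := hst k hk1 hk2
    linarith
  · have h1 := hout 2 le_rfl hK2
    rw [← bigW_le_iff hp hm (Nat.cast_nonneg _) (Real.exp_pos _).le] at h1
    linarith
  · rw [h.symm]; simp
  · intro k hk1 hk2
    have h1 := hout k (by omega) hk2
    rw [← bigW_le_iff hp hm (Nat.cast_nonneg _) (Real.exp_pos _).le] at h1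
    have h3 := hup k hk1 hk2
    linarith

theorem exists_isGoodStart (hw : IsLogPowerWeight α w) (he : Exponents α τ K) (ha : 0 < a)
    (haα : a < 1 - α) (hL : 0 < L) :
    ∃ (x : ℕ → ℤ) (T : ℕ), x 0 = 0 ∧ IsNNPath x T ∧ (∀ i ≤ T, |x i| ≤ K) ∧
      IsGoodStart w α τ a L K x T := by
  have hlim : Tendsto (fun m : ℕ => Real.log ((2 * m + 1 : ℕ) : ℝ)) atTop atTop := by
    apply Real.tendsto_log_atTop.comp
    apply tendsto_natCast_atTop_atTop.comp
    exact tendsto_atTop_mono (fun m => by simp only [id]; omega) tendsto_id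
  obtain ⟨m, hm⟩ := (hlim.eventually (he.eventually_startScale hw ha haα L)).exists
  set l := Real.log ((2 * m + 1 : ℕ) : ℝ) with hl
  set u : ℤ → ℝ := fun k => Real.exp (l - l ^ midExp α τ k) with hu
  -- c(i) counts round trips across {i, i+1}: m at the centre, otherwise the rounded target u(i+1).
  -- The local time at k ≥ 2 is then at least u(k) and at most 2 (u(k) + 1) ≤ 3 u(k).
  set c : ℕ → ℕ := fun i => if i = 0 then m else ⌈u (i + 1)⌉₊ with hc
  have hZ : (0 : ℝ) < ((2 * m + 1 : ℕ) : ℝ) := by positivity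
  have hlarge := hm.large
  have hdecay1 := hm.decay_one
  rw [Real.exp_log hZ] at hlarge hdecay1
  push_cast at hlarge hdecay1
  have hKn := he.two_le
  have hm7 : (7 : ℝ) ≤ m := by linarith
  have hm7' : 7 ≤ m := by exact_mod_cast hm7
  have hc1 : ∀ i, 1 ≤ c i := by
    intro i
    simp only [hc]
    split_ifs
    · omega
    · exact Nat.one_le_ceil_iff.2 (Real.exp_pos _)
  have hcu : ∀ i : ℕ, 1 ≤ i → u (i + 1) ≤ c i ∧ (c i : ℝ) ≤ u (i + 1) + 1 := by
    intro i hi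
    simp only [hc, if_neg (by omega : ¬ i = 0)]
    exact ⟨Nat.le_ceil _, (Nat.ceil_lt_add_one (Real.exp_pos _).le).le⟩
  -- This makes Z(1) = m + c(1) at most Z(0) = 2m + 1.
  have hc1m : c 1 ≤ m := by
    have h1 := (hcu 1 le_rfl).2
    have h2 := hm.inner_le 2 le_rfl (by exact_mod_cast hKn)
    have h3 : Real.exp (-l ^ a) ≤ 1 := Real.exp_le_one_iff.2 (by
      have : 0 ≤ l ^ a := Real.rpow_nonneg (by linarith [hm.one_le]) _
      linarith)
    have h4 : (2 * (m : ℝ) + 1) / 4 * Real.exp (-l ^ a) ≤ (2 * (m : ℝ) + 1) / 4 * 1 := by gcongr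
    have h5 : u ((1 : ℕ) + 1) = Real.exp (l - l ^ midExp α τ 2) := rfl
    rw [h5] at h1
    have h6 : (c 1 : ℝ) ≤ m := by linarith
    exact_mod_cast h6
  obtain ⟨x, T, a1, a2, a3, a4, z0, zs, zk, zK⟩ := exists_path_localTime hc1 (by omega : 1 ≤ K)
  have hc0 : c 0 = m := rfl
  rw [hc0] at z0
  have z1 : localTime x T 1 = m + c 1 := by
    have := zk 1 le_rfl (by omega)
    rw [Nat.sub_self, hc0] at this
    exact_mod_cast this
  have zin : ∀ k : ℤ, 2 ≤ k → k ≤ K → u k ≤ localTime x T k ∧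
      (localTime x T k : ℝ) ≤ Real.exp (l - l ^ outerExp α τ k) := by
    intro k hk1 hk2
    lift k to ℕ using by omega
    obtain ⟨q, rfl⟩ : ∃ q, k = q + 1 := ⟨k - 1, by omega⟩
    have b1 := hm.le_inner _ hk1 hk2
    have b2 := hm.inner_le _ hk1 hk2
    have b3 := (le_max_right _ _).trans b1
    obtain ⟨b4, b5⟩ := hcu q (by omega)
    have b6 : u ((q : ℤ) + 1) = Real.exp (l - l ^ midExp α τ ((q + 1 : ℕ) : ℤ)) := by
      simp only [hu]; push_cast; rfl
    rw [b6] at b4 b5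
    have b7 : u ((q + 1 : ℕ) : ℤ) = Real.exp (l - l ^ midExp α τ ((q + 1 : ℕ) : ℤ)) := rfl
    rw [b7]
    rcases (by omega : q + 1 = K ∨ q + 1 < K) with hq | hq
    · have hzK : localTime x T ((q + 1 : ℕ) : ℤ) = c q := by
        rw [hq, zK, ← hq, Nat.add_sub_cancel]
      rw [hzK]
      exact ⟨b4, by linarith⟩
    · rw [zk (q + 1) (by omega) hq, Nat.add_sub_cancel]
      obtain ⟨d1, d2⟩ := hcu (q + 1) (by omega)
      have d3 := hm.inner_anti ((q + 1 : ℕ) : ℤ) hk1 (by exact_mod_cast hq)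
      have d4 : u (((q + 1 : ℕ) : ℤ) + 1) =
        Real.exp (l - l ^ midExp α τ (((q + 1 : ℕ) : ℤ) + 1)) := rfl
      rw [d4] at d2
      push_cast at b4 b5 b2 b3 d2 d3 ⊢
      exact ⟨by linarith [Nat.cast_nonneg (α := ℝ) (c (q + 1))], by linarith⟩
  have hvis : ∀ y : ℤ, 0 ≤ y → y ≤ K → L ≤ visitsBefore x T y ∧ L ≤ visitsBefore x T (-y) := by
    intro y hy0 hyK
    rcases hy0.eq_or_lt with rfl | hy1
    · rw [neg_zero, and_self]
      have h1 := localTime_le_visitsBefore_add_one x T 0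
      rw [z0] at h1
      have : (2 * m : ℝ) ≤ visitsBefore x T 0 := by
        exact_mod_cast (by omega : 2 * m ≤ visitsBefore x T 0)
      linarith
    · have e1 : localTime x T y = visitsBefore x T y := by
        rw [localTime_eq_add, if_neg (by omega), add_zero]
      have e2 : localTime x T (-y) = visitsBefore x T (-y) := by
        rw [localTime_eq_add, if_neg (by omega), add_zero]
      rw [← e1, ← e2, zs, and_self]
      rcases (by omega : y = 1 ∨ 2 ≤ y) with rfl | hy2
      · rw [z1]
        push_cast
        linarith [Nat.cast_nonneg (α := ℝ) (c 1)]
      · exact ((le_max_left _ _).trans (hm.le_inner y hy2 hyK)).trans (zin y hy2 hyK).1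
  have hvis' : ∀ y : ℤ, |y| ≤ K → L ≤ visitsBefore x T y := by
    intro y hy
    rw [abs_le] at hy
    rcases le_total 0 y with h | h
    · exact (hvis y h hy.2).1
    · simpa using (hvis (-y) (by omega) (by omega)).2
  have hl0 : Real.log (localTime x T 0) = l := by rw [z0]
  have p1 : IsStartProfile α τ L K x T := by
    refine ⟨hvis', by rw [z0, z1]; omega, by rw [z0, z1]; omega, zs 1, ?_, ?_⟩
    · intro k h1 h2
      rw [hl0]; exact (zin k h1 h2).1
    · intro k h1 h2
      rw [hl0]; exact (zin k h1 h2).2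
  have p2 : IsStartProfile α τ L K (fun i => -x i) T := by
    refine ⟨fun y hy => ?_, ?_, ?_, ?_, ?_, ?_⟩
    · rw [visitsBefore_neg]; exact hvis' _ (by rwa [abs_neg])
    all_goals simp only [localTime_neg, neg_zero, zs]
    exacts [p1.one_le, p1.le_zero, p1.inner, p1.outer]
  have s1 : StartScale w α τ a K L (Real.log (localTime x T 0)) := by rw [hl0]; exact hm
  obtain ⟨c1, f1⟩ := p1.init hw he ha hL s1
  obtain ⟨c2, f2⟩ := p2.init hw he ha hL (by rw [localTime_neg, neg_zero]; exact s1)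
  exact ⟨x, T, a1, a2, a3, c1, c2, f1, f2⟩

end Start

end

end VRRW

/-! ### A model weight, the choice of α, and the conclusion -/

namespace VRRW

noncomputable section

section Model

variable {α : ℝ}

/-- A weight sequence equivalent to `k / exp (log^α k)`. -/
def modelWeight (α : ℝ) (k : ℕ) : ℝ :=
  Real.exp (Real.log ((k + 3 : ℕ) : ℝ) - Real.log ((k + 3 : ℕ) : ℝ) ^ α)

theorem one_le_log_add_three (k : ℕ) : 1 ≤ Real.log ((k + 3 : ℕ) : ℝ) := by
  have h0 : (0 : ℝ) < ((k + 3 : ℕ) : ℝ) := by positivity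
  rw [Real.le_log_iff_exp_le h0]
  have h1 : (3 : ℝ) ≤ ((k + 3 : ℕ) : ℝ) := by push_cast; linarith [Nat.cast_nonneg (α := ℝ) k]
  linarith [Real.exp_one_lt_d9]

/-- The shift by 3 puts the logarithm above 1, where l - l^α is increasing; log(k+3) - log k tends
to 0, so the equivalence is not affected. -/
theorem isLogPowerWeight_modelWeight (h0 : 0 < α) (h1 : α < 1) :
    IsLogPowerWeight α (modelWeight α) := by
  refine ⟨fun k => Real.exp_pos _, fun j k hjk => ?_, ?_⟩
  · apply Real.exp_le_exp.2
    apply sub_rpow_mono h1 (one_le_log_add_three j)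
    apply Real.log_le_log (by positivity)
    exact_mod_cast Nat.add_le_add_right hjk 3
  · apply Asymptotics.isEquivalent_of_tendsto_one
    have hlim : Tendsto (fun k : ℕ => Real.log ((k + 3 : ℕ) : ℝ) - Real.log (k : ℝ)) atTop (𝓝 0) := by
      have h3 : Tendsto (fun k : ℕ => Real.log (1 + 3 / (k : ℝ))) atTop (𝓝 (Real.log (1 + 0))) := by
        apply Tendsto.log _ (by norm_num)
        exact (tendsto_const_div_atTop_nhds_zero_nat 3).const_add 1
      rw [add_zero, Real.log_one] at h3
      refine h3.congr' ?_
      filter_upwards [eventually_gt_atTop 0] with k hk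
      have hk' : (0 : ℝ) < k := by exact_mod_cast hk
      rw [← Real.log_div (by positivity) hk'.ne']
      congr 1
      push_cast
      field_simp
    have hdiff : Tendsto (fun k : ℕ => (Real.log ((k + 3 : ℕ) : ℝ) - Real.log (k : ℝ)) -
        (Real.log ((k + 3 : ℕ) : ℝ) ^ α - Real.log (k : ℝ) ^ α)) atTop (𝓝 0) := by
      refine tendsto_of_tendsto_of_tendsto_of_le_of_le' tendsto_const_nhds hlim ?_ ?_
      all_goals
        filter_upwards [eventually_gt_atTop 0] with k hk
        have hk1 : (1 : ℝ) ≤ k := by exact_mod_cast hk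
        have hl0 : 0 ≤ Real.log (k : ℝ) := Real.log_nonneg hk1
        have hl : Real.log (k : ℝ) ≤ Real.log ((k + 3 : ℕ) : ℝ) :=
          Real.log_le_log (by linarith) (by push_cast; linarith)
        have hl1 := one_le_log_add_three k
      · have h2 := rpow_sub_rpow_le h1 hl0 hl (by linarith)
        have h3 : Real.log ((k + 3 : ℕ) : ℝ) ^ (α - 1) ≤ 1 :=
          Real.rpow_le_one_of_one_le_of_nonpos hl1 (by linarith)
        have h4 := mul_le_mul_of_nonneg_right h3 (sub_nonneg.2 hl)
        linarith
      · have := Real.rpow_le_rpow hl0 hl h0.le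
        linarith
    have h5 := (Real.continuous_exp.tendsto 0).comp hdiff
    rw [Real.exp_zero] at h5
    refine h5.congr' ?_
    filter_upwards [eventually_gt_atTop 0] with k hk
    have hk' : (0 : ℝ) < k := by exact_mod_cast hk
    simp only [Function.comp_apply, Pi.div_apply, modelWeight]
    have e : (k : ℝ) / Real.exp (Real.log k ^ α) = Real.exp (Real.log k - Real.log k ^ α) := by
      rw [Real.exp_sub, Real.exp_log hk']
    rw [e, ← Real.exp_sub]
    congr 1
    ring

theorem one_le_modelWeight_zero (h1 : α < 1) : 1 ≤ modelWeight α 0 := by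
  apply Real.one_le_exp
  have h2 := one_le_log_add_three 0
  have := Real.rpow_le_rpow_of_exponent_le h2 h1.le
  rw [Real.rpow_one] at this
  linarith

/-- With l = log(k+3) the term is exp(-2l + 2l^α), and eventually 2l^α ≤ l/2, leaving (k+3)^(-3/2).
-/
theorem summable_modelWeight (h1 : α < 1) : Summable fun j => 1 / modelWeight α j ^ 2 := by
  have hs : Summable fun k : ℕ => ((k + 3 : ℕ) : ℝ) ^ (-(3 / 2) : ℝ) :=
    (summable_nat_add_iff 3).2 (Real.summable_nat_rpow.2 (by norm_num))
  have hlog : Tendsto (fun k : ℕ => Real.log ((k + 3 : ℕ) : ℝ)) atTop atTop :=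
    Real.tendsto_log_atTop.comp (tendsto_natCast_atTop_atTop.comp (tendsto_add_atTop_nat 3))
  refine Summable.of_norm_bounded_eventually_nat hs ?_
  filter_upwards [hlog.eventually (eventually_mul_rpow_le h1 4)] with k hk
  rw [Real.rpow_one] at hk
  have h0 : (0 : ℝ) < ((k + 3 : ℕ) : ℝ) := by positivity
  rw [Real.norm_of_nonneg (by positivity), Real.rpow_def_of_pos h0, modelWeight, one_div,
    ← Real.exp_nat_mul, ← Real.exp_neg]
  apply Real.exp_le_exp.2
  push_cast at hk ⊢
  linarith

/-- The choice 1-α = t = 2/(2K-1) puts (K-1)(1-α) = 1 - t/2 at the midpoint of (α, 1), and τ =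
t/(8K) moves the exponents at K by t/8 only. -/
theorem exists_exponents {K : ℕ} (hK : 2 ≤ K) : ∃ α τ : ℝ, Exponents α τ K := by
  have hK' : (2 : ℝ) ≤ K := by exact_mod_cast hK
  have h1 : (0 : ℝ) < 2 * K - 1 := by linarith
  have ht : 0 < 2 / (2 * (K : ℝ) - 1) := by positivity
  have hm : 2 / (2 * (K : ℝ) - 1) * (2 * K - 1) = 2 := div_mul_cancel₀ _ h1.ne'
  set t := 2 / (2 * (K : ℝ) - 1)
  have hKτ : (K : ℝ) * (t / (8 * K)) = t / 8 := by field_simp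
  refine ⟨1 - t, t / (8 * K), hK, ?_, by linarith, by positivity, ?_, ?_, ?_⟩
  · nlinarith
  · linarith
  · unfold lowerExp
    push_cast
    rw [hKτ]
    linarith
  · unfold upperExp
    push_cast
    rw [hKτ]
    linarith

theorem exists_localizes_pos {K : ℕ} (hK : 2 ≤ K) :
    ∃ (α : ℝ) (w : ℕ → ℝ), α ∈ Ioo (0 : ℝ) 1 ∧ IsLogPowerWeight α w ∧
      ∃ (Ω : Type) (_ : MeasurableSpace Ω) (P : Measure Ω) (_ : IsProbabilityMeasure P)
        (X : ℕ → Ω → ℤ), IsVRRW P w X ∧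
        0 < P {ω | Localizes (fun n => X n ω) ∧
          (visitedInfinitelyOften (fun n => X n ω)).ncard = 2 * K + 1} := by
  obtain ⟨α, τ, he⟩ := exists_exponents hK
  have h0 := he.pos
  have h1 := he.lt_one
  have hw := isLogPowerWeight_modelWeight h0 h1
  have hw0 := one_le_modelWeight_zero h1
  have hs := summable_modelWeight h1
  obtain ⟨Ω, mΩ, P, hP, X, hX⟩ := exists_isVRRW hw.pos
  refine ⟨α, modelWeight α, ⟨h0, h1⟩, hw, Ω, mΩ, P, hP, X, hX, ?_⟩
  have ha : 0 < (1 - α) / 2 := by linarith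
  have haα : (1 - α) / 2 < 1 - α := by linarith
  have htail : ∀ᶠ L : ℝ in atTop, ∀ z : ℕ, L ≤ z →
      (2 * K + 1) * weightTail (modelWeight α) z + modelWeight α 0 * (2 * (1 / Real.log L)) < 1 := by
    have e1 : Tendsto (fun z => (2 * K + 1) * weightTail (modelWeight α) z) atTop (𝓝 0) := by
      simpa using (tendsto_weightTail (modelWeight α)).const_mul (2 * K + 1 : ℝ)
    have e2 : Tendsto (fun L : ℝ => modelWeight α 0 * (2 * (1 / Real.log L))) atTop (𝓝 0) := by
      have := (tendsto_inv_atTop_zero.comp Real.tendsto_log_atTop).const_mul (modelWeight α 0 * 2)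
      rw [mul_zero] at this
      refine this.congr fun L => ?_
      simp only [Function.comp_apply]
      ring
    obtain ⟨z0, hz0⟩ := eventually_atTop.1
      (e1.eventually (gt_mem_nhds (by norm_num : (0 : ℝ) < 1 / 2)))
    filter_upwards [e2.eventually (gt_mem_nhds (by norm_num : (0 : ℝ) < 1 / 2)),
      eventually_ge_atTop (z0 : ℝ)] with L q1 q2 z hz
    have := hz0 z (by exact_mod_cast q2.trans hz)
    linarith
  obtain ⟨L, ⟨⟨c1, c2⟩, c3⟩, c4⟩ := (((hw.eventually_crudeThreshold h0 h1 ha haα).and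
    (Real.tendsto_log_atTop.eventually (he.eventually_fineThreshold hw))).and
    (htail)).and (eventually_gt_atTop 0) |>.exists
  obtain ⟨x, T, a1, a2, a3, a4⟩ := exists_isGoodStart hw he ha haα c4
  exact hX.localizes_pos hw hw0 hs he ⟨c1, c2⟩ c3 a4 a1 a2 a3

end Model

end

end VRRW

theorem mainTheorem3 :
    (∀ (α : ℝ) (w : ℕ → ℝ), α ∈ Ioo (0 : ℝ) 1 → VRRW.IsLogPowerWeight α w →
      Tendsto (VRRW.iIndex w) (𝓝[<] (1 / 2 : ℝ)) (𝓝 (VRRW.iMinus w)) ∧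
      Tendsto (VRRW.iIndex w) (𝓝[>] (1 / 2 : ℝ)) (𝓝 (VRRW.iPlus w)) ∧
      VRRW.iMinus w < ⊤ ∧ VRRW.iPlus w < ⊤ ∧
      ∀ n : ℕ, 1 ≤ n → α ∈ Ioo (((n : ℝ) - 1) / n) ((n : ℝ) / (n + 1)) →
        VRRW.iMinus w = (n : ℕ∞) + 1 ∧ VRRW.iPlus w = (n : ℕ∞) + 1) ∧
    (∀ N : ℕ, Odd N → 5 ≤ N →
      ∃ (α : ℝ) (w : ℕ → ℝ), α ∈ Ioo (0 : ℝ) 1 ∧ VRRW.IsLogPowerWeight α w ∧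
        ∃ (Ω : Type) (_ : MeasurableSpace Ω) (P : Measure Ω) (_ : IsProbabilityMeasure P)
          (X : ℕ → Ω → ℤ), VRRW.IsVRRW P w X ∧
          0 < P {ω | VRRW.Localizes (fun n => X n ω) ∧
            (VRRW.visitedInfinitelyOften (fun n => X n ω)).ncard = N}) := by
  refine ⟨fun α w hα hw => VRRW.limits_of_isLogPowerWeight hw hα.1 hα.2, fun N hN hN5 => ?_⟩
  obtain ⟨K, rfl⟩ := hN
  exact VRRW.exists_localizes_pos (by omega)
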